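/- Let $d\ge 2$, $\delta,R,C^{\mathrm{in}}>0$ and $0<\gamma=\tau\le 1$. For $\varepsilon>0$ let $$M_\varepsilon(v)=\frac1\delta\Big(1+\exp\Big(\frac{|v|^2-R^2}{\varepsilon^\tau}\Big)\Big)^{-1},\qquad h(z,a)=z\log\frac za+(1-z)\log\frac{1-z}{1-a}\quad(0\le z\le1,\ 0<a<1),$$ with $0\log 0=0$. Let $f_\varepsilon(t,x,v)$, $\varepsilon>0$, be measurable on $[0,\infty)\times\mathbb R^d\times\mathbb R^d$ with $0\le f_\varepsilon\le\delta^{-1}$ a.e. and $$\frac1{\varepsilon^{2-\gamma}}\int_{\mathbb R^d\times\mathbb R^d}h(\delta f_\varepsilon,\delta M_\varepsilon)(t,x,v)\,dx\,dv\le C^{\mathrm{in}}\qquad\text{for a.e. }t\ge0\text{ and all }\varepsilon>0,$$ and set $g_\varepsilon=(f_\varepsilon-M_\varepsilon)/\varepsilon$. Let $\mathcal M_{\mathrm{loc}}$ be the space of locally finite signed Radon measures on $[0,\infty)\times\mathbb R^d\times\mathbb R^d$ with the weak-* topology (tested against continuous compactly supported functions), and let $d\omega=\delta_{\partial B(0,R)}$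 be the surface measure of $\partial B(0,R)$. Then the following hold. 1. For every $\varepsilon_0>0$ and every compact $K\subset\mathbb R^d$ there is $C<\infty$ such that for all $0<\varepsilon\le\varepsilon_0$ and a.e. $t\ge 0$ $$\int_{K\times\mathbb R^d}|g_\varepsilon(t,x,v)|(1+|v|^2)\,dx\,dv\le C.$$ Each $g_\varepsilon$ is locally integrable; identified with the measures $g_\varepsilon\,dt\,dx\,dv$, the family $\{g_\varepsilon:0<\varepsilon\le\varepsilon_0\}$ has compact closure in $\mathcal M_{\mathrm{loc}}$, and for every sequence $\varepsilon_n\to0^+$ the sequence $g_{\varepsilon_n}$ has a weakly-* convergent subsequence. 2. Let $\varphi(t,x,v)$ be continuous with $\varphi/(1+|v|^2)$ bounded, and let $\varepsilon_n\to0^+$. Then the integrals $$G_n(t,x,\sigma)=\int_0^\infty g_{\varepsilon_n}(t,x,r\sigma)\varphi(t,x,r\sigma)r^{d-1}\,dr$$ converge absolutely for a.e. $(t,x,\sigma)\in[0,\infty)\times\mathbb R^d\times\mathbb S^{d-1}$, the functions $G_n$ are locally integrable, and $\{G_n:n\in\mathbb N\}$ is relatively compact in $L^1_{\mathrm{loc}}([0,\infty)\times\mathbb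 R^d\times\mathbb S^{d-1})$ for the weak topology (tested against bounded measurable functions of compact support). 3. Let $\mu$ be a weak-* limit point of $g_\varepsilon$ as $\varepsilon\to0$, i.e. $\mu$ lies in the closure of $\{g_\varepsilon:0<\varepsilon\le\varepsilon_0\}$ in $\mathcal M_{\mathrm{loc}}$ for every $\varepsilon_0>0$. Then there is a measurable $g(t,x,\omega)$ on $[0,\infty)\times\mathbb R^d\times\partial B(0,R)$ with $$\mu=g\Big(t,x,R\frac v{|v|}\Big)\,dt\otimes dx\otimes\delta_{\partial B(0,R)}(v),\qquad \int_{\mathbb R^d\times\partial B(0,R)}g^2(t,x,\omega)\,dx\,d\omega\le\frac{C^{\mathrm{in}}}{R\delta^2}\quad\text{for a.e. }t\ge0;$$ in particular $g\in L^\infty([0,\infty);L^2(\mathbb R^d\times\partial B(0,R)))$. There is a sequence $\varepsilon_n\to0^+$ with $g_{\varepsilon_n}\to\mu$ weakly-*. For every sequence $\varepsilon_n\to 0^+$ with $g_{\varepsilon_n}\to\mu$ weakly-*, and every continuous $\varphi(t,x,v)$ that is compactly supported in $(t,x)$ and has $\varphi/(1+|v|^2)$ bounded, $g_{\varepsilon_n}\varphi$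 and $g\varphi$ are integrable for $dt\,dx\,dv$ and $dt\,dx\,d\omega$ respectively, and $$\int_{[0,\infty)\times\mathbb R^d\times\mathbb R^d}g_{\varepsilon_n}\varphi\,dt\,dx\,dv\longrightarrow\int_{[0,\infty)\times\mathbb R^d\times\partial B(0,R)}g\,\varphi\,dt\,dx\,d\omega.$$ -/

import Mathlib

open MeasureTheory Filter Topology Set
open scoped NNReal ENNReal CompactlySupported

namespace FermiGas

noncomputable section

/-! ### Locally finite signed Radon measures and the weak-star topology -/

/-- A locally finite signed Radon measure on `X`, given by its Jordan decomposition: two mutually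
singular regular (in particular finite on compact sets) nonnegative Borel measures. -/
@[ext]
structure LocRadonMeasure (X : Type*) [TopologicalSpace X] [MeasurableSpace X] where
  pos : Measure X
  neg : Measure X
  regular_pos : pos.Regular
  regular_neg : neg.Regular
  mutuallySingular : pos.MutuallySingular neg

namespace LocRadonMeasure

variable {X : Type*} [TopologicalSpace X] [MeasurableSpace X]

/-- The duality bracket `∫ φ dμ` of a signed Radon measure with a test function. -/
def pairing (μ : LocRadonMeasure X) (φ : X → ℝ) : ℝ :=
  (∫ x, φ x ∂μ.pos) - ∫ x, φ x ∂μ.neg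

/-- The weak-star topology: the coarsest topology for which `μ ↦ ∫ φ dμ` is continuous for every
continuous compactly supported `φ`. -/
instance : TopologicalSpace (LocRadonMeasure X) :=
  TopologicalSpace.induced (fun μ (φ : C_c(X, ℝ)) => μ.pairing φ) inferInstance

theorem regular_withDensity_ofReal [BorelSpace X] [TopologicalSpace.PseudoMetrizableSpace X]
    [LocallyCompactSpace X] [SecondCountableTopology X]
    {m : Measure X} [SFinite m] {f : X → ℝ} (hf : LocallyIntegrable f m) :
    (m.withDensity fun x => ENNReal.ofReal (f x)).Regular := by
  have hfin : IsFiniteMeasureOnCompacts (m.withDensity fun x => ENNReal.ofReal (f x)) := by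
    refine ⟨fun K hK => ?_⟩
    have hi : IntegrableOn f K m := hf.integrableOn_isCompact hK
    calc (m.withDensity fun x => ENNReal.ofReal (f x)) K
        = ∫⁻ x in K, ENNReal.ofReal (f x) ∂m := withDensity_apply' _ _
      _ < ∞ := by
        refine lt_of_le_of_lt (lintegral_mono fun x => ?_) hi.2
        exact Real.ofReal_le_enorm (f x)
  have : IsLocallyFiniteMeasure (m.withDensity fun x => ENNReal.ofReal (f x)) :=
    isLocallyFiniteMeasure_of_isFiniteMeasureOnCompacts
  infer_instance

/-- The signed Radon measure `f dm` with a locally integrable density `f` with respect to the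
measure `m`. -/
def ofDensity [BorelSpace X] [TopologicalSpace.PseudoMetrizableSpace X]
    [LocallyCompactSpace X] [SecondCountableTopology X]
    (m : Measure X) [SFinite m] (f : X → ℝ) (hf : LocallyIntegrable f m) : LocRadonMeasure X where
  pos := m.withDensity fun x => ENNReal.ofReal (f x)
  neg := m.withDensity fun x => ENNReal.ofReal (-f x)
  regular_pos := regular_withDensity_ofReal hf
  regular_neg := regular_withDensity_ofReal hf.neg
  mutuallySingular := by
    have hm : AEStronglyMeasurable f m := hf.aestronglyMeasurable
    have h1 : (fun x => ENNReal.ofReal (f x)) =ᵐ[m] fun x => ENNReal.ofReal (hm.mk f x) := by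
      filter_upwards [hm.ae_eq_mk] with x hx
      rw [hx]
    have h2 : (fun x => ENNReal.ofReal (-f x)) =ᵐ[m] fun x => ENNReal.ofReal (-hm.mk f x) := by
      filter_upwards [hm.ae_eq_mk] with x hx
      rw [hx]
    rw [withDensity_congr_ae h1, withDensity_congr_ae h2]
    exact withDensity_ofReal_mutuallySingular hm.stronglyMeasurable_mk.measurable

end LocRadonMeasure

/-! ### Locally integrable functions and their weak topology -/

/-- The space `L¹_loc(X, m)` of (almost everywhere classes of) locally integrable functions. -/
def LocL1 {X : Type*} [TopologicalSpace X] [MeasurableSpace X] (m : Measure X) : Type _ :=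
  {F : X →ₘ[m] ℝ // LocallyIntegrable F m}

namespace LocL1

variable {X : Type*} [TopologicalSpace X] [MeasurableSpace X] {m : Measure X}

/-- The dual of `L¹_loc`: bounded measurable functions with compact support. -/
def TestFunction (X : Type*) [TopologicalSpace X] [MeasurableSpace X] : Type _ :=
  {ψ : X → ℝ // Measurable ψ ∧ (∃ C : ℝ, ∀ x, |ψ x| ≤ C) ∧ HasCompactSupport ψ}

/-- The weak topology of `L¹_loc`: the coarsest topology for which `F ↦ ∫ F ψ dm` is continuous for
every bounded measurable compactly supported `ψ`. -/
instance : TopologicalSpace (LocL1 m) :=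
  TopologicalSpace.induced (fun F (ψ : TestFunction X) => ∫ x, F.1 x * ψ.1 x ∂m) inferInstance

/-- The class of a locally integrable function. -/
def mk (F : X → ℝ) (hm : AEStronglyMeasurable F m) (hF : LocallyIntegrable F m) : LocL1 m :=
  ⟨AEEqFun.mk F hm, hF.congr (AEEqFun.coeFn_mk F hm).symm⟩

end LocL1

/-! ### Phase space -/

/-- Euclidean space `ℝ^d`. -/
abbrev Sp (d : ℕ) : Type := EuclideanSpace ℝ (Fin d)

/-- Lebesgue measure `dt` on the time half-line `[0, ∞)`. -/
def timeMeasure : Measure ℝ≥0 := (volume : Measure ℝ).comap ((↑) : ℝ≥0 → ℝ)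

/-- The surface measure `dω = δ_{∂B(0,R)}` of the sphere of radius `R`, as a measure on `ℝ^d`: the
image of `R^(d-1) dσ` under `σ ↦ R σ`, where `dσ` is the surface measure of the unit sphere. -/
def surfaceMeasure (d : ℕ) (R : ℝ) : Measure (Sp d) :=
  ENNReal.ofReal (R ^ (d - 1)) •
    ((volume : Measure (Sp d)).toSphere).map fun σ : Metric.sphere (0 : Sp d) 1 => R • (σ : Sp d)

/-- The measure `dt dx dv` on `[0, ∞) × ℝ^d × ℝ^d`. -/
def phaseMeasure (d : ℕ) : Measure (ℝ≥0 × Sp d × Sp d) :=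
  timeMeasure.prod (volume.prod volume)

/-- The measure `dt dx dσ` on `[0, ∞) × ℝ^d × 𝕊^{d-1}`. -/
def rayMeasure (d : ℕ) : Measure (ℝ≥0 × Sp d × Metric.sphere (0 : Sp d) 1) :=
  timeMeasure.prod (volume.prod (volume : Measure (Sp d)).toSphere)

/-- The measure `dt ⊗ dx ⊗ δ_{∂B(0,R)}` on `[0, ∞) × ℝ^d × ℝ^d`. -/
def fermiMeasure (d : ℕ) (R : ℝ) : Measure (ℝ≥0 × Sp d × Sp d) :=
  timeMeasure.prod (volume.prod (surfaceMeasure d R))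

instance : SigmaFinite timeMeasure :=
  have he : MeasurableEmbedding ((↑) : ℝ≥0 → ℝ) :=
    MeasurableEmbedding.subtype_coe (measurableSet_Ici (a := (0 : ℝ)))
  SigmaFinite.of_map _ he.measurable.aemeasurable
    (by rw [timeMeasure, he.map_comap]; infer_instance)

instance (d : ℕ) (R : ℝ) : SFinite (surfaceMeasure d R) := by
  unfold surfaceMeasure; infer_instance

instance (d : ℕ) : SFinite (phaseMeasure d) := by
  unfold phaseMeasure; infer_instance

instance (d : ℕ) (R : ℝ) : SFinite (fermiMeasure d R) := by
  unfold fermiMeasure; infer_instance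

/-! ### Relative entropy and fluctuations -/

/-- The normalized Fermi–Dirac distribution `M_ε(v)` with temperature `ε^τ`. -/
def fermiDirac {d : ℕ} (δ R τ ε : ℝ) (v : Sp d) : ℝ :=
  δ⁻¹ * (1 + Real.exp ((‖v‖ ^ 2 - R ^ 2) / ε ^ τ))⁻¹

/-- The entropy density `h(z, a)`, for `0 ≤ z ≤ 1` and `0 < a < 1`, with `0 log 0 = 0`. -/
def entropyDensity (z a : ℝ) : ℝ :=
  z * Real.log (z / a) + (1 - z) * Real.log ((1 - z) / (1 - a))

/-- The relative entropy `H(f | M_ε) = ∫ h(δ f, δ M_ε) dx dv` in `[0, ∞]` (where `h ≥ 0`). -/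
def relativeEntropy {d : ℕ} (δ R τ ε : ℝ) (f : Sp d × Sp d → ℝ) : ℝ≥0∞ :=
  ∫⁻ p, ENNReal.ofReal (entropyDensity (δ * f p) (δ * fermiDirac δ R τ ε p.2))

/-- The fluctuation `g_ε = (f_ε - M_ε) / ε`. -/
def fluctuation {d : ℕ} (δ R τ : ℝ) (f : ℝ → ℝ≥0 × Sp d × Sp d → ℝ) (ε : ℝ)
    (p : ℝ≥0 × Sp d × Sp d) : ℝ :=
  (f ε p - fermiDirac δ R τ ε p.2.2) / ε

/-- A family of densities `0 ≤ f_ε(t,x,v) ≤ 1/δ`, `ε > 0`, satisfying the uniform relative entropy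
bound `ε^{-(2-γ)} H(f_ε(t) | M_ε) ≤ C^in` for (almost) every time. -/
structure UniformEntropyBound {d : ℕ} (δ R γ τ Cin : ℝ) (f : ℝ → ℝ≥0 × Sp d × Sp d → ℝ) :
    Prop where
  aestronglyMeasurable : ∀ ε, 0 < ε → AEStronglyMeasurable (f ε) (phaseMeasure d)
  bounds : ∀ ε, 0 < ε → ∀ᵐ p ∂phaseMeasure d, 0 ≤ f ε p ∧ f ε p ≤ δ⁻¹
  entropy : ∀ ε, 0 < ε → ∀ᵐ t ∂timeMeasure,
    ENNReal.ofReal (1 / ε ^ (2 - γ)) * relativeEntropy δ R τ ε (fun p => f ε (t, p))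
      ≤ ENNReal.ofReal Cin

/-! ### Test functions and radial averages -/

/-- `φ` is continuous and `φ / (1 + v²)` is bounded. -/
def QuadraticGrowth {d : ℕ} (φ : ℝ≥0 × Sp d × Sp d → ℝ) : Prop :=
  Continuous φ ∧ ∃ C : ℝ, ∀ p, |φ p| / (1 + ‖p.2.2‖ ^ 2) ≤ C

/-- `φ(t,x,v)` is compactly supported in `(t,x)`, uniformly in `v`. -/
def CompactInTimeSpace {d : ℕ} (φ : ℝ≥0 × Sp d × Sp d → ℝ) : Prop :=
  ∃ K : Set (ℝ≥0 × Sp d), IsCompact K ∧ ∀ t x v, (t, x) ∉ K → φ (t, x, v) = 0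

/-- The integrand `r ↦ g(t,x,rσ) φ(t,x,rσ) r^{d-1}` along the ray in direction `σ`. -/
def rayIntegrand {d : ℕ} (g φ : ℝ≥0 × Sp d × Sp d → ℝ)
    (q : ℝ≥0 × Sp d × Metric.sphere (0 : Sp d) 1) (r : ℝ) : ℝ :=
  g (q.1, q.2.1, r • (q.2.2 : Sp d)) * φ (q.1, q.2.1, r • (q.2.2 : Sp d)) * r ^ (d - 1)

/-- The radial average `(t,x,σ) ↦ ∫_0^∞ g(t,x,rσ) φ(t,x,rσ) r^{d-1} dr`. -/
def rayAverage {d : ℕ} (g φ : ℝ≥0 × Sp d × Sp d → ℝ)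
    (q : ℝ≥0 × Sp d × Metric.sphere (0 : Sp d) 1) : ℝ :=
  ∫ r in Ioi (0 : ℝ), rayIntegrand g φ q r

/-- The function `(t,x,v) ↦ g(t, x, R v/|v|)`. -/
def sphericalExtension {d : ℕ} (R : ℝ) (g : ℝ≥0 × Sp d × Sp d → ℝ)
    (p : ℝ≥0 × Sp d × Sp d) : ℝ :=
  g (p.1, p.2.1, (R / ‖p.2.2‖) • p.2.2)

end

end FermiGas

/-!
The proof rests on the duality of the relative entropy with exponentials. Write `z = δ f_ε`,
`a = δ M_ε = σ(-s)` with the sigmoid `σ` and the microscopic variable `s = (|v|² - R²) / ε^τ`.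
Young's inequality (`mul_sub_le_entropyDensity_add`) reads

  `λ (z - a) ≤ h(z, a) + λ² Q(λ, s)`,  `Q(λ, s) = ∫₀¹ (1 - y) σ'(λ y - s) dy`,

and the kernel satisfies `∫ Q(λ, s) ds = 1/2` for every `λ`, with exponential decay in `s`. At
`λ = ε^{1-τ} Ψ(t, x, v)`, after division by `ε^{2-τ}`, the left side becomes `δ g_ε Ψ` and the
entropy is bounded by `C^in`. In polar coordinates `v = r σ` the last term is integrated in `s`
along rays. Test functions of quadratic growth are allowed there:
`ε^{1-τ} |v|² = ε^{1-τ} R² + ε s` has small slope in `s`, so `Q` absorbs it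
(`exists_radialEnergy_le`). The choice `Ψ = ±k (1 + |v|²)` gives the uniform bound in the weighted
space (`exists_lintegral_fluctuation_le`).

As `ε → 0`, the last term converges to `R^{d-2} / 4 ∫ Ψ(t, x, R σ)² dσ` (`tendsto_radialEnergy`):
only the trace of `Ψ` on the Fermi sphere remains, and it enters quadratically. Hence the
functionals `Ψ ↦ ∫ g_ε Ψ` are asymptotically bounded by a Hilbert norm of the trace
(`exists_eventually_abs_functional_le`), the integral over all times being made finite by a weight
`e^{-t}` on the entropy inequality. A limit along an ultrafilter is therefore represented by an
element `F` of `L²` of the rays (`exists_tendsto_inner`), and separability of that space replaces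
ultrafilters by sequences (`exists_seq_tendsto_inner`). This holds on a space of test functions
that need only be measurable in `(t, x, σ)`, and continuous along rays at the Fermi sphere. It
thus contains at once the continuous compactly supported functions, for weak-star limits, and the
products `ψ(t, x, σ) φ(t, x, v)` with bounded measurable `ψ`, for the weak topology of `L¹_loc` on
radial averages. A function of quadratic growth differs from a compactly supported one by a
function with zero trace, which the limit does not see
(`tendsto_functional_of_tendsto_fluctuationMeasure`).

Choosing for `Ψ` the optimal multiple of truncations of `F` itself, localized in time, gives the
sharp bound (`ae_lintegral_rayDensity_sq_le`). The constant is `C^in / (R δ²)` once the density is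
taken with respect to the surface measure of the sphere of radius `R`.

Compactness in a topology induced by real functionals is reduced to boundedness, together with the
existence of limits along ultrafilters (`isCompact_closure_image_of_isInducing`). For the family
`0 < ε ≤ ε₀` there are also ultrafilters on which `ε` stays away from `0`. There the `g_ε` are
uniformly bounded and have limits with a density in a weighted `L²` (`exists_tendsto_of_le`).
Signed Radon measures are identified through their pairings by uniqueness of the Jordan
decomposition (`LocRadonMeasure.eq_of_pairing_eq`).
-/

namespace FermiGas

/-! ### The logistic profile and the entropy duality inequality -/

/-- The density `σ(1 - σ)` of the logistic law, which is the derivative of the sigmoid `σ`. -/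
noncomputable def logisticDensity (x : ℝ) : ℝ := Real.sigmoid x * (1 - Real.sigmoid x)

lemma logisticDensity_nonneg (x : ℝ) : 0 ≤ logisticDensity x :=
  mul_nonneg (Real.sigmoid_nonneg x) (sub_nonneg.2 (Real.sigmoid_le_one x))

lemma continuous_logisticDensity : Continuous logisticDensity := by
  unfold logisticDensity
  have := continuous_sigmoid
  fun_prop

lemma logisticDensity_le_exp_neg_abs (x : ℝ) : logisticDensity x ≤ Real.exp (-|x|) := by
  have h0 := Real.sigmoid_nonneg x
  have h1 := Real.sigmoid_le_one x
  have h2 : logisticDensity x = Real.sigmoid x * (Real.sigmoid x * Real.exp (-x)) := by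
    rw [Real.sigmoid_mul_rexp_neg, Real.sigmoid_neg, logisticDensity]
  have h3 : logisticDensity x = Real.sigmoid (-x) * (Real.sigmoid (-x) * Real.exp x) := by
    have := Real.sigmoid_mul_rexp_neg (-x)
    rw [neg_neg] at this
    rw [this, Real.sigmoid_neg, logisticDensity]
    ring
  rcases le_total 0 x with hx | hx
  · rw [abs_of_nonneg hx, h2]
    have := Real.exp_pos (-x)
    nlinarith [mul_le_mul h1 h1 h0 zero_le_one]
  · rw [abs_of_nonpos hx, neg_neg, h3]
    have := Real.exp_pos x
    have h4 := Real.sigmoid_nonneg (-x)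
    have h5 := Real.sigmoid_le_one (-x)
    nlinarith [mul_le_mul h5 h5 h4 zero_le_one]

lemma pow_mul_exp_neg_half_abs_le {A B : ℝ} (hA : 1 ≤ A) (hB : 1 ≤ B) (m : ℕ) :
    ∃ C : ℝ, 0 ≤ C ∧ ∀ s : ℝ, (A + B * |s|) ^ m * Real.exp (-(|s| / 2)) ≤ C * (1 + s ^ 2)⁻¹ := by
  refine ⟨(m + 2).factorial * (2 * B) ^ (m + 2) * Real.exp (A / (2 * B)), by positivity,
    fun s => ?_⟩
  have hs := abs_nonneg s
  have hX : 0 ≤ A + B * |s| := by positivity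
  have h1 : (A + B * |s|) ^ (m + 2) ≤ (m + 2).factorial * (2 * B) ^ (m + 2) *
      Real.exp (A / (2 * B)) * Real.exp (|s| / 2) := by
    have := Real.pow_div_factorial_le_exp ((A + B * |s|) / (2 * B)) (by positivity) (m + 2)
    rw [div_pow, div_div, div_le_iff₀ (by positivity)] at this
    have e : (A + B * |s|) / (2 * B) = A / (2 * B) + |s| / 2 := by field_simp
    rw [e, Real.exp_add] at this
    calc _ ≤ _ := this
      _ = _ := by ring
  have h2 : 1 + s ^ 2 ≤ (A + B * |s|) ^ 2 := by
    rw [← sq_abs s]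
    nlinarith [mul_le_mul hB hB zero_le_one (by linarith), mul_nonneg hs hs,
      mul_nonneg (mul_nonneg (by linarith : (0:ℝ) ≤ A) (by linarith : (0:ℝ) ≤ B)) hs]
  rw [← div_eq_mul_inv, le_div_iff₀ (by positivity)]
  calc (A + B * |s|) ^ m * Real.exp (-(|s| / 2)) * (1 + s ^ 2)
      ≤ (A + B * |s|) ^ m * Real.exp (-(|s| / 2)) * (A + B * |s|) ^ 2 := by gcongr
    _ = (A + B * |s|) ^ (m + 2) * Real.exp (-(|s| / 2)) := by ring
    _ ≤ ((m + 2).factorial * (2 * B) ^ (m + 2) *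
      Real.exp (A / (2 * B)) * Real.exp (|s| / 2)) * Real.exp (-(|s| / 2)) := by gcongr
    _ = _ := by rw [mul_assoc, ← Real.exp_add]; simp

lemma integrable_logisticDensity : Integrable logisticDensity := by
  obtain ⟨C, -, h⟩ := pow_mul_exp_neg_half_abs_le le_rfl le_rfl 0
  refine (integrable_inv_one_add_sq.const_mul C).mono'
    continuous_logisticDensity.aestronglyMeasurable (ae_of_all _ fun s => ?_)
  rw [Real.norm_of_nonneg (logisticDensity_nonneg s)]
  refine (logisticDensity_le_exp_neg_abs s).trans (le_trans ?_ (h s))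
  rw [pow_zero, one_mul]
  exact Real.exp_le_exp.2 (by linarith [abs_nonneg s])

lemma integral_logisticDensity : ∫ x, logisticDensity x = 1 := by
  simpa using integral_of_hasDerivAt_of_tendsto (f' := logisticDensity) Real.hasDerivAt_sigmoid
    integrable_logisticDensity Real.tendsto_sigmoid_atBot Real.tendsto_sigmoid_atTop

/-- The function `Q(λ, s) = ∫₀¹ (1 - y) σ'(λ y - s) dy`. With `a = σ(-s)`, Taylor's formula reads
`log(1 - a + a e^λ) - λ a = λ² Q(λ, s)`, so that `λ² Q` is the Legendre dual of the relative entropy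
density in the fluctuation variable `z - a`. -/
noncomputable def taylorKernel (l s : ℝ) : ℝ :=
  ∫ y in (0 : ℝ)..1, (1 - y) * logisticDensity (l * y - s)

lemma continuous_taylorKernel : Continuous fun p : ℝ × ℝ => taylorKernel p.1 p.2 := by
  have := continuous_logisticDensity
  exact intervalIntegral.continuous_parametric_intervalIntegral_of_continuous'
    (f := fun (p : ℝ × ℝ) y => (1 - y) * logisticDensity (p.1 * y - p.2)) (by
      simp only [Function.uncurry_def]; fun_prop) 0 1

lemma measurable_taylorKernel_comp {α : Type*} [MeasurableSpace α] {f g : α → ℝ} (hf : Measurable f)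
    (hg : Measurable g) : Measurable fun x => taylorKernel (f x) (g x) :=
  Measurable.comp (g := fun p : ℝ × ℝ => taylorKernel p.1 p.2) (f := fun x => (f x, g x))
    continuous_taylorKernel.measurable (hf.prodMk hg)

lemma taylorKernel_nonneg (l s : ℝ) : 0 ≤ taylorKernel l s :=
  intervalIntegral.integral_nonneg zero_le_one fun _ hy =>
    mul_nonneg (sub_nonneg.2 hy.2) (logisticDensity_nonneg _)

lemma taylorKernel_le (l s : ℝ) : taylorKernel l s ≤ Real.exp (|l| - |s|) := by
  have := continuous_logisticDensity
  calc taylorKernel l s ≤ ∫ _ in (0 : ℝ)..1, Real.exp (|l| - |s|) := by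
        refine intervalIntegral.integral_mono_on zero_le_one
          (Continuous.intervalIntegrable (by fun_prop) _ _) (by simp) fun y hy => ?_
        have h1 := logisticDensity_le_exp_neg_abs (l * y - s)
        have h2 := logisticDensity_nonneg (l * y - s)
        have h3 : Real.exp (-|l * y - s|) ≤ Real.exp (|l| - |s|) := by
          apply Real.exp_le_exp.2
          have h4 : |l * y| ≤ |l| := by
            rw [abs_mul, abs_of_nonneg hy.1]
            exact mul_le_of_le_one_right (abs_nonneg _) hy.2
          have h5 := abs_sub_abs_le_abs_sub s (l * y)
          rw [abs_sub_comm] at h5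
          linarith
        nlinarith [hy.1, hy.2]
    _ = _ := by simp

lemma lintegral_taylorKernel (l : ℝ) :
    ∫⁻ s, ENNReal.ofReal (taylorKernel l s) = ENNReal.ofReal (1 / 2) := by
  have hc := continuous_logisticDensity
  have hp : ∫⁻ s, ENNReal.ofReal (logisticDensity s) = 1 := by
    rw [← ofReal_integral_eq_lintegral_ofReal integrable_logisticDensity
      (ae_of_all _ logisticDensity_nonneg), integral_logisticDensity, ENNReal.ofReal_one]
  have h1 : ∀ s, ENNReal.ofReal (taylorKernel l s) =
      ∫⁻ y in Ioc (0 : ℝ) 1, ENNReal.ofReal ((1 - y) * logisticDensity (l * y - s)) := by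
    intro s
    rw [taylorKernel, intervalIntegral.integral_of_le zero_le_one,
      ofReal_integral_eq_lintegral_ofReal]
    · exact (Continuous.intervalIntegrable (by fun_prop) 0 1).1
    · filter_upwards [ae_restrict_mem measurableSet_Ioc] with y hy
      exact mul_nonneg (sub_nonneg.2 hy.2) (logisticDensity_nonneg _)
  simp_rw [h1]
  rw [lintegral_lintegral_swap (by
    simp only [Function.uncurry_def]
    exact (Continuous.measurable (by fun_prop)).ennreal_ofReal.aemeasurable)]
  have h2 : ∀ y ∈ Ioc (0 : ℝ) 1, ∫⁻ s, ENNReal.ofReal ((1 - y) * logisticDensity (l * y - s)) =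
      ENNReal.ofReal (1 - y) := by
    intro y hy
    simp_rw [ENNReal.ofReal_mul (sub_nonneg.2 hy.2)]
    rw [lintegral_const_mul _ (Continuous.measurable (by fun_prop)).ennreal_ofReal,
      lintegral_sub_left_eq_self (fun s => ENNReal.ofReal (logisticDensity s)), hp, mul_one]
  rw [setLIntegral_congr_fun measurableSet_Ioc h2, ← ofReal_integral_eq_lintegral_ofReal,
    ← intervalIntegral.integral_of_le zero_le_one]
  · congr 1
    rw [intervalIntegral.integral_sub (by simp) (by simp)]
    simp
    norm_num
  · exact (Continuous.intervalIntegrable (by fun_prop) 0 1).1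
  · filter_upwards [ae_restrict_mem measurableSet_Ioc] with y hy
    exact sub_nonneg.2 hy.2

lemma hasDerivAt_log_one_add_exp (x : ℝ) :
    HasDerivAt (fun x => Real.log (1 + Real.exp x)) (Real.sigmoid x) x := by
  have h := ((Real.hasDerivAt_exp x).const_add 1).log (by positivity)
  convert h using 1
  rw [Real.sigmoid_def, Real.exp_neg]
  have := Real.exp_pos x
  field_simp
  ring

lemma sq_mul_taylorKernel (l s : ℝ) :
    l ^ 2 * taylorKernel l s =
      Real.log (1 + Real.exp (l - s)) - Real.log (1 + Real.exp (-s)) - l * Real.sigmoid (-s) := by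
  have hc := continuous_logisticDensity
  have key : ∀ y ∈ uIcc (0 : ℝ) 1, HasDerivAt
      (fun y => l * (1 - y) * Real.sigmoid (l * y - s) + Real.log (1 + Real.exp (l * y - s)))
      (l ^ 2 * ((1 - y) * logisticDensity (l * y - s))) y := by
    intro y _
    have h0 : HasDerivAt (fun y => l * y - s) l y := by
      simpa using ((hasDerivAt_id y).const_mul l).sub_const s
    have h1 : HasDerivAt (fun y => l * (1 - y)) (-l) y := by
      simpa using ((hasDerivAt_id y).const_sub 1).const_mul l
    have h2 := (Real.hasDerivAt_sigmoid (l * y - s)).comp y h0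
    have h3 := (hasDerivAt_log_one_add_exp (l * y - s)).comp y h0
    refine ((h1.mul h2).add h3).congr_deriv ?_
    simp only [logisticDensity, Function.comp_def]
    ring
  rw [taylorKernel, ← intervalIntegral.integral_const_mul,
    intervalIntegral.integral_eq_sub_of_hasDerivAt key
      (Continuous.intervalIntegrable (by fun_prop) _ _)]
  simp
  ring

lemma sub_le_mul_log_div {z b : ℝ} (hz : 0 ≤ z) (hb : 0 < b) : z - b ≤ z * Real.log (z / b) := by
  rcases hz.eq_or_lt with rfl | hz
  · simp [hb.le]
  · have h := Real.log_le_sub_one_of_pos (div_pos hb hz)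
    have h2 : Real.log (z / b) = -Real.log (b / z) := by
      rw [← Real.log_inv, inv_div]
    rw [h2]
    have h3 : z * (b / z) = b := by field_simp
    nlinarith

/-- Young's inequality for the relative entropy density, at the equilibrium value `a = σ(-s)`. It is
the nonnegativity of the entropy of `z` relative to the tilted value `σ(λ - s)`. -/
lemma mul_sub_le_entropyDensity_add {z : ℝ} (hz0 : 0 ≤ z) (hz1 : z ≤ 1) (l s : ℝ) :
    l * (z - Real.sigmoid (-s)) ≤
      entropyDensity z (Real.sigmoid (-s)) + l ^ 2 * taylorKernel l s := by
  have hform : ∀ x : ℝ, z * Real.log (z / Real.sigmoid x) = z * Real.log z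
      - z * (x - Real.log (1 + Real.exp x)) := by
    intro x
    have hs : Real.sigmoid x = Real.exp x / (1 + Real.exp x) := by
      rw [Real.sigmoid_def, Real.exp_neg]
      have := Real.exp_pos x
      field_simp
      ring
    rcases hz0.eq_or_lt with rfl | hz
    · simp
    · rw [Real.log_div hz.ne' (Real.sigmoid_pos x).ne', hs,
        Real.log_div (Real.exp_pos x).ne' (by positivity), Real.log_exp]
      ring
  have hform' : ∀ x : ℝ, (1 - z) * Real.log ((1 - z) / (1 - Real.sigmoid x)) =
      (1 - z) * Real.log (1 - z) + (1 - z) * Real.log (1 + Real.exp x) := by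
    intro x
    have hs : 1 - Real.sigmoid x = (1 + Real.exp x)⁻¹ := by
      rw [← Real.sigmoid_neg, Real.sigmoid_def, neg_neg]
    rcases hz1.eq_or_lt with rfl | hz
    · simp
    · rw [hs, div_inv_eq_mul, Real.log_mul (by linarith) (by positivity)]
      ring
  have h1 := sub_le_mul_log_div hz0 (Real.sigmoid_pos (l - s))
  have h2 := sub_le_mul_log_div (sub_nonneg.2 hz1)
    (sub_pos.2 (Real.sigmoid_lt_one (l - s)))
  rw [hform] at h1
  rw [hform'] at h2
  rw [sq_mul_taylorKernel, entropyDensity, hform, hform']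
  linarith

lemma entropyDensity_nonneg {z : ℝ} (hz0 : 0 ≤ z) (hz1 : z ≤ 1) (s : ℝ) :
    0 ≤ entropyDensity z (Real.sigmoid (-s)) := by
  simpa using mul_sub_le_entropyDensity_add hz0 hz1 0 s

/-! ### Concentration of the dual functional on the Fermi sphere -/

/-- The dual of the scaled relative entropy on a ray: the integral of
`ε^{-(2-τ)} (λ² Q)(λ, s)` at `λ = ε^{1-τ} ψ(r)` and `s = (r² - R²) / ε^τ`, with respect to
`r^{d-1} dr`. -/
noncomputable def radialEnergy (d : ℕ) (R τ ε : ℝ) (ψ : ℝ → ℝ) : ℝ≥0∞ :=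
  ∫⁻ r in Ioi (0 : ℝ), ENNReal.ofReal ((ε ^ τ)⁻¹ * ψ r ^ 2 *
    taylorKernel (ε ^ (1 - τ) * ψ r) ((r ^ 2 - R ^ 2) / ε ^ τ) * r ^ (d - 1))

/-- The integrand of `radialEnergy` in the microscopic variable `s = (r² - R²) / ε^τ`. -/
noncomputable def layerIntegrand (d : ℕ) (R τ ε : ℝ) (ψ : ℝ → ℝ) (s : ℝ) : ℝ :=
  1 / 2 * ψ √(R ^ 2 + ε ^ τ * s) ^ 2 * taylorKernel (ε ^ (1 - τ) * ψ √(R ^ 2 + ε ^ τ * s)) s *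
    √(R ^ 2 + ε ^ τ * s) ^ (d - 2)

lemma radialEnergy_eq_lintegral_layerIntegrand {d : ℕ} (hd : 2 ≤ d) (R τ : ℝ) {ε : ℝ} (hε : 0 < ε)
    (ψ : ℝ → ℝ) :
    radialEnergy d R τ ε ψ =
      ∫⁻ s in Ioi (-R ^ 2 / ε ^ τ), ENNReal.ofReal (layerIntegrand d R τ ε ψ s) := by
  have hκ : 0 < ε ^ τ := Real.rpow_pos_of_pos hε τ
  set κ := ε ^ τ with hκdef
  have himg : (fun r : ℝ => (r ^ 2 - R ^ 2) / κ) '' Ioi 0 = Ioi (-R ^ 2 / κ) := by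
    ext s
    constructor
    · rintro ⟨r, hr, rfl⟩
      have hr' : 0 < r := hr
      simp only [mem_Ioi]
      gcongr
      nlinarith
    · intro hs
      have hs' : 0 < R ^ 2 + κ * s := by
        rw [mem_Ioi, div_lt_iff₀ hκ] at hs
        linarith
      refine ⟨√(R ^ 2 + κ * s), Real.sqrt_pos.2 hs', ?_⟩
      simp only
      rw [Real.sq_sqrt hs'.le]
      field_simp
      ring
  have hder : ∀ r ∈ Ioi (0 : ℝ), HasDerivWithinAt (fun r : ℝ => (r ^ 2 - R ^ 2) / κ)
      (2 * r / κ) (Ioi 0) r := by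
    intro r _
    have := (((hasDerivAt_id r).pow 2).sub_const (R ^ 2)).div_const κ
    refine (this.congr_deriv ?_).hasDerivWithinAt
    simp
  have hinj : InjOn (fun r : ℝ => (r ^ 2 - R ^ 2) / κ) (Ioi 0) := by
    intro a ha b hb hab
    have ha' : 0 < a := ha
    have hb' : 0 < b := hb
    simp only at hab
    rw [div_left_inj' hκ.ne', sub_left_inj] at hab
    exact (pow_left_inj₀ ha'.le hb'.le two_ne_zero).1 hab
  rw [← himg, lintegral_image_eq_lintegral_abs_deriv_mul measurableSet_Ioi hder hinj, radialEnergy]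
  refine setLIntegral_congr_fun measurableSet_Ioi fun r hr => ?_
  have hr' : 0 < r := hr
  have hsq : R ^ 2 + κ * ((r ^ 2 - R ^ 2) / κ) = r ^ 2 := by field_simp; ring
  simp only [layerIntegrand, ← hκdef]
  rw [hsq, Real.sqrt_sq hr'.le, ← ENNReal.ofReal_mul (abs_nonneg _),
    abs_of_pos (by positivity : 0 < 2 * r / κ)]
  congr 1
  obtain ⟨k, rfl⟩ := Nat.exists_eq_add_of_le hd
  have e1 : 2 + k - 1 = k + 1 := by omega
  have e2 : 2 + k - 2 = k := by omega
  rw [e1, e2]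
  field_simp
  ring

/-- Test functions of quadratic growth are admissible in the entropy duality: as
`ε^{1-τ} r² = ε^{1-τ} R² + ε s`, they grow linearly in `s` with a small slope, and are absorbed by
the exponential decay of the kernel. -/
lemma exists_layerIntegrand_le (d : ℕ) (R : ℝ) {τ : ℝ} (hτ0 : 0 < τ) (hτ1 : τ ≤ 1) {B ε₀ : ℝ}
    (hB : 0 ≤ B) (hε₀ : 0 < ε₀) (hBε : B * ε₀ ≤ 1 / 2) :
    ∃ D : ℝ, 0 ≤ D ∧ ∀ ε ∈ Ioc 0 ε₀, ∀ ψ : ℝ → ℝ, (∀ r, 0 < r → |ψ r| ≤ B * (1 + r ^ 2)) →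
      ∀ s ∈ Ioi (-R ^ 2 / ε ^ τ), layerIntegrand d R τ ε ψ s ≤ D * (1 + s ^ 2)⁻¹ := by
  have hκ₀ : 0 < ε₀ ^ τ := Real.rpow_pos_of_pos hε₀ τ
  have hc₀ : 0 < ε₀ ^ (1 - τ) := Real.rpow_pos_of_pos hε₀ _
  obtain ⟨C, hC, hCs⟩ := pow_mul_exp_neg_half_abs_le (A := 1 + R ^ 2) (B := 1 + ε₀ ^ τ)
    (by nlinarith [sq_nonneg R]) (by linarith) (d - 2 + 2)
  refine ⟨1 / 2 * B ^ 2 * Real.exp (ε₀ ^ (1 - τ) * (B * (1 + R ^ 2))) * C, by positivity,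
    fun ε hε ψ hψ s hs => ?_⟩
  have hε0 : 0 < ε := hε.1
  have hκ : 0 < ε ^ τ := Real.rpow_pos_of_pos hε0 τ
  have hc : 0 < ε ^ (1 - τ) := Real.rpow_pos_of_pos hε0 _
  have hκle : ε ^ τ ≤ ε₀ ^ τ := Real.rpow_le_rpow hε0.le hε.2 hτ0.le
  have hcle : ε ^ (1 - τ) ≤ ε₀ ^ (1 - τ) := Real.rpow_le_rpow hε0.le hε.2 (by linarith)
  have hcκ : ε ^ (1 - τ) * ε ^ τ = ε := by
    rw [← Real.rpow_add hε0]; simp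
  have hu : 0 < R ^ 2 + ε ^ τ * s := by
    rw [mem_Ioi, div_lt_iff₀ hκ] at hs
    linarith
  set ρ := √(R ^ 2 + ε ^ τ * s) with hρ
  have hρ0 : 0 < ρ := Real.sqrt_pos.2 hu
  have hρ2 : ρ ^ 2 = R ^ 2 + ε ^ τ * s := Real.sq_sqrt hu.le
  set X := 1 + R ^ 2 + (1 + ε₀ ^ τ) * |s| with hX
  have hX1 : 1 + ρ ^ 2 ≤ X := by
    have : ε ^ τ * s ≤ (1 + ε₀ ^ τ) * |s| := by
      calc ε ^ τ * s ≤ ε ^ τ * |s| := by gcongr; exact le_abs_self s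
        _ ≤ (1 + ε₀ ^ τ) * |s| := by gcongr; linarith
    rw [hρ2]
    linarith
  have hψρ := hψ ρ hρ0
  have h1 : ψ ρ ^ 2 ≤ B ^ 2 * X ^ 2 := by
    rw [← sq_abs, ← mul_pow]
    gcongr
    exact hψρ.trans (by gcongr)
  have h2 : ρ ^ (d - 2) ≤ X ^ (d - 2) := by
    gcongr
    nlinarith [sq_nonneg (ρ - 1)]
  have h3 : taylorKernel (ε ^ (1 - τ) * ψ ρ) s ≤
      Real.exp (ε₀ ^ (1 - τ) * (B * (1 + R ^ 2))) * Real.exp (-(|s| / 2)) := by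
    refine (taylorKernel_le _ _).trans ?_
    rw [← Real.exp_add]
    apply Real.exp_le_exp.2
    have h4 : |ε ^ (1 - τ) * ψ ρ| ≤ ε ^ (1 - τ) * (B * (1 + R ^ 2)) + B * ε * s := by
      rw [abs_mul, abs_of_pos hc]
      calc ε ^ (1 - τ) * |ψ ρ| ≤ ε ^ (1 - τ) * (B * (1 + ρ ^ 2)) := by gcongr
        _ = ε ^ (1 - τ) * (B * (1 + R ^ 2)) + B * (ε ^ (1 - τ) * ε ^ τ) * s := by
            rw [hρ2]; ring
        _ = _ := by rw [hcκ]
    have h5 : B * ε * s ≤ 1 / 2 * |s| := by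
      calc B * ε * s ≤ B * ε * |s| := by gcongr; exact le_abs_self s
        _ ≤ B * ε₀ * |s| := by gcongr; exact hε.2
        _ ≤ _ := by gcongr
    have h6 : ε ^ (1 - τ) * (B * (1 + R ^ 2)) ≤ ε₀ ^ (1 - τ) * (B * (1 + R ^ 2)) := by gcongr
    linarith
  have h0 := taylorKernel_nonneg (ε ^ (1 - τ) * ψ ρ) s
  calc layerIntegrand d R τ ε ψ s
      = 1 / 2 * ψ ρ ^ 2 * taylorKernel (ε ^ (1 - τ) * ψ ρ) s * ρ ^ (d - 2) := rfl
    _ ≤ 1 / 2 * (B ^ 2 * X ^ 2) * (Real.exp (ε₀ ^ (1 - τ) * (B * (1 + R ^ 2))) *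
          Real.exp (-(|s| / 2))) * X ^ (d - 2) := by gcongr
    _ = 1 / 2 * B ^ 2 * Real.exp (ε₀ ^ (1 - τ) * (B * (1 + R ^ 2))) *
          (X ^ (d - 2 + 2) * Real.exp (-(|s| / 2))) := by ring
    _ ≤ 1 / 2 * B ^ 2 * Real.exp (ε₀ ^ (1 - τ) * (B * (1 + R ^ 2))) * (C * (1 + s ^ 2)⁻¹) :=
        mul_le_mul_of_nonneg_left (hCs s) (by positivity)
    _ = _ := by ring

lemma exists_radialEnergy_le {d : ℕ} (hd : 2 ≤ d) (R : ℝ) {τ : ℝ} (hτ0 : 0 < τ) (hτ1 : τ ≤ 1)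
    {B ε₀ : ℝ} (hB : 0 ≤ B) (hε₀ : 0 < ε₀) (hBε : B * ε₀ ≤ 1 / 2) :
    ∃ D : ℝ≥0, ∀ ε ∈ Ioc 0 ε₀, ∀ ψ : ℝ → ℝ, (∀ r, 0 < r → |ψ r| ≤ B * (1 + r ^ 2)) →
      radialEnergy d R τ ε ψ ≤ D := by
  obtain ⟨D, hD, h⟩ := exists_layerIntegrand_le d R hτ0 hτ1 hB hε₀ hBε
  have hfin : ∫⁻ s : ℝ, ENNReal.ofReal (D * (1 + s ^ 2)⁻¹) ≠ ∞ :=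
    (integrable_inv_one_add_sq.const_mul D).lintegral_lt_top.ne
  refine ⟨(∫⁻ s : ℝ, ENNReal.ofReal (D * (1 + s ^ 2)⁻¹)).toNNReal, fun ε hε ψ hψ => ?_⟩
  rw [ENNReal.coe_toNNReal hfin, radialEnergy_eq_lintegral_layerIntegrand hd R τ hε.1]
  refine (setLIntegral_mono' measurableSet_Ioi fun s hs => ?_).trans (setLIntegral_le_lintegral _ _)
  exact ENNReal.ofReal_le_ofReal (h ε hε ψ hψ s hs)

/-- In the limit `ε → 0` the dual functional becomes quadratic and only sees the value on the Fermi
sphere, whether `τ < 1`, when `ε^{1-τ} ψ → 0`, or `τ = 1`, since `∫ Q(λ, s) ds = 1/2` for all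
`λ`. -/
lemma tendsto_radialEnergy {d : ℕ} (hd : 2 ≤ d) {R : ℝ} (hR : 0 < R) {τ : ℝ} (hτ0 : 0 < τ)
    (hτ1 : τ ≤ 1) {B : ℝ} {ψ : ℝ → ℝ} (hm : Measurable ψ) (hc : ContinuousAt ψ R)
    (hψ : ∀ r, 0 < r → |ψ r| ≤ B * (1 + r ^ 2)) :
    Tendsto (fun ε => radialEnergy d R τ ε ψ) (𝓝[>] 0)
      (𝓝 (ENNReal.ofReal (R ^ (d - 2) / 4 * ψ R ^ 2))) := by
  have hB : 0 ≤ B := by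
    have h := (abs_nonneg _).trans (hψ 1 one_pos)
    linarith
  set ε₀ : ℝ := (2 * (B + 1))⁻¹ with hε₀def
  have hε₀ : 0 < ε₀ := by positivity
  have hBε : B * ε₀ ≤ 1 / 2 := by
    rw [hε₀def, ← div_eq_mul_inv, div_le_div_iff₀ (by positivity) two_pos]
    linarith
  obtain ⟨D, hD, h⟩ := exists_layerIntegrand_le d R hτ0 hτ1 hB hε₀ hBε
  have hfin : ∫⁻ s : ℝ, ENNReal.ofReal (D * (1 + s ^ 2)⁻¹) ≠ ∞ :=
    (integrable_inv_one_add_sq.const_mul D).lintegral_lt_top.ne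
  have hsmall : ∀ᶠ ε : ℝ in 𝓝[>] 0, ε ∈ Ioc 0 ε₀ := Ioc_mem_nhdsGT hε₀
  have hκ : Tendsto (fun ε : ℝ => ε ^ τ) (𝓝[>] 0) (𝓝 0) := by
    have := (Real.continuousAt_rpow_const 0 τ (Or.inr hτ0.le)).tendsto
    rw [Real.zero_rpow hτ0.ne'] at this
    exact this.mono_left nhdsWithin_le_nhds
  obtain ⟨c₀, hc₀⟩ : ∃ c₀, Tendsto (fun ε : ℝ => ε ^ (1 - τ)) (𝓝[>] 0) (𝓝 c₀) :=
    ⟨_, (Real.continuousAt_rpow_const 0 (1 - τ) (Or.inr (by linarith))).tendsto.mono_left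
      nhdsWithin_le_nhds⟩
  have hlim : ∫⁻ s, ENNReal.ofReal (1 / 2 * ψ R ^ 2 * taylorKernel (c₀ * ψ R) s * R ^ (d - 2)) =
      ENNReal.ofReal (R ^ (d - 2) / 4 * ψ R ^ 2) := by
    have hp : 0 ≤ 1 / 2 * ψ R ^ 2 * R ^ (d - 2) := by positivity
    calc _ = ∫⁻ s, ENNReal.ofReal (1 / 2 * ψ R ^ 2 * R ^ (d - 2)) *
          ENNReal.ofReal (taylorKernel (c₀ * ψ R) s) := by
          refine lintegral_congr fun s => ?_
          rw [← ENNReal.ofReal_mul hp]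
          congr 1
          ring
      _ = _ := by
          rw [lintegral_const_mul', lintegral_taylorKernel, ← ENNReal.ofReal_mul hp]
          · congr 1
            ring
          · exact ENNReal.ofReal_ne_top
  rw [← hlim]
  have heq : (fun ε => ∫⁻ s, (Ioi (-R ^ 2 / ε ^ τ)).indicator
      (fun s => ENNReal.ofReal (layerIntegrand d R τ ε ψ s)) s) =ᶠ[𝓝[>] 0]
      fun ε => radialEnergy d R τ ε ψ := by
    filter_upwards [hsmall] with ε hε
    rw [radialEnergy_eq_lintegral_layerIntegrand hd R τ hε.1, lintegral_indicator measurableSet_Ioi]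
  refine Tendsto.congr' heq ?_
  refine tendsto_lintegral_filter_of_dominated_convergence
    (fun s => ENNReal.ofReal (D * (1 + s ^ 2)⁻¹)) ?_ ?_ hfin ?_
  · filter_upwards with ε
    refine Measurable.indicator (Measurable.ennreal_ofReal ?_) measurableSet_Ioi
    have hρ : Measurable fun s : ℝ => √(R ^ 2 + ε ^ τ * s) := by fun_prop
    have hψρ := hm.comp hρ
    exact ((hψρ.pow_const 2).const_mul _ |>.mul
      (measurable_taylorKernel_comp (hψρ.const_mul _) measurable_id)).mul (hρ.pow_const _)
  · filter_upwards [hsmall] with ε hε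
    refine ae_of_all _ fun s => ?_
    by_cases hs : s ∈ Ioi (-R ^ 2 / ε ^ τ)
    · rw [indicator_of_mem hs]
      exact ENNReal.ofReal_le_ofReal (h ε hε ψ hψ s hs)
    · rw [indicator_of_notMem hs]
      exact zero_le
  · refine ae_of_all _ fun s => ?_
    have hu : Tendsto (fun ε : ℝ => R ^ 2 + ε ^ τ * s) (𝓝[>] 0) (𝓝 (R ^ 2)) := by
      simpa using (hκ.mul_const s).const_add (R ^ 2)
    have hρ : Tendsto (fun ε : ℝ => √(R ^ 2 + ε ^ τ * s)) (𝓝[>] 0) (𝓝 R) := by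
      simpa [Real.sqrt_sq hR.le] using hu.sqrt
    have hψρ : Tendsto (fun ε : ℝ => ψ √(R ^ 2 + ε ^ τ * s)) (𝓝[>] 0) (𝓝 (ψ R)) :=
      hc.tendsto.comp hρ
    have hQ : Tendsto (fun ε : ℝ => taylorKernel (ε ^ (1 - τ) * ψ √(R ^ 2 + ε ^ τ * s)) s)
        (𝓝[>] 0) (𝓝 (taylorKernel (c₀ * ψ R) s)) :=
      Tendsto.comp (g := fun p : ℝ × ℝ => taylorKernel p.1 p.2)
        (f := fun ε : ℝ => (ε ^ (1 - τ) * ψ √(R ^ 2 + ε ^ τ * s), s))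
        (continuous_taylorKernel.tendsto (c₀ * ψ R, s))
        ((hc₀.mul hψρ).prodMk_nhds tendsto_const_nhds)
    have hmain : Tendsto (fun ε => ENNReal.ofReal (layerIntegrand d R τ ε ψ s)) (𝓝[>] 0)
        (𝓝 (ENNReal.ofReal (1 / 2 * ψ R ^ 2 * taylorKernel (c₀ * ψ R) s * R ^ (d - 2)))) :=
      ENNReal.tendsto_ofReal ((((hψρ.pow 2).const_mul _).mul hQ).mul (hρ.pow _))
    refine hmain.congr' ?_
    have hpos : ∀ᶠ ε : ℝ in 𝓝[>] 0, 0 < R ^ 2 + ε ^ τ * s :=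
      hu.eventually (lt_mem_nhds (by positivity))
    filter_upwards [hpos, hsmall] with ε hε hε'
    rw [indicator_of_mem]
    rw [mem_Ioi, div_lt_iff₀ (Real.rpow_pos_of_pos hε'.1 τ)]
    linarith

/-! ### Polar coordinates in the velocity variable -/

lemma measurableEmbedding_nnreal_coe : MeasurableEmbedding ((↑) : ℝ≥0 → ℝ) :=
  MeasurableEmbedding.subtype_coe (measurableSet_Ici (a := (0 : ℝ)))

lemma map_coe_timeMeasure : timeMeasure.map ((↑) : ℝ≥0 → ℝ) = volume.restrict (Ici 0) := by
  rw [timeMeasure, measurableEmbedding_nnreal_coe.map_comap]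
  congr 1
  ext x
  simp

instance : IsLocallyFiniteMeasure timeMeasure := by
  refine ⟨fun t => ⟨Iio (t + 1), Iio_mem_nhds (by simp), ?_⟩⟩
  rw [timeMeasure, measurableEmbedding_nnreal_coe.comap_apply]
  refine lt_of_le_of_lt (measure_mono (t := Icc (0 : ℝ) (t + 1)) ?_) (by simp)
  rintro _ ⟨s, hs, rfl⟩
  exact ⟨s.2, by exact_mod_cast (le_of_lt hs : s ≤ t + 1)⟩

instance (d : ℕ) : IsFiniteMeasure (volume : Measure (Sp d)).toSphere := inferInstance

instance (d : ℕ) : IsLocallyFiniteMeasure (phaseMeasure d) := by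
  unfold phaseMeasure; infer_instance

instance (d : ℕ) : SigmaFinite (rayMeasure d) := by
  unfold rayMeasure; infer_instance

instance (d : ℕ) : IsLocallyFiniteMeasure (rayMeasure d) := by
  unfold rayMeasure; infer_instance

/-- The measure `r^{d-1} dr` on `(0, ∞)`, as a measure on `ℝ`. -/
noncomputable def radialMeasure (d : ℕ) : Measure ℝ :=
  (volume.restrict (Ioi 0)).withDensity fun r => ENNReal.ofReal (r ^ (d - 1))

lemma map_val_volumeIoiPow (d : ℕ) :
    (Measure.volumeIoiPow (d - 1)).map Subtype.val = radialMeasure d := by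
  have he := MeasurableEmbedding.subtype_coe (measurableSet_Ioi (a := (0 : ℝ)))
  ext s hs
  rw [he.map_apply, Measure.volumeIoiPow, withDensity_apply _ (he.measurable hs), radialMeasure,
    withDensity_apply _ hs, ← lintegral_indicator hs, ← lintegral_indicator (he.measurable hs),
    ← lintegral_subtype_comap measurableSet_Ioi]
  rfl

instance (d : ℕ) : SigmaFinite (radialMeasure d) := by
  unfold radialMeasure
  exact SigmaFinite.withDensity_ofReal _

/-- The point of phase space with polar coordinates `((t, x, σ), r)`. -/
def polarPoint {d : ℕ} (q : ℝ≥0 × Sp d × Metric.sphere (0 : Sp d) 1) (r : ℝ) :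
    ℝ≥0 × Sp d × Sp d :=
  (q.1, q.2.1, r • (q.2.2 : Sp d))

@[fun_prop]
lemma continuous_polarPoint {d : ℕ} : Continuous fun z :
    (ℝ≥0 × Sp d × Metric.sphere (0 : Sp d) 1) × ℝ => polarPoint z.1 z.2 := by
  unfold polarPoint
  fun_prop

lemma measurePreserving_smul_sphere {d : ℕ} (hd : 2 ≤ d) :
    MeasurePreserving (fun z : Metric.sphere (0 : Sp d) 1 × ℝ => z.2 • (z.1 : Sp d))
      ((volume : Measure (Sp d)).toSphere.prod (radialMeasure d)) volume := by
  have : Nontrivial (Sp d) := by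
    have : Nonempty (Fin d) := ⟨⟨0, by omega⟩⟩
    infer_instance
  have h1 := (volume : Measure (Sp d)).measurePreserving_homeomorphUnitSphereProd
  rw [finrank_euclideanSpace_fin] at h1
  have h2 : MeasurePreserving (homeomorphUnitSphereProd (Sp d)).symm
      ((volume : Measure (Sp d)).toSphere.prod (Measure.volumeIoiPow (d - 1)))
      ((volume : Measure (Sp d)).comap Subtype.val) :=
    h1.symm (homeomorphUnitSphereProd (Sp d)).toMeasurableEquiv
  have h3 : MeasurePreserving (Subtype.val : ({0}ᶜ : Set (Sp d)) → Sp d)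
      ((volume : Measure (Sp d)).comap Subtype.val) volume := by
    refine ⟨measurable_subtype_coe, ?_⟩
    rw [(MeasurableEmbedding.subtype_coe (measurableSet_singleton (0 : Sp d)).compl).map_comap,
      Subtype.range_coe, restrict_compl_singleton]
  have h4 := h3.comp h2
  refine ⟨by fun_prop, ?_⟩
  refine Eq.trans ?_ h4.map_eq
  rw [← map_val_volumeIoiPow]
  have h5 : ((volume : Measure (Sp d)).toSphere.prod
      ((Measure.volumeIoiPow (d - 1)).map (Subtype.val : Ioi (0 : ℝ) → ℝ))) =
      ((volume : Measure (Sp d)).toSphere.prod (Measure.volumeIoiPow (d - 1))).map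
        (Prod.map id Subtype.val) := by
    have : SigmaFinite ((Measure.volumeIoiPow (d - 1)).map (Subtype.val : Ioi (0 : ℝ) → ℝ)) := by
      rw [map_val_volumeIoiPow]; infer_instance
    rw [← Measure.map_prod_map _ _ measurable_id measurable_subtype_coe, Measure.map_id]
  rw [h5, Measure.map_map (by fun_prop) (by fun_prop)]
  rfl

lemma measurePreserving_polarPoint {d : ℕ} (hd : 2 ≤ d) :
    MeasurePreserving (fun z : (ℝ≥0 × Sp d × Metric.sphere (0 : Sp d) 1) × ℝ =>
      polarPoint z.1 z.2) ((rayMeasure d).prod (radialMeasure d)) (phaseMeasure d) := by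
  have : SFinite ((volume : Measure (Sp d)).toSphere.prod (radialMeasure d)) := inferInstance
  have h1 := measurePreserving_prodAssoc timeMeasure
    ((volume : Measure (Sp d)).prod (volume : Measure (Sp d)).toSphere) (radialMeasure d)
  have h2 := (MeasurePreserving.id timeMeasure).prod
    (measurePreserving_prodAssoc (volume : Measure (Sp d)) (volume : Measure (Sp d)).toSphere
      (radialMeasure d))
  have h3 := (MeasurePreserving.id timeMeasure).prod
    ((MeasurePreserving.id (volume : Measure (Sp d))).prod (measurePreserving_smul_sphere hd))
  exact h3.comp (h2.comp h1)

lemma lintegral_radialMeasure {d : ℕ} (F : ℝ → ℝ≥0∞) :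
    ∫⁻ r, F r ∂radialMeasure d = ∫⁻ r in Ioi 0, ENNReal.ofReal (r ^ (d - 1)) * F r := by
  rw [radialMeasure, lintegral_withDensity_eq_lintegral_mul_non_measurable₀]
  · rfl
  · fun_prop
  · exact ae_of_all _ fun r => ENNReal.ofReal_lt_top

lemma lintegral_phaseMeasure_eq_polar {d : ℕ} (hd : 2 ≤ d) {H : ℝ≥0 × Sp d × Sp d → ℝ≥0∞}
    (hH : AEMeasurable H (phaseMeasure d)) :
    ∫⁻ p, H p ∂phaseMeasure d = ∫⁻ q, (∫⁻ r in Ioi (0 : ℝ),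
      ENNReal.ofReal (r ^ (d - 1)) * H (polarPoint q r)) ∂rayMeasure d := by
  have hmp := measurePreserving_polarPoint hd
  calc ∫⁻ p, H p ∂phaseMeasure d
      = ∫⁻ z, H (polarPoint z.1 z.2) ∂(rayMeasure d).prod (radialMeasure d) := by
        rw [← hmp.map_eq] at hH ⊢
        rw [lintegral_map' hH hmp.measurable.aemeasurable]
    _ = ∫⁻ q, (∫⁻ r, H (polarPoint q r) ∂radialMeasure d) ∂rayMeasure d :=
        lintegral_prod _ (hH.comp_quasiMeasurePreserving hmp.quasiMeasurePreserving)
    _ = _ := by simp_rw [lintegral_radialMeasure]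

lemma integral_radialMeasure {d : ℕ} (F : ℝ → ℝ) :
    ∫ r, F r ∂radialMeasure d = ∫ r in Ioi 0, F r * r ^ (d - 1) := by
  have hm : Measurable fun r : ℝ => (r ^ (d - 1)).toNNReal := by fun_prop
  rw [radialMeasure]
  erw [integral_withDensity_eq_integral_smul hm]
  refine setIntegral_congr_fun measurableSet_Ioi fun r hr => ?_
  simp only [NNReal.smul_def, smul_eq_mul]
  rw [Real.coe_toNNReal _ (pow_nonneg (le_of_lt hr) _), mul_comm]

lemma integrable_radialMeasure_iff {d : ℕ} {F : ℝ → ℝ} :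
    Integrable F (radialMeasure d) ↔ IntegrableOn (fun r => F r * r ^ (d - 1)) (Ioi 0) := by
  have hm : Measurable fun r : ℝ => (r ^ (d - 1)).toNNReal := by fun_prop
  rw [radialMeasure, IntegrableOn]
  erw [integrable_withDensity_iff_integrable_smul hm]
  refine integrable_congr ?_
  filter_upwards [ae_restrict_mem measurableSet_Ioi] with r hr
  simp only [NNReal.smul_def, smul_eq_mul]
  rw [Real.coe_toNNReal _ (pow_nonneg (le_of_lt hr) _), mul_comm]

lemma measurableEmbedding_polarPoint {d : ℕ} {R : ℝ} (hR : 0 < R) :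
    MeasurableEmbedding fun q : ℝ≥0 × Sp d × Metric.sphere (0 : Sp d) 1 => polarPoint q R := by
  refine (Topology.IsClosedEmbedding.id.prodMap (Topology.IsClosedEmbedding.id.prodMap
    (g := fun σ : Metric.sphere (0 : Sp d) 1 => R • (σ : Sp d)) ?_)).measurableEmbedding
  exact (Homeomorph.smulOfNeZero R hR.ne').isClosedEmbedding.comp
    (Metric.isClosed_sphere.isClosedEmbedding_subtypeVal)

lemma prod_surfaceMeasure_eq_map (d : ℕ) (R : ℝ) :
    (volume : Measure (Sp d)).prod (surfaceMeasure d R) = ENNReal.ofReal (R ^ (d - 1)) •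
      ((volume : Measure (Sp d)).prod (volume : Measure (Sp d)).toSphere).map
        fun z => (z.1, R • (z.2 : Sp d)) := by
  have hm : Measurable fun σ : Metric.sphere (0 : Sp d) 1 => R • (σ : Sp d) := by fun_prop
  rw [surfaceMeasure, Measure.prod_smul_right]
  congr 1
  have h1 := Measure.map_prod_map (volume : Measure (Sp d)) (volume : Measure (Sp d)).toSphere
    measurable_id hm
  rw [Measure.map_id] at h1
  exact h1

lemma fermiMeasure_eq_map {d : ℕ} (R : ℝ) :
    fermiMeasure d R = ENNReal.ofReal (R ^ (d - 1)) •
      (rayMeasure d).map fun q => polarPoint q R := by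
  have hm : Measurable fun z : Sp d × Metric.sphere (0 : Sp d) 1 => (z.1, R • (z.2 : Sp d)) := by
    fun_prop
  rw [fermiMeasure, prod_surfaceMeasure_eq_map, Measure.prod_smul_right]
  congr 1
  have h := Measure.map_prod_map timeMeasure
    ((volume : Measure (Sp d)).prod (volume : Measure (Sp d)).toSphere) measurable_id hm
  rw [Measure.map_id] at h
  exact h

/-! ### Functionals asymptotically bounded by a Hilbert norm -/

section Hilbert

variable {V H : Type*} [AddCommGroup V] [Module ℝ V] [NormedAddCommGroup H] [InnerProductSpace ℝ H]

/-- A functional bounded by a Hilbert seminorm factors through the range of the map into the Hilbert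
space, and extends to it. -/
lemma exists_inner_eq_of_abs_le [CompleteSpace H] (j : V →ₗ[ℝ] H) (L : V →ₗ[ℝ] ℝ) {C : ℝ}
    (hL : ∀ v, |L v| ≤ C * ‖j v‖) : ∃ F : H, ∀ v, L v = inner ℝ F (j v) := by
  obtain ⟨k, hk⟩ := j.rangeRestrict.exists_rightInverse_of_surjective j.range_rangeRestrict
  have hk' : ∀ w : LinearMap.range j, j (k w) = w := fun w => by
    have := congrArg Subtype.val (LinearMap.congr_fun hk w)
    simpa using this
  let L' : LinearMap.range j →L[ℝ] ℝ := (L.comp k).mkContinuous C fun w => by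
    have := hL (k w)
    rw [hk'] at this
    simpa using this
  obtain ⟨G, hG, -⟩ := exists_extension_norm_eq _ L'
  refine ⟨(InnerProductSpace.toDual ℝ H).symm G, fun v => ?_⟩
  rw [InnerProductSpace.toDual_symm_apply]
  have h1 := hG (j.rangeRestrict v)
  have h2 : L (v - k (j.rangeRestrict v)) = 0 := by
    have := hL (v - k (j.rangeRestrict v))
    rw [map_sub j, hk'] at this
    simpa using this
  rw [map_sub, sub_eq_zero] at h2
  rw [h2]
  exact h1.symm

variable {ι : Type*}

/-- Along an ultrafilter, functionals that are asymptotically bounded by a Hilbert seminorm converge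
to a functional represented by an element of the Hilbert space. -/
lemma exists_tendsto_inner [CompleteSpace H] (j : V →ₗ[ℝ] H) (L : ι → V →ₗ[ℝ] ℝ) {C : ℝ}
    (u : Ultrafilter ι) (hL : ∀ v, ∀ η > 0, ∀ᶠ i in u, |L i v| ≤ C * ‖j v‖ + η) :
    ∃ F : H, ∀ v, Tendsto (fun i => L i v) u (𝓝 (inner ℝ F (j v))) := by
  have hex : ∀ v, ∃ x : ℝ, Tendsto (fun i => L i v) u (𝓝 x) := by
    intro v
    have h1 : ∀ᶠ i in u, L i v ∈ Icc (-(C * ‖j v‖ + 1)) (C * ‖j v‖ + 1) := by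
      filter_upwards [hL v 1 one_pos] with i hi
      exact abs_le.1 hi
    obtain ⟨x, -, hx⟩ := isCompact_iff_ultrafilter_le_nhds.1 isCompact_Icc
      (u.map fun i => L i v) (le_principal_iff.2 h1)
    exact ⟨x, hx⟩
  choose Φ hΦ using hex
  let Λ : V →ₗ[ℝ] ℝ :=
    { toFun := Φ
      map_add' := fun v w => by
        refine tendsto_nhds_unique (hΦ (v + w)) ?_
        simpa using (hΦ v).add (hΦ w)
      map_smul' := fun c v => by
        refine tendsto_nhds_unique (hΦ (c • v)) ?_
        simpa using (hΦ v).const_mul c }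
  obtain ⟨F, hF⟩ := exists_inner_eq_of_abs_le j Λ (C := C) fun v => by
    refine le_of_forall_pos_le_add fun η hη => ?_
    exact le_of_tendsto (hΦ v).abs (hL v η hη)
  refine ⟨F, fun v => ?_⟩
  rw [← hF v]
  exact hΦ v

/-- A limit along an ultrafilter finer than a countably generated filter is attained along a
sequence, by separability of the Hilbert space. -/
lemma exists_seq_tendsto_inner [SecondCountableTopology H] [Nonempty ι] (j : V →ₗ[ℝ] H)
    (L : ι → V →ₗ[ℝ] ℝ) {C : ℝ} {l : Filter ι} [l.IsCountablyGenerated] (u : Ultrafilter ι)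
    (hul : ↑u ≤ l) (hL : ∀ v, ∀ η > 0, ∀ᶠ i in l, |L i v| ≤ C * ‖j v‖ + η) {F : H}
    (hF : ∀ v, Tendsto (fun i => L i v) u (𝓝 (inner ℝ F (j v)))) :
    ∃ i : ℕ → ι, Tendsto i atTop l ∧
      ∀ v, Tendsto (fun n => L (i n) v) atTop (𝓝 (inner ℝ F (j v))) := by
  obtain ⟨w, hw⟩ := TopologicalSpace.exists_dense_seq (LinearMap.range j)
  have hwv : ∀ n, ∃ v, j v = w n := fun n => (w n).2
  choose v hv using hwv
  obtain ⟨B, hB⟩ := l.exists_antitone_basis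
  have hi : ∀ n : ℕ, ∃ i ∈ B n, ∀ k ≤ n,
      |L i (v k) - inner ℝ F (j (v k))| < 1 / ((n : ℝ) + 1) := by
    intro n
    have h1 : ∀ᶠ i in (u : Filter ι), i ∈ B n := hul (hB.mem n)
    have h2 : ∀ᶠ i in (u : Filter ι), ∀ k ∈ Finset.range (n + 1),
        |L i (v k) - inner ℝ F (j (v k))| < 1 / ((n : ℝ) + 1) := by
      rw [Filter.eventually_all_finset]
      intro k _
      have := (hF (v k)).eventually (Metric.ball_mem_nhds _ (by positivity : 0 < 1 / ((n : ℝ) + 1)))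
      simpa [Real.dist_eq] using this
    obtain ⟨i, hi1, hi2⟩ := (h1.and h2).exists
    exact ⟨i, hi1, fun k hk => hi2 k (by simpa [Nat.lt_succ_iff] using hk)⟩
  choose i hiB hid using hi
  have hil : Tendsto i atTop l := hB.tendsto hiB
  refine ⟨i, hil, fun x => ?_⟩
  have hdense : ∀ k, Tendsto (fun n => L (i n) (v k)) atTop (𝓝 (inner ℝ F (j (v k)))) := by
    intro k
    rw [tendsto_iff_dist_tendsto_zero]
    refine squeeze_zero' (Eventually.of_forall fun _ => dist_nonneg) ?_
      tendsto_one_div_add_atTop_nhds_zero_nat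
    filter_upwards [eventually_ge_atTop k] with n hn
    rw [Real.dist_eq]
    exact (hid n k hn).le
  rw [Metric.tendsto_nhds]
  intro η hη
  set D := |C| + ‖F‖ + 1 with hD
  have hD0 : 0 < D := by positivity
  obtain ⟨k, hk⟩ : ∃ k, ‖j x - j (v k)‖ < η / (4 * D) := by
    obtain ⟨k, hk⟩ := hw.exists_dist_lt (j.rangeRestrict x) (by positivity : 0 < η / (4 * D))
    refine ⟨k, ?_⟩
    rw [Subtype.dist_eq, dist_eq_norm] at hk
    rw [hv]
    exact hk
  have h1 := hil.eventually (hL (x - v k) (η / 4) (by positivity))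
  have h2 := (Metric.tendsto_nhds.1 (hdense k)) (η / 4) (by positivity)
  filter_upwards [h1, h2] with n hn1 hn2
  rw [Real.dist_eq] at hn2 ⊢
  rw [map_sub, map_sub] at hn1
  have h3 : |inner ℝ F (j (v k)) - inner ℝ F (j x)| ≤ ‖F‖ * ‖j x - j (v k)‖ := by
    rw [← inner_sub_right, norm_sub_rev]
    exact abs_real_inner_le_norm _ _
  have h4 : |L (i n) x - inner ℝ F (j x)| ≤ |L (i n) x - L (i n) (v k)| +
      |L (i n) (v k) - inner ℝ F (j (v k))| + |inner ℝ F (j (v k)) - inner ℝ F (j x)| := by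
    have := abs_sub_le (L (i n) x) (L (i n) (v k)) (inner ℝ F (j x))
    have := abs_sub_le (L (i n) (v k)) (inner ℝ F (j (v k))) (inner ℝ F (j x))
    linarith
  have h5 : (C + ‖F‖) * ‖j x - j (v k)‖ ≤ η / 4 := by
    calc (C + ‖F‖) * ‖j x - j (v k)‖ ≤ D * (η / (4 * D)) := by
          gcongr
          rw [hD]
          linarith [le_abs_self C]
      _ = η / 4 := by field_simp
  nlinarith

end Hilbert

/-! ### The weighted bound on the fluctuations -/

/-- The ranges of the parameters. -/
structure AdmissibleParameters (d : ℕ) (δ R τ Cin : ℝ) : Prop where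
  two_le : 2 ≤ d
  delta_pos : 0 < δ
  radius_pos : 0 < R
  cin_pos : 0 < Cin
  tau_pos : 0 < τ
  tau_le : τ ≤ 1

lemma mul_fermiDirac {d : ℕ} {δ : ℝ} (hδ : 0 < δ) (R τ ε : ℝ) (v : Sp d) :
    δ * fermiDirac δ R τ ε v = Real.sigmoid (-((‖v‖ ^ 2 - R ^ 2) / ε ^ τ)) := by
  rw [fermiDirac, Real.sigmoid_def, neg_neg, ← mul_assoc, mul_inv_cancel₀ hδ.ne', one_mul]

lemma continuous_fermiDirac {d : ℕ} (δ R τ ε : ℝ) :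
    Continuous fun v : Sp d => fermiDirac δ R τ ε v := by
  unfold fermiDirac
  refine continuous_const.mul (Continuous.inv₀ (by fun_prop) fun v => ?_)
  positivity

/-- The dual of the scaled relative entropy density, evaluated on a test function. -/
noncomputable def dualDensity {d : ℕ} (R τ ε : ℝ) (Ψ : ℝ≥0 × Sp d × Sp d → ℝ)
    (p : ℝ≥0 × Sp d × Sp d) : ℝ :=
  (ε ^ τ)⁻¹ * Ψ p ^ 2 * taylorKernel (ε ^ (1 - τ) * Ψ p) ((‖p.2.2‖ ^ 2 - R ^ 2) / ε ^ τ)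

lemma measurable_dualDensity {d : ℕ} (R τ ε : ℝ) {Ψ : ℝ≥0 × Sp d × Sp d → ℝ} (hΨ : Measurable Ψ) :
    Measurable (dualDensity R τ ε Ψ) := by
  have hs : Measurable fun p : ℝ≥0 × Sp d × Sp d => (‖p.2.2‖ ^ 2 - R ^ 2) / ε ^ τ := by fun_prop
  exact ((hΨ.pow_const 2).const_mul _).mul (measurable_taylorKernel_comp (hΨ.const_mul _) hs)

lemma dualDensity_nonneg {d : ℕ} (R τ : ℝ) {ε : ℝ} (hε : 0 < ε) (Ψ : ℝ≥0 × Sp d × Sp d → ℝ)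
    (p : ℝ≥0 × Sp d × Sp d) : 0 ≤ dualDensity R τ ε Ψ p := by
  have := Real.rpow_pos_of_pos hε τ
  have := taylorKernel_nonneg (ε ^ (1 - τ) * Ψ p) ((‖p.2.2‖ ^ 2 - R ^ 2) / ε ^ τ)
  unfold dualDensity
  positivity

lemma lintegral_dualDensity_polarPoint {d : ℕ} (R τ ε : ℝ)
    (Ψ : ℝ≥0 × Sp d × Sp d → ℝ) (q : ℝ≥0 × Sp d × Metric.sphere (0 : Sp d) 1) :
    ∫⁻ r in Ioi (0 : ℝ), ENNReal.ofReal (r ^ (d - 1)) *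
      ENNReal.ofReal (dualDensity R τ ε Ψ (polarPoint q r)) =
    radialEnergy d R τ ε fun r => Ψ (polarPoint q r) := by
  refine setLIntegral_congr_fun measurableSet_Ioi fun r hr => ?_
  have hr' : 0 < r := hr
  have hn : ‖(polarPoint q r).2.2‖ ^ 2 = r ^ 2 := by simp [polarPoint, norm_smul]
  simp only [dualDensity]
  rw [hn, ← ENNReal.ofReal_mul (by positivity), mul_comm]

section Fluctuation

variable {d : ℕ} {δ R τ Cin : ℝ} {f : ℝ → ℝ≥0 × Sp d × Sp d → ℝ}

/-- Young's inequality for the fluctuation, at a point where `0 ≤ f_ε ≤ 1/δ`. -/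
lemma mul_fluctuation_mul_le (hp : AdmissibleParameters d δ R τ Cin) {ε : ℝ} (hε : 0 < ε)
    {p : ℝ≥0 × Sp d × Sp d} (h0 : 0 ≤ f ε p) (h1 : f ε p ≤ δ⁻¹) (Ψ : ℝ≥0 × Sp d × Sp d → ℝ) :
    δ * (fluctuation δ R τ f ε p * Ψ p) ≤
      1 / ε ^ (2 - τ) * entropyDensity (δ * f ε p) (δ * fermiDirac δ R τ ε p.2.2) +
        dualDensity R τ ε Ψ p := by
  have hδ := hp.delta_pos
  have hz0 : 0 ≤ δ * f ε p := by positivity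
  have hz1 : δ * f ε p ≤ 1 := by
    calc δ * f ε p ≤ δ * δ⁻¹ := by gcongr
      _ = 1 := mul_inv_cancel₀ hδ.ne'
  have key := mul_sub_le_entropyDensity_add hz0 hz1 (ε ^ (1 - τ) * Ψ p)
    ((‖p.2.2‖ ^ 2 - R ^ 2) / ε ^ τ)
  rw [← mul_fermiDirac hδ] at key
  have hE : 0 < ε ^ (2 - τ) := Real.rpow_pos_of_pos hε _
  have hκ : 0 < ε ^ τ := Real.rpow_pos_of_pos hε _
  have e1 : ε ^ (1 - τ) * ε = ε ^ (2 - τ) := by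
    rw [← Real.rpow_add_one hε.ne']
    congr 1
    ring
  have e2 : ε ^ (1 - τ) * ε ^ (1 - τ) * ε ^ τ = ε ^ (2 - τ) := by
    rw [← Real.rpow_add hε, ← Real.rpow_add hε]
    congr 1
    ring
  have e3 : δ * f ε p - δ * fermiDirac δ R τ ε p.2.2 =
      δ * ε * fluctuation δ R τ f ε p := by
    rw [fluctuation]
    field_simp
  rw [e3] at key
  have e4 : dualDensity R τ ε Ψ p = 1 / ε ^ (2 - τ) * ((ε ^ (1 - τ) * Ψ p) ^ 2 *
      taylorKernel (ε ^ (1 - τ) * Ψ p) ((‖p.2.2‖ ^ 2 - R ^ 2) / ε ^ τ)) := by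
    rw [dualDensity, ← e2]
    have : 0 < ε ^ (1 - τ) := Real.rpow_pos_of_pos hε _
    field_simp
  rw [e4, ← mul_add, one_div, inv_mul_eq_div, le_div_iff₀ hE, ← e1]
  calc _ = ε ^ (1 - τ) * Ψ p * (δ * ε * fluctuation δ R τ f ε p) := by ring
    _ ≤ _ := key

lemma aestronglyMeasurable_fluctuation (hf : UniformEntropyBound δ R τ τ Cin f) {ε : ℝ}
    (hε : 0 < ε) : AEStronglyMeasurable (fluctuation δ R τ f ε) (phaseMeasure d) := by
  have h1 : Continuous fun p : ℝ≥0 × Sp d × Sp d => fermiDirac δ R τ ε p.2.2 :=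
    (continuous_fermiDirac δ R τ ε).comp (by fun_prop)
  exact (((hf.aestronglyMeasurable ε hε).sub h1.aestronglyMeasurable).aemeasurable.div_const
    ε).aestronglyMeasurable

lemma abs_fluctuation_le (hp : AdmissibleParameters d δ R τ Cin)
    (hf : UniformEntropyBound δ R τ τ Cin f) {ε : ℝ} (hε : 0 < ε) :
    ∀ᵐ p ∂phaseMeasure d, |fluctuation δ R τ f ε p| ≤ δ⁻¹ / ε := by
  filter_upwards [hf.bounds ε hε] with p hb
  have hδ := hp.delta_pos
  have h1 : 0 ≤ fermiDirac δ R τ ε p.2.2 := by unfold fermiDirac; positivity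
  have h2 : fermiDirac δ R τ ε p.2.2 ≤ δ⁻¹ := by
    have := Real.sigmoid_le_one (-((‖p.2.2‖ ^ 2 - R ^ 2) / ε ^ τ))
    rw [← mul_fermiDirac hδ] at this
    rw [← one_div, le_div_iff₀ hδ]
    linarith
  rw [fluctuation, abs_div, abs_of_pos hε]
  gcongr
  rw [abs_le]
  constructor <;> linarith [hb.1, hb.2]

lemma locallyIntegrable_fluctuation (hp : AdmissibleParameters d δ R τ Cin)
    (hf : UniformEntropyBound δ R τ τ Cin f) {ε : ℝ} (hε : 0 < ε) :
    LocallyIntegrable (fluctuation δ R τ f ε) (phaseMeasure d) :=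
  (locallyIntegrable_const (δ⁻¹ / ε)).mono (aestronglyMeasurable_fluctuation hf hε) <| by
    filter_upwards [abs_fluctuation_le hp hf hε] with p h
    exact h.trans (le_abs_self _)

/-- The bound on the dual density for the extremal growth `(1 + |v|²)`, integrated in velocity. -/
lemma exists_lintegral_dualDensity_le (hp : AdmissibleParameters d δ R τ Cin) {ε₀ : ℝ}
    (hε₀ : 0 < ε₀) {k : ℝ} (hk : |k| * ε₀ ≤ 1 / 2) :
    ∃ D : ℝ≥0, ∀ ε ∈ Ioc 0 ε₀, ∀ (t : ℝ≥0) (x : Sp d),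
      ∫⁻ v, ENNReal.ofReal (dualDensity R τ ε (fun p => k * (1 + ‖p.2.2‖ ^ 2)) (t, x, v)) ≤ D := by
  obtain ⟨D, hD⟩ := exists_radialEnergy_le hp.two_le R hp.tau_pos hp.tau_le (abs_nonneg k) hε₀ hk
  have hfin : (volume : Measure (Sp d)).toSphere univ ≠ ∞ := measure_ne_top _ _
  refine ⟨D * ((volume : Measure (Sp d)).toSphere univ).toNNReal, fun ε hε t x => ?_⟩
  have hmp := measurePreserving_smul_sphere hp.two_le
  have hm : Measurable fun v : Sp d => ENNReal.ofReal
      (dualDensity R τ ε (fun p => k * (1 + ‖p.2.2‖ ^ 2)) (t, x, v)) :=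
    ((measurable_dualDensity R τ ε (by fun_prop)).comp (by fun_prop)).ennreal_ofReal
  have hm' : Measurable fun z : Metric.sphere (0 : Sp d) 1 × ℝ => ENNReal.ofReal
      (dualDensity R τ ε (fun p => k * (1 + ‖p.2.2‖ ^ 2)) (t, x, z.2 • (z.1 : Sp d))) :=
    hm.comp hmp.measurable
  rw [← hmp.lintegral_comp hm, lintegral_prod _ hm'.aemeasurable]
  have hle : ∀ σ : Metric.sphere (0 : Sp d) 1, ∫⁻ r, ENNReal.ofReal
      (dualDensity R τ ε (fun p => k * (1 + ‖p.2.2‖ ^ 2)) (t, x, r • (σ : Sp d)))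
        ∂radialMeasure d ≤ D := by
    intro σ
    rw [lintegral_radialMeasure]
    refine (lintegral_dualDensity_polarPoint R τ ε _ (t, x, σ)).le.trans (hD ε hε _ fun r _ => ?_)
    simp only [polarPoint, norm_smul, norm_eq_of_mem_sphere, mul_one, Real.norm_eq_abs, sq_abs]
    rw [abs_mul, abs_of_pos (by positivity : 0 < 1 + r ^ 2)]
  refine (lintegral_mono hle).trans ?_
  rw [lintegral_const, ENNReal.coe_mul, ENNReal.coe_toNNReal hfin]

/-- The fluctuations are bounded in `L^∞(dt; L¹_loc(dx; L¹((1 + |v|²) dv)))`: Young's inequality is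
applied with the test functions `±k (1 + |v|²)` for a small `k`. -/
lemma exists_lintegral_fluctuation_le (hp : AdmissibleParameters d δ R τ Cin)
    (hf : UniformEntropyBound δ R τ τ Cin f) {ε₀ : ℝ} (hε₀ : 0 < ε₀) {K : Set (Sp d)}
    (hK : IsCompact K) :
    ∃ C : ℝ≥0, ∀ ε ∈ Ioc 0 ε₀, ∀ᵐ t ∂timeMeasure, ∫⁻ p in K ×ˢ univ,
      ENNReal.ofReal (|fluctuation δ R τ f ε (t, p)| * (1 + ‖p.2‖ ^ 2)) ≤ C := by
  have hδ := hp.delta_pos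
  set k : ℝ := (2 * ε₀)⁻¹ with hk
  have hk0 : 0 < k := by positivity
  have hkε : k * ε₀ ≤ 1 / 2 := by rw [hk]; field_simp; rfl
  obtain ⟨D₁, hD₁⟩ := exists_lintegral_dualDensity_le hp hε₀ (k := k)
    (by rwa [abs_of_pos hk0])
  obtain ⟨D₂, hD₂⟩ := exists_lintegral_dualDensity_le hp hε₀ (k := -k)
    (by rwa [abs_neg, abs_of_pos hk0])
  have hKfin : volume K ≠ ∞ := hK.measure_ne_top
  refine ⟨(δ * k).toNNReal⁻¹ * (Cin.toNNReal + (D₁ + D₂) * (volume K).toNNReal), fun ε hε => ?_⟩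
  filter_upwards [Measure.ae_ae_of_ae_prod (hf.bounds ε hε.1), hf.entropy ε hε.1] with t ht1 ht2
  set W₁ : ℝ≥0 × Sp d × Sp d → ℝ := fun p => k * (1 + ‖p.2.2‖ ^ 2) with hW₁
  set W₂ : ℝ≥0 × Sp d × Sp d → ℝ := fun p => -k * (1 + ‖p.2.2‖ ^ 2) with hW₂
  have hE : 0 < ε ^ (2 - τ) := Real.rpow_pos_of_pos hε.1 _
  have hδk : ENNReal.ofReal (δ * k) ≠ 0 := by simp; positivity
  have hpt : ∀ᵐ p ∂(volume.prod volume : Measure (Sp d × Sp d)),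
      ENNReal.ofReal (δ * k) *
        ENNReal.ofReal (|fluctuation δ R τ f ε (t, p)| * (1 + ‖p.2‖ ^ 2)) ≤
      ENNReal.ofReal (1 / ε ^ (2 - τ)) * ENNReal.ofReal
        (entropyDensity (δ * f ε (t, p)) (δ * fermiDirac δ R τ ε p.2)) +
      (ENNReal.ofReal (dualDensity R τ ε W₁ (t, p)) +
        ENNReal.ofReal (dualDensity R τ ε W₂ (t, p))) := by
    filter_upwards [ht1] with p hpb
    have y1 := mul_fluctuation_mul_le hp hε.1 hpb.1 hpb.2 W₁
    have y2 := mul_fluctuation_mul_le hp hε.1 hpb.1 hpb.2 W₂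
    have n1 := dualDensity_nonneg R τ hε.1 W₁ (t, p)
    have n2 := dualDensity_nonneg R τ hε.1 W₂ (t, p)
    have n3 : 0 ≤ entropyDensity (δ * f ε (t, p)) (δ * fermiDirac δ R τ ε p.2) := by
      rw [mul_fermiDirac hδ]
      refine entropyDensity_nonneg (mul_nonneg hδ.le hpb.1) ?_ _
      calc δ * f ε (t, p) ≤ δ * δ⁻¹ := by gcongr; exact hpb.2
        _ = 1 := mul_inv_cancel₀ hδ.ne'
    rw [← ENNReal.ofReal_mul (by positivity), ← ENNReal.ofReal_mul (by positivity),
      ← ENNReal.ofReal_add n1 n2, ← ENNReal.ofReal_add (by positivity) (by positivity)]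
    apply ENNReal.ofReal_le_ofReal
    simp only [hW₁, hW₂] at y1 y2 n1 n2 ⊢
    rcases abs_cases (fluctuation δ R τ f ε (t, p)) with ⟨h, -⟩ | ⟨h, -⟩ <;> rw [h] <;> linarith
  have hmeas : ∀ k' : ℝ, Measurable fun p : Sp d × Sp d => ENNReal.ofReal
      (dualDensity R τ ε (fun p => k' * (1 + ‖p.2.2‖ ^ 2)) (t, p)) := fun k' =>
    ((measurable_dualDensity R τ ε (by fun_prop)).comp (by fun_prop)).ennreal_ofReal
  have hdual : ∀ (k' : ℝ) (D : ℝ≥0), (∀ x : Sp d, ∫⁻ v, ENNReal.ofReal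
      (dualDensity R τ ε (fun p => k' * (1 + ‖p.2.2‖ ^ 2)) (t, x, v)) ≤ D) →
      ∫⁻ p in K ×ˢ univ, ENNReal.ofReal
        (dualDensity R τ ε (fun p => k' * (1 + ‖p.2.2‖ ^ 2)) (t, p)) ≤ D * volume K := by
    intro k' D h
    rw [Measure.volume_eq_prod, ← Measure.prod_restrict, Measure.restrict_univ,
      lintegral_prod _ (hmeas k').aemeasurable]
    refine (lintegral_mono h).trans ?_
    simp
  have hmain : ENNReal.ofReal (δ * k) * ∫⁻ p in K ×ˢ univ,
      ENNReal.ofReal (|fluctuation δ R τ f ε (t, p)| * (1 + ‖p.2‖ ^ 2)) ≤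
      ENNReal.ofReal Cin + (D₁ * volume K + D₂ * volume K) := by
    rw [← lintegral_const_mul' _ _ ENNReal.ofReal_ne_top]
    refine (lintegral_mono_ae (ae_restrict_of_ae hpt)).trans ?_
    have hsum : Measurable fun p : Sp d × Sp d => ENNReal.ofReal (dualDensity R τ ε W₁ (t, p)) +
        ENNReal.ofReal (dualDensity R τ ε W₂ (t, p)) := (hmeas k).add (hmeas (-k))
    have hW₂m : Measurable fun p : Sp d × Sp d => ENNReal.ofReal (dualDensity R τ ε W₂ (t, p)) :=
      hmeas (-k)
    rw [lintegral_add_right _ hsum, lintegral_add_right _ hW₂m]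
    refine add_le_add ?_ (add_le_add (hdual k D₁ (hD₁ ε hε t)) (hdual (-k) D₂ (hD₂ ε hε t)))
    refine (setLIntegral_le_lintegral _ _).trans ?_
    rw [lintegral_const_mul' _ _ ENNReal.ofReal_ne_top]
    exact ht2
  have hcoe : (((δ * k).toNNReal⁻¹ * (Cin.toNNReal + (D₁ + D₂) * (volume K).toNNReal) : ℝ≥0) :
      ℝ≥0∞) = (ENNReal.ofReal (δ * k))⁻¹ *
        (ENNReal.ofReal Cin + (D₁ * volume K + D₂ * volume K)) := by
    have h0 : (δ * k).toNNReal ≠ 0 := by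
      simp only [ne_eq, Real.toNNReal_eq_zero, not_le]
      positivity
    push_cast [ENNReal.coe_inv h0, ENNReal.coe_toNNReal hKfin]
    rw [add_mul]
    rfl
  rw [hcoe, mul_comm, ← div_eq_mul_inv, ENNReal.le_div_iff_mul_le (Or.inl hδk)
    (Or.inl ENNReal.ofReal_ne_top), mul_comm]
  exact hmain

/-- The part of phase space over the box `{t ≤ B, |x| ≤ B}`. -/
def phaseBox (d : ℕ) (B : ℝ) : Set (ℝ≥0 × Sp d × Sp d) :=
  {t : ℝ≥0 | (t : ℝ) ≤ B} ×ˢ (Metric.closedBall (0 : Sp d) B ×ˢ univ)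

lemma timeMeasure_le_ne_top (B : ℝ) : timeMeasure {t : ℝ≥0 | (t : ℝ) ≤ B} ≠ ∞ := by
  refine ne_top_of_le_ne_top (isCompact_Icc (a := (0 : ℝ≥0)) (b := B.toNNReal)).measure_ne_top
    (measure_mono (μ := timeMeasure) fun t ht => ⟨zero_le, ?_⟩)
  exact NNReal.coe_le_coe.1 ((show (t : ℝ) ≤ B from ht).trans (Real.le_coe_toNNReal B))

lemma measurableSet_phaseBox (d : ℕ) (B : ℝ) : MeasurableSet (phaseBox d B) :=
  (measurableSet_le (by fun_prop) measurable_const).prod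
    (Metric.isClosed_closedBall.measurableSet.prod MeasurableSet.univ)

lemma exists_lintegral_phaseBox_le (hp : AdmissibleParameters d δ R τ Cin)
    (hf : UniformEntropyBound δ R τ τ Cin f) {ε₀ : ℝ} (hε₀ : 0 < ε₀) (B : ℝ) :
    ∃ C : ℝ≥0, ∀ ε ∈ Ioc 0 ε₀, ∫⁻ p in phaseBox d B,
      ENNReal.ofReal (|fluctuation δ R τ f ε p| * (1 + ‖p.2.2‖ ^ 2)) ∂phaseMeasure d ≤ C := by
  obtain ⟨C, hC⟩ := exists_lintegral_fluctuation_le hp hf hε₀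
    (isCompact_closedBall (0 : Sp d) B)
  have hT := timeMeasure_le_ne_top B
  refine ⟨C * (timeMeasure {t : ℝ≥0 | (t : ℝ) ≤ B}).toNNReal, fun ε hε => ?_⟩
  have hm : AEMeasurable (fun p : ℝ≥0 × Sp d × Sp d =>
      ENNReal.ofReal (|fluctuation δ R τ f ε p| * (1 + ‖p.2.2‖ ^ 2))) (phaseMeasure d) := by
    have h1 := (aestronglyMeasurable_fluctuation hf hε.1).norm.aemeasurable
    exact (h1.mul (by fun_prop : Measurable fun p : ℝ≥0 × Sp d × Sp d =>
      1 + ‖p.2.2‖ ^ 2).aemeasurable).ennreal_ofReal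
  have hr : (phaseMeasure d).restrict (phaseBox d B) =
      (timeMeasure.restrict {t : ℝ≥0 | (t : ℝ) ≤ B}).prod
        ((volume.prod volume).restrict (Metric.closedBall (0 : Sp d) B ×ˢ univ)) := by
    rw [phaseMeasure, phaseBox, Measure.prod_restrict]
  have hm' := hm.mono_measure (Measure.restrict_le_self (s := phaseBox d B))
  rw [hr] at hm' ⊢
  rw [lintegral_prod _ hm']
  refine (lintegral_mono_ae (ae_restrict_of_ae (hC ε hε))).trans ?_
  rw [lintegral_const, Measure.restrict_apply_univ, ENNReal.coe_mul, ENNReal.coe_toNNReal hT]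

/-- A test function of quadratic growth that is supported over the box `{t ≤ B, |x| ≤ B}`. -/
def BoundedByBox (B : ℝ) (Ψ : ℝ≥0 × Sp d × Sp d → ℝ) : Prop :=
  ∀ p, |Ψ p| ≤ B * (1 + ‖p.2.2‖ ^ 2) ∧ (Ψ p ≠ 0 → (p.1 : ℝ) ≤ B ∧ ‖p.2.1‖ ≤ B)

lemma BoundedByBox.nonneg {B : ℝ} {Ψ : ℝ≥0 × Sp d × Sp d → ℝ} (h : BoundedByBox B Ψ) : 0 ≤ B := by
  simpa using (abs_nonneg _).trans (h 0).1

/-- Test functions of quadratic growth over a bounded box integrate the fluctuations, with a bound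
uniform in `ε ≤ ε₀`. -/
lemma exists_integral_norm_le (hp : AdmissibleParameters d δ R τ Cin)
    (hf : UniformEntropyBound δ R τ τ Cin f) {ε₀ : ℝ} (hε₀ : 0 < ε₀) {B : ℝ}
    {Ψ : ℝ≥0 × Sp d × Sp d → ℝ} (hm : Measurable Ψ) (hΨ : BoundedByBox B Ψ) :
    ∃ C : ℝ, ∀ ε ∈ Ioc 0 ε₀,
      Integrable (fun p => fluctuation δ R τ f ε p * Ψ p) (phaseMeasure d) ∧
      |∫ p, fluctuation δ R τ f ε p * Ψ p ∂phaseMeasure d| ≤ C := by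
  have hB := hΨ.nonneg
  obtain ⟨C, hC⟩ := exists_lintegral_phaseBox_le hp hf hε₀ B
  refine ⟨(ENNReal.ofReal B * C).toReal, fun ε hε => ?_⟩
  have hle : ∫⁻ p, ‖fluctuation δ R τ f ε p * Ψ p‖ₑ ∂phaseMeasure d ≤ ENNReal.ofReal B * C := by
    refine le_trans ?_ (mul_le_mul_right (hC ε hε) _)
    rw [← lintegral_const_mul' _ _ ENNReal.ofReal_ne_top,
      ← lintegral_indicator (measurableSet_phaseBox d B)]
    refine lintegral_mono fun p => ?_
    by_cases h0 : Ψ p = 0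
    · simp [h0]
    · have hbox : p ∈ phaseBox d B := by
        obtain ⟨h1, h2⟩ := (hΨ p).2 h0
        exact ⟨h1, by simpa using h2, trivial⟩
      rw [indicator_of_mem hbox, ← ENNReal.ofReal_mul hB, Real.enorm_eq_ofReal_abs, abs_mul]
      apply ENNReal.ofReal_le_ofReal
      calc |fluctuation δ R τ f ε p| * |Ψ p|
          ≤ |fluctuation δ R τ f ε p| * (B * (1 + ‖p.2.2‖ ^ 2)) := by
            gcongr
            exact (hΨ p).1
        _ = _ := by ring
  have hfin : ENNReal.ofReal B * C ≠ ∞ :=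
    ENNReal.mul_ne_top ENNReal.ofReal_ne_top ENNReal.coe_ne_top
  refine ⟨⟨(aestronglyMeasurable_fluctuation hf hε.1).mul hm.aestronglyMeasurable,
    lt_of_le_of_lt hle hfin.lt_top⟩, ?_⟩
  rw [← Real.norm_eq_abs]
  refine (norm_integral_le_lintegral_norm _).trans (ENNReal.toReal_mono hfin ?_)
  simpa only [ofReal_norm] using hle

lemma integrable_fluctuation_mul (hp : AdmissibleParameters d δ R τ Cin)
    (hf : UniformEntropyBound δ R τ τ Cin f) {ε : ℝ} (hε : 0 < ε) {B : ℝ}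
    {Ψ : ℝ≥0 × Sp d × Sp d → ℝ} (hm : Measurable Ψ) (hΨ : BoundedByBox B Ψ) :
    Integrable (fun p => fluctuation δ R τ f ε p * Ψ p) (phaseMeasure d) := by
  obtain ⟨C, hC⟩ := exists_integral_norm_le hp hf hε hm hΨ
  exact (hC ε ⟨hε, le_rfl⟩).1

end Fluctuation

/-! ### Test functions and the asymptotic quadratic bound -/

section TestSpace

variable {d : ℕ} {δ R τ Cin : ℝ} {f : ℝ → ℝ≥0 × Sp d × Sp d → ℝ}

/-- Multiplication by a locally bounded function of time preserves the test functions. -/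
lemma BoundedByBox.time_mul {B M : ℝ} {Ψ : ℝ≥0 × Sp d × Sp d → ℝ} (h : BoundedByBox B Ψ)
    {β : ℝ≥0 → ℝ} (hM : 0 ≤ M) (hβ : ∀ t : ℝ≥0, (t : ℝ) ≤ B → |β t| ≤ M) :
    BoundedByBox (M * B + B) fun p => β p.1 * Ψ p := by
  have hB := h.nonneg
  intro p
  by_cases h0 : Ψ p = 0
  · simp only [h0, mul_zero, abs_zero, ne_eq, not_true_eq_false, IsEmpty.forall_iff, and_true]
    positivity
  · obtain ⟨h1, h2⟩ := (h p).2 h0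
    refine ⟨?_, fun _ => ⟨?_, ?_⟩⟩
    · rw [abs_mul]
      calc |β p.1| * |Ψ p| ≤ M * (B * (1 + ‖p.2.2‖ ^ 2)) := by
            gcongr
            · exact hβ _ h1
            · exact (h p).1
        _ ≤ (M * B + B) * (1 + ‖p.2.2‖ ^ 2) := by
            have : 0 ≤ B * (1 + ‖p.2.2‖ ^ 2) := by positivity
            linarith
    · nlinarith
    · nlinarith

/-- The space of test functions: measurable functions of quadratic growth in `v` with bounded
support in `(t, x)`, whose restriction to every ray is continuous at the Fermi sphere. -/
def testSpace (d : ℕ) (R : ℝ) : Submodule ℝ (ℝ≥0 × Sp d × Sp d → ℝ) where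
  carrier := {Ψ | Measurable Ψ ∧ (∀ q, ContinuousAt (fun r => Ψ (polarPoint q r)) R) ∧
    ∃ B, BoundedByBox B Ψ}
  zero_mem' := ⟨measurable_const, fun _ => continuousAt_const, 0, fun p => by simp⟩
  add_mem' := by
    rintro Ψ₁ Ψ₂ ⟨m₁, c₁, B₁, h₁⟩ ⟨m₂, c₂, B₂, h₂⟩
    refine ⟨m₁.add m₂, fun q => (c₁ q).add (c₂ q), B₁ + B₂, fun p => ⟨?_, fun h => ?_⟩⟩
    · rw [Pi.add_apply, add_mul]
      exact (abs_add_le _ _).trans (add_le_add (h₁ p).1 (h₂ p).1)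
    · have hB₁ := h₁.nonneg
      have hB₂ := h₂.nonneg
      by_cases h0 : Ψ₁ p = 0
      · obtain ⟨a, b⟩ := (h₂ p).2 fun h' => h (by simp [h0, h'])
        constructor <;> linarith
      · obtain ⟨a, b⟩ := (h₁ p).2 h0
        constructor <;> linarith
  smul_mem' := by
    rintro c Ψ ⟨m, hc, B, h⟩
    exact ⟨m.const_smul c, fun q => (hc q).const_smul c, _,
      h.time_mul (β := fun _ => c) (abs_nonneg c) fun _ _ => le_rfl⟩

lemma time_mul_mem_testSpace {Ψ : ℝ≥0 × Sp d × Sp d → ℝ} (hΨ : Ψ ∈ testSpace d R) {β : ℝ≥0 → ℝ}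
    (hm : Measurable β) (hβ : ∀ T : ℝ, ∃ M, ∀ t : ℝ≥0, (t : ℝ) ≤ T → |β t| ≤ M) :
    (fun p => β p.1 * Ψ p) ∈ testSpace d R := by
  obtain ⟨m, hc, B, h⟩ := hΨ
  obtain ⟨M, hM⟩ := hβ B
  exact ⟨(hm.comp measurable_fst).mul m, fun q => continuousAt_const.mul (hc q), _,
    h.time_mul (M := |M|) (abs_nonneg M) fun t ht => (hM t ht).trans (le_abs_self M)⟩

/-- The part of the ray space over the box `{t ≤ B, |x| ≤ B}`. -/
def rayBox (d : ℕ) (B : ℝ) : Set (ℝ≥0 × Sp d × Metric.sphere (0 : Sp d) 1) :=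
  {t : ℝ≥0 | (t : ℝ) ≤ B} ×ˢ (Metric.closedBall (0 : Sp d) B ×ˢ univ)

lemma measurableSet_rayBox (d : ℕ) (B : ℝ) : MeasurableSet (rayBox d B) :=
  (measurableSet_le (by fun_prop) measurable_const).prod
    (Metric.isClosed_closedBall.measurableSet.prod MeasurableSet.univ)

lemma rayMeasure_rayBox_ne_top (d : ℕ) (B : ℝ) : rayMeasure d (rayBox d B) ≠ ∞ := by
  rw [rayMeasure, rayBox, Measure.prod_prod, Measure.prod_prod]
  exact ENNReal.mul_ne_top (timeMeasure_le_ne_top B)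
    (ENNReal.mul_ne_top measure_closedBall_lt_top.ne (measure_ne_top _ _))

lemma BoundedByBox.eq_zero_of_notMem_rayBox {B : ℝ} {Ψ : ℝ≥0 × Sp d × Sp d → ℝ}
    (h : BoundedByBox B Ψ) {q : ℝ≥0 × Sp d × Metric.sphere (0 : Sp d) 1} (hq : q ∉ rayBox d B)
    (r : ℝ) : Ψ (polarPoint q r) = 0 := by
  by_contra h0
  obtain ⟨h1, h2⟩ := (h _).2 h0
  exact hq ⟨h1, by simpa [polarPoint] using h2, trivial⟩

lemma BoundedByBox.abs_polarPoint_le {B : ℝ} {Ψ : ℝ≥0 × Sp d × Sp d → ℝ} (h : BoundedByBox B Ψ)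
    (q : ℝ≥0 × Sp d × Metric.sphere (0 : Sp d) 1) (r : ℝ) :
    |Ψ (polarPoint q r)| ≤ B * (1 + r ^ 2) := by
  simpa [polarPoint, norm_smul] using (h (polarPoint q r)).1

lemma measurable_trace {Ψ : ℝ≥0 × Sp d × Sp d → ℝ} (hm : Measurable Ψ) (R : ℝ) :
    Measurable fun q => Ψ (polarPoint q R) :=
  hm.comp (by unfold polarPoint; fun_prop)

lemma memLp_of_bounded_of_rayBox {F : ℝ≥0 × Sp d × Metric.sphere (0 : Sp d) 1 → ℝ} {B M : ℝ}
    (hm : Measurable F) (hM : ∀ q ∈ rayBox d B, |F q| ≤ M) (h0 : ∀ q, q ∉ rayBox d B → F q = 0)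
    (p : ℝ≥0∞) : MemLp F p (rayMeasure d) := by
  have : IsFiniteMeasure ((rayMeasure d).restrict (rayBox d B)) :=
    ⟨by simpa using (rayMeasure_rayBox_ne_top d B).lt_top⟩
  have h1 : F = (rayBox d B).indicator F := by
    ext q
    by_cases hq : q ∈ rayBox d B
    · rw [indicator_of_mem hq]
    · rw [indicator_of_notMem hq, h0 q hq]
  rw [h1, memLp_indicator_iff_restrict (measurableSet_rayBox d B)]
  refine MemLp.of_bound hm.aestronglyMeasurable M ?_
  filter_upwards [ae_restrict_mem (measurableSet_rayBox d B)] with q hq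
  exact hM q hq

/-- The dual functional with a weight in time converges to its quadratic limit. -/
lemma tendsto_lintegral_dualDensity (hp : AdmissibleParameters d δ R τ Cin)
    {Ψ : ℝ≥0 × Sp d × Sp d → ℝ} (hΨ : Ψ ∈ testSpace d R) {θ : ℝ≥0 → ℝ} (hθm : Measurable θ)
    (hθ1 : ∀ t, θ t ≤ 1) :
    Tendsto (fun ε => ∫⁻ p, ENNReal.ofReal (θ p.1) * ENNReal.ofReal (dualDensity R τ ε Ψ p)
        ∂phaseMeasure d) (𝓝[>] 0)
      (𝓝 (∫⁻ q, ENNReal.ofReal (θ q.1) *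
        ENNReal.ofReal (R ^ (d - 2) / 4 * Ψ (polarPoint q R) ^ 2) ∂rayMeasure d)) := by
  obtain ⟨m, hc, B, h⟩ := hΨ
  have hB := h.nonneg
  set ε₀ : ℝ := (2 * (B + 1))⁻¹ with hε₀def
  have hε₀ : 0 < ε₀ := by positivity
  have hBε : B * ε₀ ≤ 1 / 2 := by
    rw [hε₀def, ← div_eq_mul_inv, div_le_div_iff₀ (by positivity) two_pos]
    linarith
  obtain ⟨D, hD⟩ := exists_radialEnergy_le hp.two_le R hp.tau_pos hp.tau_le hB hε₀ hBε
  have hsmall : ∀ᶠ ε : ℝ in 𝓝[>] 0, ε ∈ Ioc 0 ε₀ := Ioc_mem_nhdsGT hε₀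
  have hθm' : Measurable fun p : ℝ≥0 × Sp d × Sp d => ENNReal.ofReal (θ p.1) :=
    (hθm.comp measurable_fst).ennreal_ofReal
  have heq : (fun ε => ∫⁻ q, ENNReal.ofReal (θ q.1) *
      radialEnergy d R τ ε (fun r => Ψ (polarPoint q r)) ∂rayMeasure d) =
      fun ε => ∫⁻ p, ENNReal.ofReal (θ p.1) * ENNReal.ofReal (dualDensity R τ ε Ψ p)
        ∂phaseMeasure d := by
    ext ε
    have hmm : Measurable fun p => ENNReal.ofReal (θ p.1) *
        ENNReal.ofReal (dualDensity R τ ε Ψ p) :=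
      hθm'.mul (measurable_dualDensity R τ ε m).ennreal_ofReal
    rw [lintegral_phaseMeasure_eq_polar hp.two_le hmm.aemeasurable]
    refine lintegral_congr fun q => ?_
    rw [← lintegral_dualDensity_polarPoint, ← lintegral_const_mul' _ _ ENNReal.ofReal_ne_top]
    refine lintegral_congr fun r => ?_
    simp only [polarPoint]
    ring
  rw [← heq]
  refine tendsto_lintegral_filter_of_dominated_convergence
    ((rayBox d B).indicator fun _ => (D : ℝ≥0∞)) ?_ ?_ ?_ ?_
  · filter_upwards with ε
    have h1 : Measurable fun z : (ℝ≥0 × Sp d × Metric.sphere (0 : Sp d) 1) × ℝ =>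
        ENNReal.ofReal (z.2 ^ (d - 1)) *
          ENNReal.ofReal (dualDensity R τ ε Ψ (polarPoint z.1 z.2)) :=
      (measurable_snd.pow_const _).ennreal_ofReal.mul
        (((measurable_dualDensity R τ ε m).comp continuous_polarPoint.measurable).ennreal_ofReal)
    have h2 := h1.lintegral_prod_right' (ν := volume.restrict (Ioi (0 : ℝ)))
    simp_rw [lintegral_dualDensity_polarPoint] at h2
    exact (hθm.comp measurable_fst).ennreal_ofReal.mul h2
  · filter_upwards [hsmall] with ε hε
    refine ae_of_all _ fun q => ?_
    by_cases hq : q ∈ rayBox d B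
    · rw [indicator_of_mem hq]
      calc _ ≤ 1 * (D : ℝ≥0∞) := by
            gcongr
            · exact ENNReal.ofReal_le_one.2 (hθ1 _)
            · exact hD ε hε _ fun r _ => h.abs_polarPoint_le q r
        _ = D := one_mul _
    · have h0 : (fun r => Ψ (polarPoint q r)) = fun _ => 0 :=
        funext fun r => h.eq_zero_of_notMem_rayBox hq r
      rw [h0]
      simp [radialEnergy]
  · rw [lintegral_indicator (measurableSet_rayBox d B), setLIntegral_const]
    exact ENNReal.mul_ne_top ENNReal.coe_ne_top (rayMeasure_rayBox_ne_top d B)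
  · refine ae_of_all _ fun q => ENNReal.Tendsto.const_mul ?_ (Or.inr ENNReal.ofReal_ne_top)
    exact tendsto_radialEnergy hp.two_le hp.radius_pos hp.tau_pos hp.tau_le
      (m.comp (continuous_polarPoint.measurable.comp (measurable_prodMk_left (x := q)))) (hc q)
      fun r _ => h.abs_polarPoint_le q r

lemma integral_le_toReal_lintegral_ofReal {α : Type*} [MeasurableSpace α] {μ : Measure α}
    {X : α → ℝ} (hX : Integrable X μ) : ∫ a, X a ∂μ ≤ (∫⁻ a, ENNReal.ofReal (X a) ∂μ).toReal := by
  rw [integral_eq_lintegral_pos_part_sub_lintegral_neg_part hX]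
  exact sub_le_self _ ENNReal.toReal_nonneg

/-- The asymptotic form of Young's inequality, with a weight in time: the entropy bound controls a
linear functional of the fluctuations by a quadratic functional carried by the Fermi sphere. -/
lemma eventually_integral_fluctuation_le (hp : AdmissibleParameters d δ R τ Cin)
    (hf : UniformEntropyBound δ R τ τ Cin f) {Ψ : ℝ≥0 × Sp d × Sp d → ℝ} (hΨ : Ψ ∈ testSpace d R)
    {θ : ℝ≥0 → ℝ} (hθm : Measurable θ) (hθ0 : ∀ t, 0 ≤ θ t) (hθ1 : ∀ t, θ t ≤ 1)
    (hθi : Integrable θ timeMeasure) {η : ℝ} (hη : 0 < η) :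
    ∀ᶠ ε in 𝓝[>] 0, δ * ∫ p, fluctuation δ R τ f ε p * (θ p.1 * Ψ p) ∂phaseMeasure d ≤
      Cin * ∫ t, θ t ∂timeMeasure +
        R ^ (d - 2) / 4 * ∫ q, θ q.1 * Ψ (polarPoint q R) ^ 2 ∂rayMeasure d + η := by
  have hδ := hp.delta_pos
  have hR := hp.radius_pos
  have hΨ' := hΨ
  obtain ⟨m, -, B, h⟩ := hΨ'
  have hB := h.nonneg
  set E : ℝ → ℝ≥0∞ := fun ε => ∫⁻ p, ENNReal.ofReal (θ p.1) *
    ENNReal.ofReal (dualDensity R τ ε Ψ p) ∂phaseMeasure d with hE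
  set E₀ : ℝ≥0∞ := ∫⁻ q, ENNReal.ofReal (θ q.1) *
    ENNReal.ofReal (R ^ (d - 2) / 4 * Ψ (polarPoint q R) ^ 2) ∂rayMeasure d with hE₀
  have hlim : Tendsto E (𝓝[>] 0) (𝓝 E₀) := tendsto_lintegral_dualDensity hp hΨ hθm hθ1
  -- the limit is finite and equal to the quadratic functional
  have hint : Integrable (fun q => θ q.1 * Ψ (polarPoint q R) ^ 2) (rayMeasure d) := by
    rw [← memLp_one_iff_integrable]
    refine memLp_of_bounded_of_rayBox (F := fun q => θ q.1 * Ψ (polarPoint q R) ^ 2) (B := B)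
      (M := 1 * (B * (1 + R ^ 2)) ^ 2)
      ((hθm.comp measurable_fst).mul ((measurable_trace m R).pow_const 2)) (fun q _ => ?_)
      (fun q hq => by rw [h.eq_zero_of_notMem_rayBox hq]; ring) 1
    rw [abs_mul, abs_of_nonneg (hθ0 _), abs_pow]
    gcongr
    · exact hθ1 _
    · exact h.abs_polarPoint_le q R
  have hE₀eq : E₀ = ENNReal.ofReal
      (R ^ (d - 2) / 4 * ∫ q, θ q.1 * Ψ (polarPoint q R) ^ 2 ∂rayMeasure d) := by
    rw [← integral_const_mul, ofReal_integral_eq_lintegral_ofReal (hint.const_mul _)]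
    · refine lintegral_congr fun q => ?_
      rw [← ENNReal.ofReal_mul (hθ0 _)]
      congr 1
      ring
    · refine ae_of_all _ fun q => ?_
      have := hθ0 q.1
      simp only [Pi.zero_apply]
      positivity
  have hA : ∫⁻ t, ENNReal.ofReal (θ t) ∂timeMeasure = ENNReal.ofReal (∫ t, θ t ∂timeMeasure) :=
    (ofReal_integral_eq_lintegral_ofReal hθi (ae_of_all _ hθ0)).symm
  have hI0 : 0 ≤ ∫ t, θ t ∂timeMeasure := integral_nonneg hθ0
  have hJ0 : 0 ≤ ∫ q, θ q.1 * Ψ (polarPoint q R) ^ 2 ∂rayMeasure d :=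
    integral_nonneg fun q => mul_nonneg (hθ0 _) (sq_nonneg _)
  have hE₀fin : E₀ ≠ ∞ := by rw [hE₀eq]; exact ENNReal.ofReal_ne_top
  have hfinev : ∀ᶠ ε in 𝓝[>] 0, E ε < ∞ := hlim.eventually (gt_mem_nhds hE₀fin.lt_top)
  have hreal : Tendsto (fun ε => (E ε).toReal) (𝓝[>] 0) (𝓝 E₀.toReal) :=
    (ENNReal.tendsto_toReal hE₀fin).comp hlim
  have hclose : ∀ᶠ ε in 𝓝[>] 0, (E ε).toReal < E₀.toReal + η :=
    hreal.eventually (gt_mem_nhds (by linarith))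
  filter_upwards [hfinev, hclose, self_mem_nhdsWithin] with ε h1 h2 hε
  have hε' : 0 < ε := hε
  have hEε : 0 < ε ^ (2 - τ) := Real.rpow_pos_of_pos hε' _
  set S : ℝ≥0 × Sp d × Sp d → ℝ := fun p =>
    entropyDensity (δ * f ε p) (δ * fermiDirac δ R τ ε p.2.2) with hS
  have hgi : Integrable (fun p => fluctuation δ R τ f ε p * (θ p.1 * Ψ p)) (phaseMeasure d) :=
    integrable_fluctuation_mul hp hf hε' ((hθm.comp measurable_fst).mul m)
      (h.time_mul zero_le_one fun t _ => by rw [abs_of_nonneg (hθ0 t)]; exact hθ1 t)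
  have hpt : ∀ᵐ p ∂phaseMeasure d,
      ENNReal.ofReal (δ * (fluctuation δ R τ f ε p * (θ p.1 * Ψ p))) ≤
        ENNReal.ofReal (θ p.1) * (ENNReal.ofReal (1 / ε ^ (2 - τ)) * ENNReal.ofReal (S p)) +
        ENNReal.ofReal (θ p.1) * ENNReal.ofReal (dualDensity R τ ε Ψ p) := by
    filter_upwards [hf.bounds ε hε'] with p hpb
    have y := mul_fluctuation_mul_le hp hε' hpb.1 hpb.2 Ψ
    have n1 := dualDensity_nonneg R τ hε' Ψ p
    have n2 : 0 ≤ S p := by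
      simp only [hS]
      rw [mul_fermiDirac hδ]
      refine entropyDensity_nonneg (mul_nonneg hδ.le hpb.1) ?_ _
      calc δ * f ε p ≤ δ * δ⁻¹ := by gcongr; exact hpb.2
        _ = 1 := mul_inv_cancel₀ hδ.ne'
    have hθp := hθ0 p.1
    rw [← ENNReal.ofReal_mul (by positivity), ← ENNReal.ofReal_mul hθp, ← ENNReal.ofReal_mul hθp,
      ← ENNReal.ofReal_add (by positivity) (by positivity)]
    apply ENNReal.ofReal_le_ofReal
    calc δ * (fluctuation δ R τ f ε p * (θ p.1 * Ψ p))
        = θ p.1 * (δ * (fluctuation δ R τ f ε p * Ψ p)) := by ring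
      _ ≤ θ p.1 * (1 / ε ^ (2 - τ) * S p + dualDensity R τ ε Ψ p) := by gcongr
      _ = _ := by ring
  have hentropy : ∫⁻ p, ENNReal.ofReal (θ p.1) *
      (ENNReal.ofReal (1 / ε ^ (2 - τ)) * ENNReal.ofReal (S p)) ∂phaseMeasure d ≤
      ENNReal.ofReal (Cin * ∫ t, θ t ∂timeMeasure) := by
    rw [ENNReal.ofReal_mul hp.cin_pos.le, ← hA, mul_comm,
      ← lintegral_mul_const' _ _ ENNReal.ofReal_ne_top]
    -- this half of Tonelli's theorem needs no measurability of the entropy density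
    refine (lintegral_prod_le _).trans (lintegral_mono_ae ?_)
    filter_upwards [hf.entropy ε hε'] with t ht
    rw [lintegral_const_mul' _ _ ENNReal.ofReal_ne_top,
      lintegral_const_mul' _ _ ENNReal.ofReal_ne_top]
    gcongr
    exact ht
  have htotal : ∫⁻ p, ENNReal.ofReal (δ * (fluctuation δ R τ f ε p * (θ p.1 * Ψ p)))
      ∂phaseMeasure d ≤ ENNReal.ofReal (Cin * ∫ t, θ t ∂timeMeasure) + E ε := by
    refine (lintegral_mono_ae hpt).trans ?_
    have hmm : Measurable fun p : ℝ≥0 × Sp d × Sp d => ENNReal.ofReal (θ p.1) *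
        ENNReal.ofReal (dualDensity R τ ε Ψ p) :=
      (hθm.comp measurable_fst).ennreal_ofReal.mul (measurable_dualDensity R τ ε m).ennreal_ofReal
    rw [lintegral_add_right _ hmm]
    exact add_le_add hentropy le_rfl
  rw [← integral_const_mul]
  refine (integral_le_toReal_lintegral_ofReal (hgi.const_mul δ)).trans ?_
  refine (ENNReal.toReal_mono (ENNReal.add_ne_top.2 ⟨ENNReal.ofReal_ne_top, h1.ne⟩) htotal).trans ?_
  rw [ENNReal.toReal_add ENNReal.ofReal_ne_top h1.ne, ENNReal.toReal_ofReal
    (mul_nonneg hp.cin_pos.le hI0)]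
  have e : E₀.toReal = R ^ (d - 2) / 4 * ∫ q, θ q.1 * Ψ (polarPoint q R) ^ 2 ∂rayMeasure d := by
    rw [hE₀eq, ENNReal.toReal_ofReal (by positivity)]
  rw [← e]
  linarith

end TestSpace

/-! ### Limits of the fluctuations as square integrable functions on the rays -/

/-- The filter of positive parameters `ε` that tend to `0`. -/
def vanishing : Filter {ε : ℝ // 0 < ε} := comap Subtype.val (𝓝 0)

instance : vanishing.IsCountablyGenerated := by unfold vanishing; infer_instance

lemma tendsto_val_vanishing : Tendsto Subtype.val vanishing (𝓝[>] (0 : ℝ)) :=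
  tendsto_nhdsWithin_iff.2 ⟨tendsto_comap, Eventually.of_forall fun ε => ε.2⟩

section Limits

variable {d : ℕ} {δ R τ Cin : ℝ} {f : ℝ → ℝ≥0 × Sp d × Sp d → ℝ}

lemma integrable_fluctuation_mul_testSpace (hp : AdmissibleParameters d δ R τ Cin)
    (hf : UniformEntropyBound δ R τ τ Cin f) {ε : ℝ} (hε : 0 < ε) (Ψ : testSpace d R) :
    Integrable (fun p => fluctuation δ R τ f ε p * (Ψ : ℝ≥0 × Sp d × Sp d → ℝ) p)
      (phaseMeasure d) := by
  obtain ⟨m, -, B, h⟩ := Ψ.2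
  exact integrable_fluctuation_mul hp hf hε m h

/-- The functional `Ψ ↦ ∫ g_ε Ψ dt dx dv` on the test space. -/
noncomputable def fluctuationFunctional (hp : AdmissibleParameters d δ R τ Cin)
    (hf : UniformEntropyBound δ R τ τ Cin f) (ε : {ε : ℝ // 0 < ε}) : testSpace d R →ₗ[ℝ] ℝ where
  toFun Ψ := ∫ p, fluctuation δ R τ f ε p * (Ψ : ℝ≥0 × Sp d × Sp d → ℝ) p ∂phaseMeasure d
  map_add' Ψ₁ Ψ₂ := by
    rw [← integral_add (integrable_fluctuation_mul_testSpace hp hf ε.2 Ψ₁)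
      (integrable_fluctuation_mul_testSpace hp hf ε.2 Ψ₂)]
    simp [mul_add]
  map_smul' c Ψ := by
    rw [RingHom.id_apply, smul_eq_mul, ← integral_const_mul]
    refine integral_congr_ae (ae_of_all _ fun p => ?_)
    simp only [Submodule.coe_smul, Pi.smul_apply, smul_eq_mul]
    ring

lemma memLp_weighted_trace (Ψ : testSpace d R) : MemLp (fun q =>
    Real.exp ((q.1 : ℝ) / 2) * (Ψ : ℝ≥0 × Sp d × Sp d → ℝ) (polarPoint q R)) 2 (rayMeasure d) := by
  obtain ⟨m, -, B, h⟩ := Ψ.2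
  have hB := h.nonneg
  refine memLp_of_bounded_of_rayBox
    (F := fun q => Real.exp ((q.1 : ℝ) / 2) * (Ψ : ℝ≥0 × Sp d × Sp d → ℝ) (polarPoint q R))
    (B := B) (M := Real.exp (B / 2) * (B * (1 + R ^ 2)))
    (Measurable.mul (by fun_prop) (measurable_trace m R)) (fun q hq => ?_) (fun q hq => ?_) 2
  · rw [abs_mul, Real.abs_exp]
    have h1 : (q.1 : ℝ) ≤ B := hq.1
    gcongr
    exact h.abs_polarPoint_le q R
  · rw [h.eq_zero_of_notMem_rayBox hq, mul_zero]

/-- The restriction of a test function to the Fermi sphere, parametrized by the rays, with the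
weight `e^{t/2}` that makes the time integral of the entropy bound finite. -/
noncomputable def weightedTrace (d : ℕ) (R : ℝ) : testSpace d R →ₗ[ℝ] Lp ℝ 2 (rayMeasure d) where
  toFun Ψ := (memLp_weighted_trace Ψ).toLp _
  map_add' Ψ₁ Ψ₂ := by
    rw [← MemLp.toLp_add]
    congr 1
    ext q
    simp [mul_add]
  map_smul' c Ψ := by
    rw [RingHom.id_apply, ← MemLp.toLp_const_smul]
    congr 1
    ext q
    simp only [Submodule.coe_smul, Pi.smul_apply, smul_eq_mul]
    ring

/-- The locally square integrable function `e^{t/2} F` on the rays. -/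
noncomputable def rayDensity (F : Lp ℝ 2 (rayMeasure d))
    (q : ℝ≥0 × Sp d × Metric.sphere (0 : Sp d) 1) : ℝ :=
  Real.exp ((q.1 : ℝ) / 2) * F q

lemma measurable_rayDensity (F : Lp ℝ 2 (rayMeasure d)) : Measurable (rayDensity F) :=
  Measurable.mul (by fun_prop) (Lp.stronglyMeasurable F).measurable

lemma inner_weightedTrace (F : Lp ℝ 2 (rayMeasure d)) (Ψ : testSpace d R) :
    inner ℝ F (weightedTrace d R Ψ) =
      ∫ q, rayDensity F q * (Ψ : ℝ≥0 × Sp d × Sp d → ℝ) (polarPoint q R) ∂rayMeasure d := by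
  rw [L2.inner_def]
  refine integral_congr_ae ?_
  filter_upwards [(memLp_weighted_trace Ψ).coeFn_toLp] with q hq
  have : (weightedTrace d R Ψ) q = _ := hq
  rw [this, rayDensity, real_inner_eq_re_inner]
  simp
  ring

lemma norm_weightedTrace_sq (Ψ : testSpace d R) : ‖weightedTrace d R Ψ‖ ^ 2 =
    ∫ q, Real.exp q.1 * (Ψ : ℝ≥0 × Sp d × Sp d → ℝ) (polarPoint q R) ^ 2 ∂rayMeasure d := by
  rw [← real_inner_self_eq_norm_sq, inner_weightedTrace]
  refine integral_congr_ae ?_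
  filter_upwards [(memLp_weighted_trace Ψ).coeFn_toLp] with q hq
  have : (weightedTrace d R Ψ) q = _ := hq
  rw [rayDensity, this]
  have e : Real.exp (q.1 : ℝ) = Real.exp ((q.1 : ℝ) / 2) * Real.exp ((q.1 : ℝ) / 2) := by
    rw [← Real.exp_add, add_halves]
  rw [e]
  ring

lemma integrable_rayDensity_mul (F : Lp ℝ 2 (rayMeasure d)) {h : _ → ℝ} {B M : ℝ}
    (hm : Measurable h) (hM : ∀ q ∈ rayBox d B, |h q| ≤ M) (h0 : ∀ q, q ∉ rayBox d B → h q = 0) :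
    Integrable (fun q => rayDensity F q * h q) (rayMeasure d) := by
  have h1 : MemLp (fun q => Real.exp ((q.1 : ℝ) / 2) * h q) 2 (rayMeasure d) := by
    refine memLp_of_bounded_of_rayBox (F := fun q => Real.exp ((q.1 : ℝ) / 2) * h q) (B := B)
      (M := Real.exp (B / 2) * M)
      (Measurable.mul (by fun_prop) hm) (fun q hq => ?_) (fun q hq => ?_) 2
    · rw [abs_mul, Real.abs_exp]
      have h1 : (q.1 : ℝ) ≤ B := hq.1
      gcongr
      exact hM q hq
    · rw [h0 q hq, mul_zero]
  refine ((Lp.memLp F).integrable_mul h1).congr (ae_of_all _ fun q => ?_)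
  simp only [rayDensity, Pi.mul_apply]
  ring

lemma integrable_exp_neg_timeMeasure :
    Integrable (fun t : ℝ≥0 => Real.exp (-(t : ℝ))) timeMeasure := by
  have h : IntegrableOn (fun t : ℝ => Real.exp (-t)) (Ici 0) := by
    rw [integrableOn_Ici_iff_integrableOn_Ioi]
    exact integrableOn_exp_neg_Ioi 0
  rw [IntegrableOn, ← map_coe_timeMeasure,
    measurableEmbedding_nnreal_coe.integrable_map_iff] at h
  exact h

/-- The fluctuations are asymptotically bounded in the dual of the Hilbert space of square
integrable functions on the rays: the asymptotic Young inequality is applied with the weight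
`e^{-t}` to a normalized test function. -/
lemma exists_eventually_abs_functional_le (hp : AdmissibleParameters d δ R τ Cin)
    (hf : UniformEntropyBound δ R τ τ Cin f) :
    ∃ C : ℝ, ∀ Ψ : testSpace d R, ∀ η > 0, ∀ᶠ ε in vanishing,
      |fluctuationFunctional hp hf ε Ψ| ≤ C * ‖weightedTrace d R Ψ‖ + η := by
  have hδ := hp.delta_pos
  have hR := hp.radius_pos
  have hCin := hp.cin_pos
  set I := ∫ t : ℝ≥0, Real.exp (-(t : ℝ)) ∂timeMeasure with hI
  have hI0 : 0 ≤ I := integral_nonneg fun t => (Real.exp_pos _).le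
  set A := Cin * I + R ^ (d - 2) / 4 + 1 with hA
  have hA0 : 0 < A := by positivity
  have main : ∀ Ψ : testSpace d R, ∀ η > 0, ∀ᶠ ε in vanishing,
      fluctuationFunctional hp hf ε Ψ ≤ A / δ * ‖weightedTrace d R Ψ‖ + η := by
    intro Ψ η hη
    set N := ‖weightedTrace d R Ψ‖ with hN
    set κ := (N + η * δ / A)⁻¹ with hκ
    have hNη : 0 < N + η * δ / A := by positivity
    have hκ0 : 0 < κ := inv_pos.2 hNη
    have hκN : κ ^ 2 * N ^ 2 ≤ 1 := by
      rw [← mul_pow]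
      refine pow_le_one₀ (by positivity) ?_
      rw [hκ, inv_mul_le_iff₀ hNη, mul_one]
      have : 0 < η * δ / A := by positivity
      linarith
    have hmem : (fun p => (κ * Real.exp (p.1 : ℝ)) * (Ψ : ℝ≥0 × Sp d × Sp d → ℝ) p) ∈
        testSpace d R := by
      refine time_mul_mem_testSpace Ψ.2 (β := fun t => κ * Real.exp (t : ℝ)) (by fun_prop)
        fun T => ⟨κ * Real.exp T, fun t ht => ?_⟩
      rw [abs_of_nonneg (by positivity)]
      gcongr
    have key := eventually_integral_fluctuation_le hp hf hmem
      (θ := fun t : ℝ≥0 => Real.exp (-(t : ℝ))) (by fun_prop) (fun t => (Real.exp_pos _).le)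
      (fun t => Real.exp_le_one_iff.2 (by simp)) integrable_exp_neg_timeMeasure one_pos
    filter_upwards [tendsto_val_vanishing.eventually key] with ε hε
    have e1 : ∫ p, fluctuation δ R τ f ε p * (Real.exp (-(p.1 : ℝ)) *
        ((κ * Real.exp (p.1 : ℝ)) * (Ψ : ℝ≥0 × Sp d × Sp d → ℝ) p)) ∂phaseMeasure d =
        κ * fluctuationFunctional hp hf ε Ψ := by
      rw [fluctuationFunctional]
      simp only [LinearMap.coe_mk, AddHom.coe_mk]
      rw [← integral_const_mul]
      refine integral_congr_ae (ae_of_all _ fun p => ?_)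
      simp only [Real.exp_neg]
      have := Real.exp_pos (p.1 : ℝ)
      field_simp
    have e2 : ∫ q, Real.exp (-(q.1 : ℝ)) * ((κ * Real.exp ((polarPoint q R).1 : ℝ)) *
        (Ψ : ℝ≥0 × Sp d × Sp d → ℝ) (polarPoint q R)) ^ 2 ∂rayMeasure d = κ ^ 2 * N ^ 2 := by
      rw [hN, norm_weightedTrace_sq, ← integral_const_mul]
      refine integral_congr_ae (ae_of_all _ fun q => ?_)
      simp only [Real.exp_neg, polarPoint]
      have := Real.exp_pos (q.1 : ℝ)
      field_simp
    rw [e1, e2] at hε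
    have h1 : δ * (κ * fluctuationFunctional hp hf ε Ψ) ≤ A := by
      have : R ^ (d - 2) / 4 * (κ ^ 2 * N ^ 2) ≤ R ^ (d - 2) / 4 * 1 := by gcongr
      linarith
    have h2 : fluctuationFunctional hp hf ε Ψ ≤ A / (δ * κ) := by
      rw [le_div_iff₀ (by positivity)]
      linarith
    refine h2.trans (le_of_eq ?_)
    rw [hκ]
    field_simp
  refine ⟨A / δ, fun Ψ η hη => ?_⟩
  filter_upwards [main Ψ η hη, main (-Ψ) η hη] with ε h1 h2
  rw [map_neg, map_neg, norm_neg] at h2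
  exact abs_le.2 ⟨by linarith, h1⟩

/-- The function on phase space that is equal to `ψ(t, x, σ)` on the ray in direction `σ`,
and to `0` where `v = 0`. -/
noncomputable def rayLift (ψ : ℝ≥0 × Sp d × Metric.sphere (0 : Sp d) 1 → ℝ)
    (p : ℝ≥0 × Sp d × Sp d) : ℝ :=
  Function.extend (fun q => polarPoint q 1) ψ 0 (p.1, p.2.1, ‖p.2.2‖⁻¹ • p.2.2)

lemma rayLift_polarPoint (ψ : ℝ≥0 × Sp d × Metric.sphere (0 : Sp d) 1 → ℝ)
    (q : ℝ≥0 × Sp d × Metric.sphere (0 : Sp d) 1) {r : ℝ} (hr : 0 < r) :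
    rayLift ψ (polarPoint q r) = ψ q := by
  have h : ((polarPoint q r).1, (polarPoint q r).2.1,
      ‖(polarPoint q r).2.2‖⁻¹ • (polarPoint q r).2.2) = polarPoint q 1 := by
    simp [polarPoint, norm_smul, abs_of_pos hr, smul_smul, inv_mul_cancel₀ hr.ne']
  rw [rayLift, h]
  exact (measurableEmbedding_polarPoint one_pos).injective.extend_apply ψ 0 q

lemma rayLift_eq_zero_or (ψ : ℝ≥0 × Sp d × Metric.sphere (0 : Sp d) 1 → ℝ)
    (p : ℝ≥0 × Sp d × Sp d) : rayLift ψ p = 0 ∨ ∃ σ, rayLift ψ p = ψ (p.1, p.2.1, σ) := by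
  by_cases h : ∃ q, polarPoint q 1 = (p.1, p.2.1, ‖p.2.2‖⁻¹ • p.2.2)
  · obtain ⟨q, hq⟩ := h
    right
    refine ⟨q.2.2, ?_⟩
    rw [rayLift, ← hq, (measurableEmbedding_polarPoint one_pos).injective.extend_apply]
    simp only [polarPoint, Prod.mk.injEq] at hq
    rw [← hq.1, ← hq.2.1]
  · left
    rw [rayLift, Function.extend_apply' _ _ _ h]
    rfl

lemma measurable_rayLift {ψ : ℝ≥0 × Sp d × Metric.sphere (0 : Sp d) 1 → ℝ} (hm : Measurable ψ) :
    Measurable (rayLift ψ) := by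
  have h := (measurableEmbedding_polarPoint (d := d) one_pos).measurable_extend hm
    (measurable_const (a := (0 : ℝ)))
  exact h.comp (by fun_prop)

lemma rayLift_mul_mem_testSpace (hR : 0 < R)
    {ψ : ℝ≥0 × Sp d × Metric.sphere (0 : Sp d) 1 → ℝ} (hm : Measurable ψ) {B M C : ℝ}
    (hM : ∀ q, |ψ q| ≤ M) (h0 : ∀ q, q ∉ rayBox d B → ψ q = 0) {φ : ℝ≥0 × Sp d × Sp d → ℝ}
    (hφ : Continuous φ) (hC : ∀ p, |φ p| ≤ C * (1 + ‖p.2.2‖ ^ 2)) :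
    (fun p => rayLift ψ p * φ p) ∈ testSpace d R := by
  refine ⟨(measurable_rayLift hm).mul hφ.measurable, fun q => ?_, |M| * |C| + |B|, fun p => ?_⟩
  · have h1 : (fun r => rayLift ψ (polarPoint q r)) =ᶠ[𝓝 R] fun _ => ψ q := by
      filter_upwards [lt_mem_nhds hR] with r hr
      exact rayLift_polarPoint ψ q hr
    refine (continuousAt_const.congr h1.symm).mul (hφ.continuousAt.comp ?_)
    exact (continuous_polarPoint.comp (by fun_prop : Continuous fun r : ℝ => (q, r))).continuousAt
  · have hC' : |φ p| ≤ |C| * (1 + ‖p.2.2‖ ^ 2) :=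
      (hC p).trans (mul_le_mul_of_nonneg_right (le_abs_self C) (by positivity))
    rcases rayLift_eq_zero_or ψ p with h | ⟨σ, h⟩
    · simp only [h, zero_mul, abs_zero, ne_eq, not_true_eq_false, IsEmpty.forall_iff, and_true]
      positivity
    · refine ⟨?_, fun hne => ?_⟩
      · simp only
        rw [h, abs_mul, add_mul, mul_assoc]
        have h1 : |ψ (p.1, p.2.1, σ)| * |φ p| ≤ |M| * (|C| * (1 + ‖p.2.2‖ ^ 2)) :=
          mul_le_mul ((hM _).trans (le_abs_self M)) hC' (abs_nonneg _) (abs_nonneg _)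
        have h2 : 0 ≤ |B| * (1 + ‖p.2.2‖ ^ 2) := by positivity
        linarith
      · have hq : (p.1, p.2.1, σ) ∈ rayBox d B := by
          by_contra hq
          exact hne (by simp only; rw [h, h0 _ hq, zero_mul])
        have hB : B ≤ |M| * |C| + |B| := by
          have := le_abs_self B
          have : 0 ≤ |M| * |C| := by positivity
          linarith
        exact ⟨le_trans hq.1 hB, le_trans (by simpa using hq.2.1) hB⟩

/-- The sharp bound on the limits. The test function is the truncation of `2 δ R^{-(d-2)}` times the
limit density itself, which optimizes the asymptotic Young inequality. -/
lemma ae_lintegral_rayDensity_sq_le (hp : AdmissibleParameters d δ R τ Cin)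
    (hf : UniformEntropyBound δ R τ τ Cin f) {l : Filter {ε : ℝ // 0 < ε}} [l.NeBot]
    (hl : l ≤ vanishing) {F : Lp ℝ 2 (rayMeasure d)}
    (hF : ∀ Ψ, Tendsto (fun ε => fluctuationFunctional hp hf ε Ψ) l
      (𝓝 (inner ℝ F (weightedTrace d R Ψ)))) :
    ∀ᵐ t ∂timeMeasure, ∫⁻ p, ENNReal.ofReal (rayDensity F (t, p) ^ 2)
      ∂((volume : Measure (Sp d)).prod (volume : Measure (Sp d)).toSphere) ≤
        ENNReal.ofReal (Cin * R ^ (d - 2) / δ ^ 2) := by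
  have hδ := hp.delta_pos
  have hR := hp.radius_pos
  have hCin := hp.cin_pos
  set G := rayDensity F with hG
  have hGm : Measurable G := measurable_rayDensity F
  set A : ℕ → Set (ℝ≥0 × Sp d × Metric.sphere (0 : Sp d) 1) :=
    fun N => rayBox d N ∩ {q | |G q| ≤ N} with hA
  have hAm : ∀ N, MeasurableSet (A N) := fun N =>
    (measurableSet_rayBox d N).inter (measurableSet_le hGm.abs measurable_const)
  set GN : ℕ → ℝ≥0 × Sp d × Metric.sphere (0 : Sp d) 1 → ℝ := fun N => (A N).indicator G with hGN
  have hGNm : ∀ N, Measurable (GN N) := fun N => hGm.indicator (hAm N)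
  have hGNle : ∀ (N : ℕ) q, |GN N q| ≤ N := by
    intro N q
    by_cases hq : q ∈ A N
    · simp only [hGN]
      rw [indicator_of_mem hq]
      exact hq.2
    · simp only [hGN]
      rw [indicator_of_notMem hq]
      simp
  have hGN0 : ∀ (N : ℕ) q, q ∉ rayBox d N → GN N q = 0 := fun N q hq =>
    indicator_of_notMem (fun h => hq h.1) _
  have hGGN : ∀ N q, G q * GN N q = GN N q ^ 2 := by
    intro N q
    by_cases hq : q ∈ A N
    · simp only [hGN]
      rw [indicator_of_mem hq]
      ring
    · simp only [hGN]
      rw [indicator_of_notMem hq]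
      ring
  -- the multiple for which the linear term of Young's inequality is twice the quadratic one
  set k : ℝ := 2 * δ / R ^ (d - 2) with hk
  have hRd : 0 < R ^ (d - 2) := by positivity
  have hstep : ∀ N : ℕ, ∀ᵐ t ∂timeMeasure, ∫⁻ p, ENNReal.ofReal (GN N (t, p) ^ 2)
      ∂((volume : Measure (Sp d)).prod (volume : Measure (Sp d)).toSphere) ≤
        ENNReal.ofReal (Cin * R ^ (d - 2) / δ ^ 2) := by
    intro N
    have hsm : Measurable fun q => ENNReal.ofReal (GN N q ^ 2) :=
      ((hGNm N).pow_const 2).ennreal_ofReal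
    refine ae_le_of_forall_setLIntegral_le_of_sigmaFinite hsm.lintegral_prod_right'
      fun s hs hsfin => ?_
    set θ : ℝ≥0 → ℝ := s.indicator fun _ => 1 with hθ
    have hθm : Measurable θ := measurable_const.indicator hs
    have hθ0 : ∀ t, 0 ≤ θ t := fun t => indicator_nonneg (fun _ _ => zero_le_one) t
    have hθ1 : ∀ t, θ t ≤ 1 := fun t =>
      indicator_le_self' (f := fun _ => (1 : ℝ)) (fun _ _ => zero_le_one) t
    have hθi : Integrable θ timeMeasure := by
      rw [hθ, integrable_indicator_iff hs]
      exact integrableOn_const hsfin.ne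
    have hmem : (fun p => rayLift (fun q => k * GN N q) p * 1) ∈ testSpace d R :=
      rayLift_mul_mem_testSpace hR ((hGNm N).const_mul k) (B := N) (M := |k| * N) (C := 1)
        (fun q => by rw [abs_mul]; gcongr; exact hGNle N q)
        (fun q hq => by rw [hGN0 N q hq, mul_zero]) continuous_const
        (fun p => by rw [abs_one, one_mul]; exact le_add_of_nonneg_right (sq_nonneg _))
    have htr : ∀ q, rayLift (fun q => k * GN N q) (polarPoint q R) = k * GN N q := fun q =>
      rayLift_polarPoint _ q hR
    have hmem' := time_mul_mem_testSpace hmem hθm fun T => ⟨1, fun t _ => by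
      rw [abs_of_nonneg (hθ0 t)]; exact hθ1 t⟩
    have hlim := (hF ⟨_, hmem'⟩).const_mul δ
    set J := ∫ q, θ q.1 * GN N q ^ 2 ∂rayMeasure d with hJ
    have hJi : Integrable (fun q => θ q.1 * GN N q ^ 2) (rayMeasure d) := by
      rw [← memLp_one_iff_integrable]
      refine memLp_of_bounded_of_rayBox (F := fun q => θ q.1 * GN N q ^ 2) (B := N)
        (M := 1 * (N : ℝ) ^ 2) ((hθm.comp measurable_fst).mul ((hGNm N).pow_const 2))
        (fun q _ => ?_) (fun q hq => by rw [hGN0 N q hq]; ring) 1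
      rw [abs_mul, abs_of_nonneg (hθ0 _), abs_pow]
      gcongr
      · exact hθ1 _
      · exact hGNle N q
    have hin : inner ℝ F (weightedTrace d R ⟨_, hmem'⟩) = k * J := by
      rw [inner_weightedTrace, hJ, ← integral_const_mul]
      refine integral_congr_ae (ae_of_all _ fun q => ?_)
      simp only
      rw [htr, ← hG, ← hGGN N q]
      simp only [polarPoint]
      ring
    rw [hin] at hlim
    have hquad : ∫ q, θ q.1 * (rayLift (fun q => k * GN N q) (polarPoint q R) * 1) ^ 2
        ∂rayMeasure d = k ^ 2 * J := by
      rw [hJ, ← integral_const_mul]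
      refine integral_congr_ae (ae_of_all _ fun q => ?_)
      simp only
      rw [htr]
      ring
    have hineq : δ * (k * J) ≤ Cin * ∫ t, θ t ∂timeMeasure + R ^ (d - 2) / 4 * (k ^ 2 * J) := by
      refine le_of_forall_pos_le_add fun η hη => ?_
      refine le_of_tendsto hlim ?_
      have := (tendsto_val_vanishing.mono_left hl).eventually
        (eventually_integral_fluctuation_le hp hf hmem hθm hθ0 hθ1 hθi hη)
      rw [hquad] at this
      exact this
    have hJle : J ≤ Cin * R ^ (d - 2) / δ ^ 2 * ∫ t, θ t ∂timeMeasure := by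
      rw [hk] at hineq
      have h1 : δ ^ 2 / R ^ (d - 2) * J ≤ Cin * ∫ t, θ t ∂timeMeasure := by
        have e1 : δ * (2 * δ / R ^ (d - 2) * J) = 2 * (δ ^ 2 / R ^ (d - 2) * J) := by ring
        have e2 : R ^ (d - 2) / 4 * ((2 * δ / R ^ (d - 2)) ^ 2 * J) =
            δ ^ 2 / R ^ (d - 2) * J := by field_simp; ring
        rw [e1, e2] at hineq
        linarith
      have h2 : J = R ^ (d - 2) / δ ^ 2 * (δ ^ 2 / R ^ (d - 2) * J) := by field_simp
      rw [h2]
      calc _ ≤ R ^ (d - 2) / δ ^ 2 * (Cin * ∫ t, θ t ∂timeMeasure) := by gcongr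
        _ = _ := by ring
    have hθint : ∫ t, θ t ∂timeMeasure = (timeMeasure s).toReal := by
      rw [hθ, integral_indicator_const _ hs]
      simp [Measure.real]
    have hleft : ∫⁻ t in s, ∫⁻ p, ENNReal.ofReal (GN N (t, p) ^ 2)
        ∂((volume : Measure (Sp d)).prod (volume : Measure (Sp d)).toSphere) ∂timeMeasure =
        ENNReal.ofReal J := by
      rw [hJ, ofReal_integral_eq_lintegral_ofReal hJi (ae_of_all _ fun q =>
        mul_nonneg (hθ0 _) (sq_nonneg _)), rayMeasure, lintegral_prod, ← lintegral_indicator hs]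
      · refine lintegral_congr fun t => ?_
        by_cases ht : t ∈ s
        · simp [hθ, ht]
        · simp [hθ, ht]
      · exact ((hθm.comp measurable_fst).mul ((hGNm N).pow_const 2)).ennreal_ofReal.aemeasurable
    rw [hleft, lintegral_const, Measure.restrict_apply_univ, ← ENNReal.ofReal_toReal hsfin.ne,
      ← ENNReal.ofReal_mul (by positivity), ← hθint]
    exact ENNReal.ofReal_le_ofReal hJle
  filter_upwards [ae_all_iff.2 hstep] with t ht
  have hmono : ∀ p, Tendsto (fun N => ENNReal.ofReal (GN N (t, p) ^ 2)) atTop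
      (𝓝 (ENNReal.ofReal (G (t, p) ^ 2))) := by
    intro p
    refine tendsto_const_nhds.congr' ?_
    obtain ⟨N₀, hN₀⟩ := exists_nat_ge (max (t : ℝ) (max ‖p.1‖ |G (t, p)|))
    filter_upwards [eventually_ge_atTop N₀] with N hN
    have hN' : max (t : ℝ) (max ‖p.1‖ |G (t, p)|) ≤ N := hN₀.trans (by exact_mod_cast hN)
    rw [max_le_iff, max_le_iff] at hN'
    have hmem : (t, p) ∈ A N :=
      ⟨⟨hN'.1, by simpa using hN'.2.1, trivial⟩, hN'.2.2⟩
    simp only [hGN]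
    rw [indicator_of_mem hmem]
  have hfatou := lintegral_liminf_le (u := atTop) (f := fun N p => ENNReal.ofReal (GN N (t, p) ^ 2))
    (μ := (volume : Measure (Sp d)).prod (volume : Measure (Sp d)).toSphere)
    fun N => (((hGNm N).comp measurable_prodMk_left).pow_const 2).ennreal_ofReal
  simp_rw [fun p => (hmono p).liminf_eq] at hfatou
  refine hfatou.trans ?_
  exact liminf_le_of_frequently_le' (Frequently.of_forall ht)

end Limits

/-! ### Weak topologies, and signed Radon measures -/

/-- A criterion for relative compactness in a weak topology induced by a family of real functionals:
these are bounded, and along every ultrafilter they converge to those of some point. -/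
lemma isCompact_closure_image_of_isInducing {Y ι κ : Type*} [TopologicalSpace Y] {Φ : Y → ι → ℝ}
    (hΦ : IsInducing Φ) {G : κ → Y} {A : Set κ} (hb : ∀ i, ∃ C, ∀ a ∈ A, |Φ (G a) i| ≤ C)
    (hu : ∀ u : Ultrafilter κ, A ∈ u → ∃ y, ∀ i,
      Tendsto (fun a => Φ (G a) i) u (𝓝 (Φ y i))) : IsCompact (closure (G '' A)) := by
  choose C hC using hb
  have hcomp : IsCompact (closure (Φ '' (G '' A))) := by
    refine (isCompact_univ_pi fun i => isCompact_Icc (a := -C i) (b := C i)).of_isClosed_subset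
      isClosed_closure (closure_minimal ?_ (isClosed_set_pi fun i _ => isClosed_Icc))
    rintro _ ⟨_, ⟨a, ha, rfl⟩, rfl⟩ i -
    exact abs_le.1 (hC i a ha)
  have hrange : closure (Φ '' (G '' A)) ⊆ range Φ := by
    intro z hz
    have hz' : MapClusterPt z (𝓟 A) (Φ ∘ G) := by
      rw [MapClusterPt, map_principal, image_comp]
      exact mem_closure_iff_clusterPt.1 hz
    obtain ⟨u, huA, huz⟩ := mapClusterPt_iff_ultrafilter.1 hz'
    obtain ⟨y, hy⟩ := hu u (le_principal_iff.1 huA)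
    exact ⟨y, tendsto_nhds_unique (tendsto_pi_nhds.2 hy) huz⟩
  rw [hΦ.closure_eq_preimage_closure_image, hΦ.isCompact_iff, image_preimage_eq_inter_range,
    inter_eq_left.2 hrange]
  exact hcomp

namespace LocRadonMeasure

variable {X : Type*} [TopologicalSpace X] [MeasurableSpace X]

lemma isInducing_pairing :
    IsInducing fun (μ : LocRadonMeasure X) (φ : C_c(X, ℝ)) => μ.pairing φ := ⟨rfl⟩

lemma tendsto_iff {ι : Type*} {l : Filter ι} {G : ι → LocRadonMeasure X} {μ : LocRadonMeasure X} :
    Tendsto G l (𝓝 μ) ↔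
      ∀ φ : C_c(X, ℝ), Tendsto (fun i => (G i).pairing φ) l (𝓝 (μ.pairing φ)) := by
  rw [isInducing_pairing.tendsto_nhds_iff, tendsto_pi_nhds]
  rfl

lemma pairing_ofDensity [BorelSpace X] [TopologicalSpace.PseudoMetrizableSpace X]
    [LocallyCompactSpace X] [SecondCountableTopology X] {m : Measure X} [SFinite m] {f : X → ℝ}
    (hf : LocallyIntegrable f m) {φ : X → ℝ} (hφ : AEStronglyMeasurable φ m)
    (hi : Integrable (fun x => f x * φ x) m) :
    (ofDensity m f hf).pairing φ = ∫ x, f x * φ x ∂m := by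
  have hm : AEMeasurable f m := hf.aestronglyMeasurable.aemeasurable
  have key : ∀ h : X → ℝ, AEMeasurable h m →
      ∫ x, φ x ∂(m.withDensity fun x => ENNReal.ofReal (h x)) = ∫ x, max (h x) 0 * φ x ∂m := by
    intro h hh
    rw [integral_withDensity_eq_integral_toReal_smul₀ hh.ennreal_ofReal
      (ae_of_all _ fun _ => ENNReal.ofReal_lt_top)]
    simp only [ENNReal.toReal_ofReal', smul_eq_mul]
  have hint : ∀ h : X → ℝ, AEMeasurable h m → (∀ x, |h x| = |f x|) →
      Integrable (fun x => max (h x) 0 * φ x) m := by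
    intro h hh habs
    refine hi.mono ((hh.max aemeasurable_const).aestronglyMeasurable.mul hφ)
      (ae_of_all _ fun x => ?_)
    rw [norm_mul, norm_mul]
    gcongr
    rw [Real.norm_eq_abs, Real.norm_eq_abs, ← habs]
    rcases le_total (h x) 0 with h0 | h0
    · rw [max_eq_right h0]
      simp
    · rw [max_eq_left h0]
  rw [pairing, ofDensity]
  simp only
  rw [key f hm, key (fun x => -f x) hm.neg, ← integral_sub (hint f hm fun _ => rfl)
    (hint (fun x => -f x) hm.neg fun x => abs_neg _)]
  refine integral_congr_ae (ae_of_all _ fun x => ?_)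
  simp only
  rw [← sub_mul]
  congr 1
  rcases le_total (f x) 0 with h0 | h0
  · rw [max_eq_right h0, max_eq_left (by linarith)]
    ring
  · rw [max_eq_left h0, max_eq_right (by linarith)]
    ring

/-- Uniqueness of the Jordan decomposition: only the restrictions of the measures to the four
intersections of Hahn sets have to be compared, so that no finiteness is needed. -/
lemma eq_of_add_eq {μ ν : LocRadonMeasure X} (h : μ.pos + ν.neg = ν.pos + μ.neg) : μ = ν := by
  obtain ⟨A, hA, hA1, hA2⟩ := μ.mutuallySingular
  obtain ⟨B, hB, hB1, hB2⟩ := ν.mutuallySingular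
  have hs : ∀ s, μ.pos s + ν.neg s = ν.pos s + μ.neg s := fun s => by
    rw [← Measure.add_apply, h, Measure.add_apply]
  have null : ∀ (m : Measure X) (s t : Set X), s ⊆ t → m t = 0 → m s = 0 := fun m s t hst ht =>
    measure_mono_null hst ht
  have hsplit : ∀ (m : Measure X) (s : Set X), m s =
      m (s ∩ A ∩ B) + m ((s ∩ A) \ B) + (m ((s \ A) ∩ B) + m ((s \ A) \ B)) := fun m s => by
    rw [measure_inter_add_sdiff _ hB, measure_inter_add_sdiff _ hB, measure_inter_add_sdiff _ hA]
  have p1 : ∀ s, μ.pos (s ∩ A ∩ B) = 0 := fun s => null _ _ A (fun x hx => hx.1.2) hA1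
  have p2 : ∀ s, μ.pos ((s ∩ A) \ B) = 0 := fun s => null _ _ A (fun x hx => hx.1.2) hA1
  have m3 : ∀ s, μ.neg ((s \ A) ∩ B) = 0 := fun s => null _ _ Aᶜ (fun x hx => hx.1.2) hA2
  have m4 : ∀ s, μ.neg ((s \ A) \ B) = 0 := fun s => null _ _ Aᶜ (fun x hx => hx.1.2) hA2
  have q1 : ∀ s, ν.pos (s ∩ A ∩ B) = 0 := fun s => null _ _ B (fun x hx => hx.2) hB1
  have q3 : ∀ s, ν.pos ((s \ A) ∩ B) = 0 := fun s => null _ _ B (fun x hx => hx.2) hB1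
  have n2 : ∀ s, ν.neg ((s ∩ A) \ B) = 0 := fun s => null _ _ Bᶜ (fun x hx => hx.2) hB2
  have n4 : ∀ s, ν.neg ((s \ A) \ B) = 0 := fun s => null _ _ Bᶜ (fun x hx => hx.2) hB2
  have e1 := fun s => hs (s ∩ A ∩ B)
  have e2 := fun s => hs ((s ∩ A) \ B)
  have e3 := fun s => hs ((s \ A) ∩ B)
  have e4 := fun s => hs ((s \ A) \ B)
  simp only [p1, q1, zero_add] at e1
  simp only [p2, n2, zero_add] at e2
  simp only [m3, q3, add_zero] at e3
  simp only [m4, n4, add_zero] at e4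
  have z2 : ∀ s, ν.pos ((s ∩ A) \ B) = 0 ∧ μ.neg ((s ∩ A) \ B) = 0 := fun s =>
    add_eq_zero.1 (e2 s).symm
  have z3 : ∀ s, μ.pos ((s \ A) ∩ B) = 0 ∧ ν.neg ((s \ A) ∩ B) = 0 := fun s =>
    add_eq_zero.1 (e3 s)
  refine LocRadonMeasure.ext (Measure.ext fun s _ => ?_) (Measure.ext fun s _ => ?_)
  · rw [hsplit μ.pos s, hsplit ν.pos s, p1, p2, q1, q3, e4, (z2 s).1, (z3 s).1]
  · rw [hsplit μ.neg s, hsplit ν.neg s, m3, m4, n2, n4, ← e1, (z2 s).2, (z3 s).2]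

/-- A signed Radon measure is determined by its pairing with the test functions. -/
lemma eq_of_pairing_eq [T2Space X] [BorelSpace X] [TopologicalSpace.PseudoMetrizableSpace X]
    [LocallyCompactSpace X] [SecondCountableTopology X] {μ ν : LocRadonMeasure X}
    (h : ∀ φ : C_c(X, ℝ), μ.pairing φ = ν.pairing φ) : μ = ν := by
  apply eq_of_add_eq
  have := μ.regular_pos
  have := μ.regular_neg
  have := ν.regular_pos
  have := ν.regular_neg
  have hr : ∀ (m₁ m₂ : Measure X) [m₁.Regular] [m₂.Regular], (m₁ + m₂).Regular := by
    intro m₁ m₂ _ _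
    have : IsFiniteMeasureOnCompacts (m₁ + m₂) :=
      ⟨fun K hK => by
        rw [Measure.add_apply]
        exact ENNReal.add_lt_top.2 ⟨hK.measure_lt_top, hK.measure_lt_top⟩⟩
    have : IsLocallyFiniteMeasure (m₁ + m₂) := isLocallyFiniteMeasure_of_isFiniteMeasureOnCompacts
    infer_instance
  have := hr μ.pos ν.neg
  have := hr ν.pos μ.neg
  refine Measure.ext_of_integral_eq_on_compactlySupported fun φ => ?_
  have hi : ∀ (m : Measure X) [m.Regular], Integrable φ m := fun m _ =>
    φ.continuous.integrable_of_hasCompactSupport φ.hasCompactSupport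
  rw [integral_add_measure (hi _) (hi _), integral_add_measure (hi _) (hi _)]
  have := h φ
  simp only [pairing] at this
  linarith

end LocRadonMeasure

/-! ### Weak-star limits of the fluctuations -/

section WeakStar

variable {d : ℕ} {δ R τ Cin : ℝ} {f : ℝ → ℝ≥0 × Sp d × Sp d → ℝ}

lemma mem_testSpace_of_continuous {φ : ℝ≥0 × Sp d × Sp d → ℝ} (hφ : Continuous φ) {B : ℝ}
    (h : BoundedByBox B φ) : φ ∈ testSpace d R :=
  ⟨hφ.measurable, fun q => (hφ.comp (continuous_polarPoint.comp
    (by fun_prop : Continuous fun r : ℝ => (q, r)))).continuousAt, B, h⟩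

lemma exists_boundedByBox {φ : ℝ≥0 × Sp d × Sp d → ℝ} {C : ℝ}
    (hC : ∀ p, |φ p| ≤ C * (1 + ‖p.2.2‖ ^ 2)) (hK : CompactInTimeSpace φ) :
    ∃ B, BoundedByBox B φ := by
  obtain ⟨K, hK, h0⟩ := hK
  obtain ⟨T, hT⟩ := hK.exists_bound_of_continuousOn
    (f := fun z : ℝ≥0 × Sp d => ((z.1 : ℝ), z.2)) (by fun_prop)
  refine ⟨|C| + |T|, fun p => ⟨(hC p).trans ?_, fun hne => ?_⟩⟩
  · have h1 := le_abs_self C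
    have h2 := abs_nonneg T
    gcongr
    linarith
  · have hp : (p.1, p.2.1) ∈ K := by
      by_contra hp
      exact hne (h0 _ _ _ hp)
    have h1 := hT _ hp
    rw [Prod.norm_def, max_le_iff] at h1
    have h2 := le_abs_self T
    have h3 := abs_nonneg C
    have h4 := le_abs_self (p.1 : ℝ)
    exact ⟨by linarith [h1.1, Real.norm_eq_abs (p.1 : ℝ)], by linarith [h1.2]⟩

lemma CompactInTimeSpace.of_hasCompactSupport {φ : ℝ≥0 × Sp d × Sp d → ℝ}
    (h : HasCompactSupport φ) : CompactInTimeSpace φ := by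
  refine ⟨(fun p : ℝ≥0 × Sp d × Sp d => (p.1, p.2.1)) '' tsupport φ,
    h.isCompact.image (by fun_prop), fun t x v hn => ?_⟩
  by_contra h0
  exact hn ⟨(t, x, v), subset_tsupport _ h0, rfl⟩

lemma exists_boundedByBox_of_hasCompactSupport {φ : ℝ≥0 × Sp d × Sp d → ℝ} (hφ : Continuous φ)
    (h : HasCompactSupport φ) : ∃ B, BoundedByBox B φ := by
  obtain ⟨C, hC⟩ := h.exists_bound_of_continuous hφ
  refine exists_boundedByBox (C := C) (fun p => (hC p).trans ?_)
    (CompactInTimeSpace.of_hasCompactSupport h)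
  have h0 : 0 ≤ C := (norm_nonneg _).trans (hC p)
  nlinarith [mul_nonneg h0 (sq_nonneg ‖p.2.2‖)]

/-- The inclusion of the continuous compactly supported functions into the test space. -/
noncomputable def compactlySupportedTest (d : ℕ) (R : ℝ) :
    C_c(ℝ≥0 × Sp d × Sp d, ℝ) →ₗ[ℝ] testSpace d R where
  toFun φ := ⟨φ, by
    obtain ⟨B, hB⟩ := exists_boundedByBox_of_hasCompactSupport φ.continuous φ.hasCompactSupport
    exact mem_testSpace_of_continuous φ.continuous hB⟩
  map_add' _ _ := rfl
  map_smul' _ _ := rfl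

/-- The signed Radon measure `g_ε dt dx dv`. -/
noncomputable def fluctuationMeasure (hp : AdmissibleParameters d δ R τ Cin)
    (hf : UniformEntropyBound δ R τ τ Cin f) (ε : {ε : ℝ // 0 < ε}) :
    LocRadonMeasure (ℝ≥0 × Sp d × Sp d) :=
  LocRadonMeasure.ofDensity (phaseMeasure d) (fluctuation δ R τ f ε)
    (locallyIntegrable_fluctuation hp hf ε.2)

lemma pairing_fluctuationMeasure (hp : AdmissibleParameters d δ R τ Cin)
    (hf : UniformEntropyBound δ R τ τ Cin f) (ε : {ε : ℝ // 0 < ε})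
    (φ : C_c(ℝ≥0 × Sp d × Sp d, ℝ)) : (fluctuationMeasure hp hf ε).pairing φ =
      fluctuationFunctional hp hf ε (compactlySupportedTest d R φ) :=
  LocRadonMeasure.pairing_ofDensity _ φ.continuous.aestronglyMeasurable
    (integrable_fluctuation_mul_testSpace hp hf ε.2 (compactlySupportedTest d R φ))

lemma integral_fermiMeasure (hR : 0 < R) (H : ℝ≥0 × Sp d × Sp d → ℝ) :
    ∫ p, H p ∂fermiMeasure d R = R ^ (d - 1) * ∫ q, H (polarPoint q R) ∂rayMeasure d := by
  rw [fermiMeasure_eq_map, integral_smul_measure,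
    (measurableEmbedding_polarPoint hR).integral_map, ENNReal.toReal_ofReal (by positivity),
    smul_eq_mul]

lemma integrable_fermiMeasure_iff (hR : 0 < R) {H : ℝ≥0 × Sp d × Sp d → ℝ} :
    Integrable H (fermiMeasure d R) ↔ Integrable (fun q => H (polarPoint q R)) (rayMeasure d) := by
  have h0 : ENNReal.ofReal (R ^ (d - 1)) ≠ 0 := by
    simp only [ne_eq, ENNReal.ofReal_eq_zero, not_le]
    positivity
  rw [fermiMeasure_eq_map, integrable_smul_measure h0 ENNReal.ofReal_ne_top,
    (measurableEmbedding_polarPoint hR).integrable_map_iff]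
  rfl

/-- The density `g(t, x, ω)` with respect to the surface measure of the Fermi sphere, as a function
on phase space that is constant on rays. -/
noncomputable def fermiDensity (R : ℝ) (F : Lp ℝ 2 (rayMeasure d)) (p : ℝ≥0 × Sp d × Sp d) : ℝ :=
  (R ^ (d - 1))⁻¹ * rayLift (rayDensity F) p

lemma measurable_fermiDensity (R : ℝ) (F : Lp ℝ 2 (rayMeasure d)) :
    Measurable (fermiDensity R F) :=
  (measurable_rayLift (measurable_rayDensity F)).const_mul _

lemma fermiDensity_polarPoint (hR : 0 < R) (F : Lp ℝ 2 (rayMeasure d))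
    (q : ℝ≥0 × Sp d × Metric.sphere (0 : Sp d) 1) :
    fermiDensity R F (polarPoint q R) = (R ^ (d - 1))⁻¹ * rayDensity F q := by
  rw [fermiDensity, rayLift_polarPoint _ _ hR]

lemma sphericalExtension_fermiDensity (hR : 0 < R) (F : Lp ℝ 2 (rayMeasure d)) :
    sphericalExtension R (fermiDensity R F) = fermiDensity R F := by
  ext p
  simp only [sphericalExtension, fermiDensity, rayLift]
  congr 3
  by_cases h : p.2.2 = 0
  · simp [h]
  · have h' : ‖p.2.2‖ ≠ 0 := norm_ne_zero_iff.2 h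
    rw [norm_smul, smul_smul, norm_div, Real.norm_of_nonneg hR.le, norm_norm]
    congr 3
    field_simp

lemma integral_fermiDensity_mul (hR : 0 < R) (F : Lp ℝ 2 (rayMeasure d)) (Ψ : testSpace d R) :
    ∫ p, fermiDensity R F p * (Ψ : ℝ≥0 × Sp d × Sp d → ℝ) p ∂fermiMeasure d R =
      inner ℝ F (weightedTrace d R Ψ) := by
  rw [integral_fermiMeasure hR, inner_weightedTrace, ← integral_const_mul]
  refine integral_congr_ae (ae_of_all _ fun q => ?_)
  simp only
  rw [fermiDensity_polarPoint hR]
  have : 0 < R ^ (d - 1) := by positivity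
  field_simp

lemma integrable_fermiDensity_mul (hR : 0 < R) (F : Lp ℝ 2 (rayMeasure d)) (Ψ : testSpace d R) :
    Integrable (fun p => fermiDensity R F p * (Ψ : ℝ≥0 × Sp d × Sp d → ℝ) p)
      (fermiMeasure d R) := by
  obtain ⟨m, -, B, h⟩ := Ψ.2
  rw [integrable_fermiMeasure_iff hR]
  have := integrable_rayDensity_mul F (measurable_trace m R) (B := B)
    (fun q _ => h.abs_polarPoint_le q R) (fun q hq => h.eq_zero_of_notMem_rayBox hq R)
  refine (this.const_mul (R ^ (d - 1))⁻¹).congr (ae_of_all _ fun q => ?_)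
  simp only
  rw [fermiDensity_polarPoint hR, mul_assoc]

lemma exists_phaseBox_mem_nhds (p : ℝ≥0 × Sp d × Sp d) : ∃ B, phaseBox d B ∈ 𝓝 p := by
  refine ⟨max (p.1 + 1 : ℝ) (‖p.2.1‖ + 1), ?_⟩
  have h1 : ∀ᶠ p' in 𝓝 p, (p'.1 : ℝ) < max (p.1 + 1 : ℝ) (‖p.2.1‖ + 1) :=
    (by fun_prop : Continuous fun p' : ℝ≥0 × Sp d × Sp d => (p'.1 : ℝ)).continuousAt.eventually
      (gt_mem_nhds (lt_max_of_lt_left (by linarith)))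
  have h2 : ∀ᶠ p' in 𝓝 p, ‖p'.2.1‖ < max (p.1 + 1 : ℝ) (‖p.2.1‖ + 1) :=
    (by fun_prop : Continuous fun p' : ℝ≥0 × Sp d × Sp d => ‖p'.2.1‖).continuousAt.eventually
      (gt_mem_nhds (lt_max_of_lt_right (by linarith)))
  filter_upwards [h1, h2] with p' hp1 hp2
  exact ⟨hp1.le, by simpa using hp2.le, trivial⟩

lemma locallyIntegrable_fermiDensity (hR : 0 < R) (F : Lp ℝ 2 (rayMeasure d)) :
    LocallyIntegrable (fermiDensity R F) (fermiMeasure d R) := by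
  intro p
  obtain ⟨B, hB⟩ := exists_phaseBox_mem_nhds p
  refine ⟨phaseBox d B, hB, ?_⟩
  rw [← integrable_indicator_iff (measurableSet_phaseBox d B), integrable_fermiMeasure_iff hR]
  have := integrable_rayDensity_mul F (h := (rayBox d B).indicator fun _ => (R ^ (d - 1))⁻¹)
    (B := B) (M := (R ^ (d - 1))⁻¹) (measurable_const.indicator (measurableSet_rayBox d B))
    (fun q hq => by rw [indicator_of_mem hq, abs_of_pos (by positivity)])
    (fun q hq => indicator_of_notMem hq _)
  refine this.congr (ae_of_all _ fun q => ?_)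
  by_cases hq : q ∈ rayBox d B
  · have hq' : polarPoint q R ∈ phaseBox d B := ⟨hq.1, hq.2.1, trivial⟩
    simp only
    rw [indicator_of_mem hq', indicator_of_mem hq, fermiDensity_polarPoint hR, mul_comm]
  · have hq' : polarPoint q R ∉ phaseBox d B := fun h => hq ⟨h.1, h.2.1, trivial⟩
    simp only
    rw [indicator_of_notMem hq', indicator_of_notMem hq, mul_zero]

/-- The signed Radon measure carried by the Fermi sphere with density `fermiDensity`. -/
noncomputable def limitMeasure (hR : 0 < R) (F : Lp ℝ 2 (rayMeasure d)) :
    LocRadonMeasure (ℝ≥0 × Sp d × Sp d) :=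
  LocRadonMeasure.ofDensity (fermiMeasure d R) (fermiDensity R F)
    (locallyIntegrable_fermiDensity hR F)

lemma pairing_limitMeasure (hR : 0 < R) (F : Lp ℝ 2 (rayMeasure d))
    (φ : C_c(ℝ≥0 × Sp d × Sp d, ℝ)) : (limitMeasure hR F).pairing φ =
      inner ℝ F (weightedTrace d R (compactlySupportedTest d R φ)) := by
  rw [← integral_fermiDensity_mul hR]
  exact LocRadonMeasure.pairing_ofDensity _ φ.continuous.aestronglyMeasurable
    (integrable_fermiDensity_mul hR F (compactlySupportedTest d R φ))

/-- An integrable continuous positive weight on phase space. -/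
noncomputable def decayWeight (p : ℝ≥0 × Sp d × Sp d) : ℝ :=
  Real.exp (-(p.1 : ℝ)) * ((1 + ‖p.2.1‖) ^ (-((d : ℝ) + 1)) * (1 + ‖p.2.2‖) ^ (-((d : ℝ) + 1)))

lemma decayWeight_pos (p : ℝ≥0 × Sp d × Sp d) : 0 < decayWeight p := by
  unfold decayWeight
  positivity

lemma continuous_decayWeight : Continuous (decayWeight (d := d)) := by
  unfold decayWeight
  refine Continuous.mul (by fun_prop) (Continuous.mul ?_ ?_)
  · exact Continuous.rpow_const (by fun_prop) fun p => Or.inl (by positivity)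
  · exact Continuous.rpow_const (by fun_prop) fun p => Or.inl (by positivity)

lemma integrable_decayWeight : Integrable (decayWeight (d := d)) (phaseMeasure d) := by
  have h : Integrable (fun x : Sp d => (1 + ‖x‖) ^ (-((d : ℝ) + 1))) volume :=
    integrable_one_add_norm (by rw [finrank_euclideanSpace_fin]; linarith)
  exact integrable_exp_neg_timeMeasure.mul_prod (h.mul_prod h)

lemma memLp_sqrt_decayWeight :
    MemLp (fun p => √(decayWeight (d := d) p)) 2 (phaseMeasure d) := by
  rw [memLp_two_iff_integrable_sq continuous_decayWeight.sqrt.aestronglyMeasurable]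
  refine integrable_decayWeight.congr (ae_of_all _ fun p => ?_)
  exact (Real.sq_sqrt (decayWeight_pos p).le).symm

lemma memLp_div_sqrt_decayWeight (φ : C_c(ℝ≥0 × Sp d × Sp d, ℝ)) :
    MemLp (fun p => φ p / √(decayWeight p)) 2 (phaseMeasure d) := by
  have hc : Continuous fun p => φ p / √(decayWeight p) :=
    φ.continuous.div continuous_decayWeight.sqrt fun p => (Real.sqrt_pos.2 (decayWeight_pos p)).ne'
  refine hc.memLp_of_hasCompactSupport ?_
  exact φ.hasCompactSupport.mono fun p hp h0 => hp (by simp [h0])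

/-- The embedding of the compactly supported functions into `L²`, with a weight such that the dual
norm controls uniformly bounded densities. -/
noncomputable def weightedEmbedding (d : ℕ) :
    C_c(ℝ≥0 × Sp d × Sp d, ℝ) →ₗ[ℝ] Lp ℝ 2 (phaseMeasure d) where
  toFun φ := (memLp_div_sqrt_decayWeight φ).toLp _
  map_add' φ₁ φ₂ := by
    rw [← MemLp.toLp_add]
    congr 1
    ext p
    simp [add_div]
  map_smul' c φ := by
    rw [RingHom.id_apply, ← MemLp.toLp_const_smul]
    congr 1
    ext p
    simp [mul_div_assoc]

lemma exists_abs_functional_le_weightedEmbedding (hp : AdmissibleParameters d δ R τ Cin)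
    (hf : UniformEntropyBound δ R τ τ Cin f) {η : ℝ} (hη : 0 < η) :
    ∃ C : ℝ, ∀ ε : {ε : ℝ // 0 < ε}, η ≤ ε → ∀ φ : C_c(ℝ≥0 × Sp d × Sp d, ℝ),
      |fluctuationFunctional hp hf ε (compactlySupportedTest d R φ)| ≤
        C * ‖weightedEmbedding d φ‖ := by
  have hδ := hp.delta_pos
  set w := (memLp_sqrt_decayWeight (d := d)).toLp _ with hw
  refine ⟨δ⁻¹ / η * ‖w‖, fun ε hε φ => ?_⟩
  have h2 := (memLp_div_sqrt_decayWeight φ).norm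
  have hnorm : ‖h2.toLp _‖ = ‖weightedEmbedding d φ‖ := by
    rw [weightedEmbedding]
    simp only [LinearMap.coe_mk, AddHom.coe_mk, Lp.norm_toLp]
    congr 1
    exact eLpNorm_norm _
  have hinner : inner ℝ w (h2.toLp _) = ∫ p, |φ p| ∂phaseMeasure d := by
    rw [L2.inner_def]
    refine integral_congr_ae ?_
    filter_upwards [(memLp_sqrt_decayWeight (d := d)).coeFn_toLp, h2.coeFn_toLp] with p hp1 hp2
    rw [hp2, hw, hp1, real_inner_eq_re_inner]
    have := Real.sqrt_pos.2 (decayWeight_pos p)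
    simp only [RCLike.inner_apply, conj_trivial, RCLike.re_to_real, norm_div, Real.norm_eq_abs,
      abs_of_pos this]
    field_simp
  have hφi : Integrable φ (phaseMeasure d) :=
    φ.continuous.integrable_of_hasCompactSupport φ.hasCompactSupport
  calc |fluctuationFunctional hp hf ε (compactlySupportedTest d R φ)|
      ≤ ∫ p, |fluctuation δ R τ f ε p * φ p| ∂phaseMeasure d := abs_integral_le_integral_abs
    _ ≤ ∫ p, δ⁻¹ / η * |φ p| ∂phaseMeasure d := by
        refine integral_mono_ae
          (integrable_fluctuation_mul_testSpace hp hf ε.2 (compactlySupportedTest d R φ)).abs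
          (hφi.abs.const_mul _) ?_
        filter_upwards [abs_fluctuation_le hp hf ε.2] with p h
        rw [abs_mul]
        gcongr
        refine h.trans ?_
        gcongr
    _ = δ⁻¹ / η * inner ℝ w (h2.toLp _) := by rw [integral_const_mul, hinner]
    _ ≤ δ⁻¹ / η * (‖w‖ * ‖h2.toLp _‖) := by
        gcongr
        exact real_inner_le_norm _ _
    _ = _ := by rw [hnorm, mul_assoc]

/-- Along parameters that stay away from `0`, the fluctuations are uniformly bounded, and their
limits are absolutely continuous. -/
lemma exists_tendsto_of_le (hp : AdmissibleParameters d δ R τ Cin)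
    (hf : UniformEntropyBound δ R τ τ Cin f) {η : ℝ} (hη : 0 < η)
    (u : Ultrafilter {ε : ℝ // 0 < ε}) (hu : ∀ᶠ ε : {ε : ℝ // 0 < ε} in u, η ≤ ε) :
    ∃ μ, Tendsto (fluctuationMeasure hp hf) u (𝓝 μ) := by
  obtain ⟨C, hC⟩ := exists_abs_functional_le_weightedEmbedding hp hf hη
  obtain ⟨F, hF⟩ := exists_tendsto_inner (weightedEmbedding d)
    (fun ε => (fluctuationFunctional hp hf ε).comp (compactlySupportedTest d R)) (C := C) u
    fun φ η' hη' => by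
      filter_upwards [hu] with ε hε
      exact (hC ε hε φ).trans (by linarith)
  have hloc : LocallyIntegrable (fun p => F p / √(decayWeight p)) (phaseMeasure d) := by
    rw [locallyIntegrable_iff]
    intro K hK
    have hFK : IntegrableOn F K (phaseMeasure d) := by
      have : IsFiniteMeasure ((phaseMeasure d).restrict K) := ⟨by simpa using hK.measure_lt_top⟩
      exact ((Lp.memLp F).restrict K).integrable one_le_two
    simp_rw [div_eq_mul_inv]
    refine hFK.mul_continuousOn (Continuous.continuousOn ?_) hK
    exact continuous_decayWeight.sqrt.inv₀ fun p => (Real.sqrt_pos.2 (decayWeight_pos p)).ne'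
  refine ⟨LocRadonMeasure.ofDensity _ _ hloc, LocRadonMeasure.tendsto_iff.2 fun φ => ?_⟩
  have hi : Integrable (fun p => F p / √(decayWeight p) * φ p) (phaseMeasure d) := by
    refine ((Lp.memLp F).integrable_mul (memLp_div_sqrt_decayWeight φ)).congr
      (ae_of_all _ fun p => ?_)
    simp only [Pi.mul_apply]
    ring
  have hpair : (LocRadonMeasure.ofDensity _ _ hloc).pairing φ =
      ∫ p, F p / √(decayWeight p) * φ p ∂phaseMeasure d :=
    LocRadonMeasure.pairing_ofDensity hloc φ.continuous.aestronglyMeasurable hi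
  rw [hpair]
  have hin : inner ℝ F (weightedEmbedding d φ) =
      ∫ p, F p / √(decayWeight p) * φ p ∂phaseMeasure d := by
    rw [L2.inner_def]
    refine integral_congr_ae ?_
    filter_upwards [(memLp_div_sqrt_decayWeight φ).coeFn_toLp] with p hp1
    have : (weightedEmbedding d φ) p = _ := hp1
    rw [this, real_inner_eq_re_inner]
    simp
    ring
  rw [← hin]
  simp_rw [pairing_fluctuationMeasure]
  exact hF φ

lemma exists_tendsto_functional (hp : AdmissibleParameters d δ R τ Cin)
    (hf : UniformEntropyBound δ R τ τ Cin f) (u : Ultrafilter {ε : ℝ // 0 < ε})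
    (hu : ↑u ≤ vanishing) : ∃ F : Lp ℝ 2 (rayMeasure d), ∀ Ψ,
      Tendsto (fun ε => fluctuationFunctional hp hf ε Ψ) u
        (𝓝 (inner ℝ F (weightedTrace d R Ψ))) := by
  obtain ⟨C, hC⟩ := exists_eventually_abs_functional_le hp hf
  exact exists_tendsto_inner (weightedTrace d R) (fluctuationFunctional hp hf) u
    fun Ψ η hη => hu (hC Ψ η hη)

lemma tendsto_fluctuationMeasure_of_functional (hp : AdmissibleParameters d δ R τ Cin)
    (hf : UniformEntropyBound δ R τ τ Cin f) {ι : Type*} {l : Filter ι} {e : ι → {ε : ℝ // 0 < ε}}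
    {F : Lp ℝ 2 (rayMeasure d)} (hF : ∀ Ψ, Tendsto (fun i => fluctuationFunctional hp hf (e i) Ψ) l
      (𝓝 (inner ℝ F (weightedTrace d R Ψ)))) :
    Tendsto (fun i => fluctuationMeasure hp hf (e i)) l (𝓝 (limitMeasure hp.radius_pos F)) := by
  refine LocRadonMeasure.tendsto_iff.2 fun φ => ?_
  rw [pairing_limitMeasure]
  simp_rw [pairing_fluctuationMeasure]
  exact hF _

lemma le_vanishing_iff {l : Filter {ε : ℝ // 0 < ε}} :
    l ≤ vanishing ↔ ∀ η > 0, ∀ᶠ ε : {ε : ℝ // 0 < ε} in l, (ε : ℝ) < η := by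
  rw [vanishing, ← tendsto_iff_comap]
  constructor
  · intro h η hη
    exact h.eventually (gt_mem_nhds hη)
  · intro h
    rw [Metric.tendsto_nhds]
    intro η hη
    filter_upwards [h η hη] with ε hε
    rwa [Real.dist_eq, sub_zero, abs_of_pos ε.2]

/-- Weak-star relative compactness of the fluctuations. -/
lemma isCompact_closure_fluctuationMeasure (hp : AdmissibleParameters d δ R τ Cin)
    (hf : UniformEntropyBound δ R τ τ Cin f) {ε₀ : ℝ} (hε₀ : 0 < ε₀) :
    IsCompact (closure (fluctuationMeasure hp hf '' {ε | (ε : ℝ) ≤ ε₀})) := by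
  refine isCompact_closure_image_of_isInducing LocRadonMeasure.isInducing_pairing (fun φ => ?_)
    fun u hu => ?_
  · obtain ⟨B, hB⟩ := exists_boundedByBox_of_hasCompactSupport φ.continuous φ.hasCompactSupport
    obtain ⟨C, hC⟩ := exists_integral_norm_le hp hf hε₀ φ.continuous.measurable hB
    refine ⟨C, fun ε hε => ?_⟩
    rw [pairing_fluctuationMeasure]
    exact (hC ε ⟨ε.2, hε⟩).2
  · have hex : ∃ μ, Tendsto (fluctuationMeasure hp hf) u (𝓝 μ) := by
      by_cases h : ↑u ≤ vanishing
      · obtain ⟨F, hF⟩ := exists_tendsto_functional hp hf u h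
        exact ⟨_, tendsto_fluctuationMeasure_of_functional hp hf (e := id) hF⟩
      · rw [le_vanishing_iff] at h
        push Not at h
        obtain ⟨η, hη, hne⟩ := h
        exact exists_tendsto_of_le hp hf hη u hne
    obtain ⟨μ, hμ⟩ := hex
    exact ⟨μ, LocRadonMeasure.tendsto_iff.1 hμ⟩

instance : SecondCountableTopology (Lp ℝ 2 (rayMeasure d)) :=
  have : Fact ((2 : ℝ≥0∞) ≠ ∞) := ⟨by simp⟩
  Lp.SecondCountableTopology

/-- A limit of the functionals along an ultrafilter is a limit along a sequence. -/
lemma exists_seq_tendsto_functional (hp : AdmissibleParameters d δ R τ Cin)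
    (hf : UniformEntropyBound δ R τ τ Cin f) {ι : Type*} [Nonempty ι] {l : Filter ι}
    [l.IsCountablyGenerated] {e : ι → {ε : ℝ // 0 < ε}} (he : Tendsto e l vanishing)
    (u : Ultrafilter ι) (hul : ↑u ≤ l) {F : Lp ℝ 2 (rayMeasure d)}
    (hF : ∀ Ψ, Tendsto (fun i => fluctuationFunctional hp hf (e i) Ψ) u
      (𝓝 (inner ℝ F (weightedTrace d R Ψ)))) :
    ∃ i : ℕ → ι, Tendsto i atTop l ∧ ∀ Ψ, Tendsto
      (fun n => fluctuationFunctional hp hf (e (i n)) Ψ) atTop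
        (𝓝 (inner ℝ F (weightedTrace d R Ψ))) := by
  obtain ⟨C, hC⟩ := exists_eventually_abs_functional_le hp hf
  exact exists_seq_tendsto_inner (weightedTrace d R) (fun i => fluctuationFunctional hp hf (e i))
    u hul (fun Ψ η hη => he.eventually (hC Ψ η hη)) hF

lemma exists_subseq_tendsto_fluctuationMeasure (hp : AdmissibleParameters d δ R τ Cin)
    (hf : UniformEntropyBound δ R τ τ Cin f) {e : ℕ → {ε : ℝ // 0 < ε}}
    (he : Tendsto e atTop vanishing) : ∃ (θ : ℕ → ℕ) (μ : _), StrictMono θ ∧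
      Tendsto (fun n => fluctuationMeasure hp hf (e (θ n))) atTop (𝓝 μ) := by
  have hu : ((Ultrafilter.of atTop : Ultrafilter ℕ) : Filter ℕ) ≤ atTop := Ultrafilter.of_le _
  obtain ⟨F, hF⟩ := exists_tendsto_functional hp hf ((Ultrafilter.of atTop).map e)
    ((Filter.map_mono hu).trans he)
  obtain ⟨i, hi, hiF⟩ := exists_seq_tendsto_functional hp hf he (Ultrafilter.of atTop) hu hF
  obtain ⟨k, hk, hik⟩ := strictMono_subseq_of_tendsto_atTop hi
  refine ⟨i ∘ k, limitMeasure hp.radius_pos F, hik, ?_⟩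
  exact (tendsto_fluctuationMeasure_of_functional hp hf (e := fun n => e (i n)) hiF).comp
    hk.tendsto_atTop

end WeakStar

/-! ### Radial averages -/

section RadialAverages

variable {d : ℕ} {δ R τ Cin : ℝ} {f : ℝ → ℝ≥0 × Sp d × Sp d → ℝ}

lemma rayAverage_eq_integral_radialMeasure (g φ : ℝ≥0 × Sp d × Sp d → ℝ)
    (q : ℝ≥0 × Sp d × Metric.sphere (0 : Sp d) 1) :
    rayAverage g φ q = ∫ r, g (polarPoint q r) * φ (polarPoint q r) ∂radialMeasure d :=
  (integral_radialMeasure _).symm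

lemma ae_radialMeasure_pos (d : ℕ) : ∀ᵐ r ∂radialMeasure d, 0 < r :=
  (withDensity_absolutelyContinuous _ _).ae_le (ae_restrict_mem measurableSet_Ioi)

lemma polarPoint_mem_phaseBox_iff {B r : ℝ} {q : ℝ≥0 × Sp d × Metric.sphere (0 : Sp d) 1} :
    polarPoint q r ∈ phaseBox d B ↔ q ∈ rayBox d B :=
  ⟨fun h => ⟨h.1, h.2.1, trivial⟩, fun h => ⟨h.1, h.2.1, trivial⟩⟩

lemma indicator_phaseBox_polarPoint {B r : ℝ} {q : ℝ≥0 × Sp d × Metric.sphere (0 : Sp d) 1}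
    (hq : q ∈ rayBox d B) (H : ℝ≥0 × Sp d × Sp d → ℝ) :
    (phaseBox d B).indicator H (polarPoint q r) = H (polarPoint q r) :=
  indicator_of_mem (polarPoint_mem_phaseBox_iff.2 hq) H

lemma boundedByBox_indicator {φ : ℝ≥0 × Sp d × Sp d → ℝ} {C : ℝ}
    (hC : ∀ p, |φ p| ≤ C * (1 + ‖p.2.2‖ ^ 2)) (B : ℝ) :
    BoundedByBox (|C| + |B|) ((phaseBox d B).indicator φ) := by
  have h1 := le_abs_self C
  have h2 := abs_nonneg B
  have h3 := le_abs_self B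
  have h4 := abs_nonneg C
  intro p
  by_cases hp : p ∈ phaseBox d B
  · rw [indicator_of_mem hp]
    refine ⟨(hC p).trans (by gcongr; linarith), fun _ => ?_⟩
    have hx : ‖p.2.1‖ ≤ B := by simpa using hp.2.1
    have ht : (p.1 : ℝ) ≤ B := hp.1
    exact ⟨by linarith, by linarith⟩
  · rw [indicator_of_notMem hp]
    refine ⟨?_, fun h => absurd rfl h⟩
    rw [abs_zero]
    positivity

lemma integrable_indicator_polarPoint (hp : AdmissibleParameters d δ R τ Cin)
    (hf : UniformEntropyBound δ R τ τ Cin f) {ε : ℝ} (hε : 0 < ε) {φ : ℝ≥0 × Sp d × Sp d → ℝ}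
    (hφ : Continuous φ) {C : ℝ} (hC : ∀ p, |φ p| ≤ C * (1 + ‖p.2.2‖ ^ 2)) (B : ℝ) :
    Integrable (fun z : (ℝ≥0 × Sp d × Metric.sphere (0 : Sp d) 1) × ℝ =>
      (phaseBox d B).indicator (fun p => fluctuation δ R τ f ε p * φ p) (polarPoint z.1 z.2))
        ((rayMeasure d).prod (radialMeasure d)) := by
  have h := integrable_fluctuation_mul hp hf hε
    (hφ.measurable.indicator (measurableSet_phaseBox d B)) (boundedByBox_indicator hC B)
  have h' : Integrable ((phaseBox d B).indicator fun p => fluctuation δ R τ f ε p * φ p)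
      (phaseMeasure d) :=
    h.congr (ae_of_all _ fun p => (indicator_mul_right _ (fluctuation δ R τ f ε) φ).symm)
  exact ((measurePreserving_polarPoint hp.two_le).integrable_comp h'.aestronglyMeasurable).2 h'

lemma ae_integrableOn_rayIntegrand (hp : AdmissibleParameters d δ R τ Cin)
    (hf : UniformEntropyBound δ R τ τ Cin f) {ε : ℝ} (hε : 0 < ε) {φ : ℝ≥0 × Sp d × Sp d → ℝ}
    (hφ : Continuous φ) {C : ℝ} (hC : ∀ p, |φ p| ≤ C * (1 + ‖p.2.2‖ ^ 2)) :
    ∀ᵐ q ∂rayMeasure d, IntegrableOn (rayIntegrand (fluctuation δ R τ f ε) φ q) (Ioi 0) := by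
  filter_upwards [ae_all_iff.2 fun N : ℕ =>
    (integrable_indicator_polarPoint hp hf hε hφ hC N).prod_right_ae] with q hq
  obtain ⟨N, hN⟩ := exists_nat_ge (max (q.1 : ℝ) ‖q.2.1‖)
  have hqN : q ∈ rayBox d N :=
    ⟨(le_max_left _ _).trans hN, by simpa using (le_max_right _ _).trans hN, trivial⟩
  have h := hq N
  simp only [indicator_phaseBox_polarPoint hqN] at h
  exact integrable_radialMeasure_iff.1 h

lemma aestronglyMeasurable_rayAverage (hp : AdmissibleParameters d δ R τ Cin)
    (hf : UniformEntropyBound δ R τ τ Cin f) {ε : ℝ} (hε : 0 < ε) {φ : ℝ≥0 × Sp d × Sp d → ℝ}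
    (hφ : Continuous φ) :
    AEStronglyMeasurable (rayAverage (fluctuation δ R τ f ε) φ) (rayMeasure d) := by
  have h : AEStronglyMeasurable (fun p => fluctuation δ R τ f ε p * φ p) (phaseMeasure d) :=
    (aestronglyMeasurable_fluctuation hf hε).mul hφ.aestronglyMeasurable
  refine (h.comp_measurePreserving
    (measurePreserving_polarPoint hp.two_le)).integral_prod_right'.congr (ae_of_all _ fun q => ?_)
  exact (rayAverage_eq_integral_radialMeasure _ _ q).symm

lemma integrableOn_rayAverage (hp : AdmissibleParameters d δ R τ Cin)
    (hf : UniformEntropyBound δ R τ τ Cin f) {ε : ℝ} (hε : 0 < ε) {φ : ℝ≥0 × Sp d × Sp d → ℝ}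
    (hφ : Continuous φ) {C : ℝ} (hC : ∀ p, |φ p| ≤ C * (1 + ‖p.2.2‖ ^ 2)) (B : ℝ) :
    IntegrableOn (rayAverage (fluctuation δ R τ f ε) φ) (rayBox d B) (rayMeasure d) := by
  refine (integrable_indicator_polarPoint hp hf hε hφ hC B).integral_prod_left.integrableOn.congr
    (f := fun q => ∫ r, (phaseBox d B).indicator (fun p => fluctuation δ R τ f ε p * φ p)
      (polarPoint q r) ∂radialMeasure d) ?_
  filter_upwards [ae_restrict_mem (measurableSet_rayBox d B)] with q hq
  simp only [indicator_phaseBox_polarPoint hq]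
  exact (rayAverage_eq_integral_radialMeasure _ _ q).symm

lemma exists_rayBox_mem_nhds (q : ℝ≥0 × Sp d × Metric.sphere (0 : Sp d) 1) :
    ∃ B, rayBox d B ∈ 𝓝 q := by
  obtain ⟨B, hB⟩ := exists_phaseBox_mem_nhds (polarPoint q 1)
  refine ⟨B, ?_⟩
  have hc : Continuous fun q : ℝ≥0 × Sp d × Metric.sphere (0 : Sp d) 1 => polarPoint q 1 :=
    continuous_polarPoint.comp (by fun_prop : Continuous fun q => (q, (1 : ℝ)))
  filter_upwards [hc.continuousAt.preimage_mem_nhds hB] with q' hq'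
  exact polarPoint_mem_phaseBox_iff.1 hq'

lemma locallyIntegrable_of_forall_rayBox
    {G : ℝ≥0 × Sp d × Metric.sphere (0 : Sp d) 1 → ℝ}
    (h : ∀ B, IntegrableOn G (rayBox d B) (rayMeasure d)) : LocallyIntegrable G (rayMeasure d) :=
  fun q =>
    have ⟨B, hB⟩ := exists_rayBox_mem_nhds q
    ⟨rayBox d B, hB, h B⟩

lemma exists_rayBox_of_hasCompactSupport {ψ : ℝ≥0 × Sp d × Metric.sphere (0 : Sp d) 1 → ℝ}
    (h : HasCompactSupport ψ) : ∃ B, ∀ q, q ∉ rayBox d B → ψ q = 0 := by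
  obtain ⟨B, hB⟩ := IsCompact.exists_bound_of_continuousOn (s := tsupport ψ) h
    (f := fun q => ((q.1 : ℝ), q.2.1)) (by fun_prop)
  refine ⟨B, fun q hq => ?_⟩
  by_contra h0
  have h1 := hB q (subset_tsupport _ h0)
  rw [Prod.norm_def, max_le_iff] at h1
  exact hq ⟨(le_abs_self _).trans h1.1, by simpa using h1.2, trivial⟩

/-- The test function on phase space whose pairing with the fluctuation is the pairing of its
radial average, weighted by `φ`, with `ψ`. -/
lemma rayLift_testFunction_mul_mem_testSpace (hR : 0 < R)
    (ψ : LocL1.TestFunction (ℝ≥0 × Sp d × Metric.sphere (0 : Sp d) 1))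
    {φ : ℝ≥0 × Sp d × Sp d → ℝ} (hφ : Continuous φ) {C : ℝ}
    (hC : ∀ p, |φ p| ≤ C * (1 + ‖p.2.2‖ ^ 2)) :
    (fun p => rayLift ψ.1 p * φ p) ∈ testSpace d R := by
  obtain ⟨hm, ⟨M, hM⟩, hc⟩ := ψ.2
  obtain ⟨B, hB⟩ := exists_rayBox_of_hasCompactSupport hc
  exact rayLift_mul_mem_testSpace hR hm hM hB hφ hC

lemma integral_rayAverage_mul (hp : AdmissibleParameters d δ R τ Cin)
    (hf : UniformEntropyBound δ R τ τ Cin f) (ε : {ε : ℝ // 0 < ε})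
    {φ ψ} (hΨ : (fun p => rayLift ψ p * φ p) ∈ testSpace d R) :
    ∫ q, rayAverage (fluctuation δ R τ f ε) φ q * ψ q ∂rayMeasure d =
      fluctuationFunctional hp hf ε ⟨_, hΨ⟩ := by
  have hmp := measurePreserving_polarPoint hp.two_le
  have hi := integrable_fluctuation_mul_testSpace hp hf ε.2 ⟨_, hΨ⟩
  symm
  calc ∫ p, fluctuation δ R τ f ε p * (rayLift ψ p * φ p) ∂phaseMeasure d
      = ∫ z, fluctuation δ R τ f ε (polarPoint z.1 z.2) *
          (rayLift ψ (polarPoint z.1 z.2) * φ (polarPoint z.1 z.2))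
            ∂(rayMeasure d).prod (radialMeasure d) := by
        rw [← hmp.map_eq, integral_map hmp.measurable.aemeasurable]
        rw [hmp.map_eq]
        exact hi.aestronglyMeasurable
    _ = ∫ q, ∫ r, fluctuation δ R τ f ε (polarPoint q r) *
          (rayLift ψ (polarPoint q r) * φ (polarPoint q r)) ∂radialMeasure d ∂rayMeasure d :=
        integral_prod _ ((hmp.integrable_comp hi.aestronglyMeasurable).2 hi)
    _ = _ := by
        refine integral_congr_ae (ae_of_all _ fun q => ?_)
        simp only
        rw [rayAverage_eq_integral_radialMeasure, ← integral_mul_const]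
        refine integral_congr_ae ?_
        filter_upwards [ae_radialMeasure_pos d] with r hr
        rw [rayLift_polarPoint _ _ hr]
        ring

lemma locallyIntegrable_rayDensity_mul (F : Lp ℝ 2 (rayMeasure d)) {φ : ℝ≥0 × Sp d × Sp d → ℝ}
    (hφ : Continuous φ) {C : ℝ} (hC : ∀ p, |φ p| ≤ C * (1 + ‖p.2.2‖ ^ 2)) :
    LocallyIntegrable (fun q => rayDensity F q * φ (polarPoint q R)) (rayMeasure d) := by
  refine locallyIntegrable_of_forall_rayBox fun B => ?_
  rw [← integrable_indicator_iff (measurableSet_rayBox d B)]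
  have := integrable_rayDensity_mul F (h := (rayBox d B).indicator fun q => φ (polarPoint q R))
    (B := B) (M := C * (1 + R ^ 2))
    ((measurable_trace hφ.measurable R).indicator (measurableSet_rayBox d B))
    (fun q hq => by
      rw [indicator_of_mem hq]
      simpa [polarPoint, norm_smul] using hC (polarPoint q R))
    (fun q hq => indicator_of_notMem hq _)
  exact this.congr (ae_of_all _ fun q => (indicator_mul_right _ (rayDensity F) _).symm)

/-- Weak relative compactness of the radial averages in `L¹_loc`. -/
lemma isCompact_closure_rayAverage (hp : AdmissibleParameters d δ R τ Cin)
    (hf : UniformEntropyBound δ R τ τ Cin f) {φ : ℝ≥0 × Sp d × Sp d → ℝ} (hφ : Continuous φ)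
    {C : ℝ} (hC : ∀ p, |φ p| ≤ C * (1 + ‖p.2.2‖ ^ 2)) {e : ℕ → {ε : ℝ // 0 < ε}}
    (he : Tendsto e atTop vanishing)
    (hm : ∀ n, AEStronglyMeasurable (rayAverage (fluctuation δ R τ f (e n)) φ) (rayMeasure d))
    (hG : ∀ n, LocallyIntegrable (rayAverage (fluctuation δ R τ f (e n)) φ) (rayMeasure d)) :
    IsCompact (closure (range fun n => LocL1.mk
      (rayAverage (fluctuation δ R τ f (e n)) φ) (hm n) (hG n))) := by
  have hR := hp.radius_pos
  have hmk : ∀ (G : ℝ≥0 × Sp d × Metric.sphere (0 : Sp d) 1 → ℝ)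
      (hm : AEStronglyMeasurable G (rayMeasure d)) (hG : LocallyIntegrable G (rayMeasure d))
      (ψ : LocL1.TestFunction (ℝ≥0 × Sp d × Metric.sphere (0 : Sp d) 1)),
      ∫ q, (LocL1.mk G hm hG).1 q * ψ.1 q ∂rayMeasure d = ∫ q, G q * ψ.1 q ∂rayMeasure d := by
    intro G hm hG ψ
    refine integral_congr_ae ?_
    filter_upwards [AEEqFun.coeFn_mk G hm] with q hq
    rw [LocL1.mk, hq]
  have hind : IsInducing fun (F : LocL1 (rayMeasure d))
      (ψ : LocL1.TestFunction (ℝ≥0 × Sp d × Metric.sphere (0 : Sp d) 1)) =>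
        ∫ q, F.1 q * ψ.1 q ∂rayMeasure d := ⟨rfl⟩
  rw [← image_univ]
  refine isCompact_closure_image_of_isInducing hind (fun ψ => ?_) fun u _ => ?_
  · obtain ⟨m, -, B, hB⟩ := rayLift_testFunction_mul_mem_testSpace hR ψ hφ hC
    obtain ⟨ε₀, hε₀⟩ :=
      ((tendsto_val_vanishing.mono_right nhdsWithin_le_nhds).comp he).bddAbove_range
    have hpos : 0 < ε₀ := (e 0).2.trans_le (hε₀ ⟨0, rfl⟩)
    obtain ⟨D, hD⟩ := exists_integral_norm_le hp hf hpos m hB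
    refine ⟨D, fun n _ => ?_⟩
    simp only [hmk]
    rw [integral_rayAverage_mul hp hf (e n) (rayLift_testFunction_mul_mem_testSpace hR ψ hφ hC)]
    exact (hD (e n) ⟨(e n).2, hε₀ ⟨n, rfl⟩⟩).2
  · simp only [hmk]
    rcases u.le_cofinite_or_eq_pure with h | ⟨m, rfl⟩
    · rw [Nat.cofinite_eq_atTop] at h
      obtain ⟨F, hF⟩ := exists_tendsto_functional hp hf (u.map e) ((Filter.map_mono h).trans he)
      refine ⟨LocL1.mk (fun q => rayDensity F q * φ (polarPoint q R)) ?_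
        (locallyIntegrable_rayDensity_mul F hφ hC), fun ψ => ?_⟩
      · exact ((measurable_rayDensity F).mul
          (measurable_trace hφ.measurable R)).aestronglyMeasurable
      · have hΨ := rayLift_testFunction_mul_mem_testSpace hR ψ hφ hC
        rw [hmk]
        simp_rw [fun n => integral_rayAverage_mul hp hf (e n) hΨ]
        have heq : ∫ q, rayDensity F q * φ (polarPoint q R) * ψ.1 q ∂rayMeasure d =
            inner ℝ F (weightedTrace d R ⟨_, hΨ⟩) := by
          rw [inner_weightedTrace]
          refine integral_congr_ae (ae_of_all _ fun q => ?_)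
          simp only
          rw [rayLift_polarPoint _ _ hR]
          ring
        rw [heq]
        exact hF ⟨_, hΨ⟩
    · refine ⟨LocL1.mk _ (hm m) (hG m), fun ψ => ?_⟩
      rw [hmk]
      exact tendsto_pure_nhds _ m

end RadialAverages

/-! ### Limit points -/

section LimitPoints

variable {d : ℕ} {δ R τ Cin : ℝ} {f : ℝ → ℝ≥0 × Sp d × Sp d → ℝ}

/-- The sharp bound for the density of a limit point. -/
lemma ae_memLp_fermiDensity (hp : AdmissibleParameters d δ R τ Cin)
    (hf : UniformEntropyBound δ R τ τ Cin f) {l : Filter {ε : ℝ // 0 < ε}} [l.NeBot]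
    (hl : l ≤ vanishing) {F : Lp ℝ 2 (rayMeasure d)}
    (hF : ∀ Ψ, Tendsto (fun ε => fluctuationFunctional hp hf ε Ψ) l
      (𝓝 (inner ℝ F (weightedTrace d R Ψ)))) :
    ∀ᵐ t ∂timeMeasure,
      MemLp (fun p => fermiDensity R F (t, p)) 2 (volume.prod (surfaceMeasure d R)) ∧
      ∫ p, fermiDensity R F (t, p) ^ 2 ∂(volume.prod (surfaceMeasure d R)) ≤
        Cin / (R * δ ^ 2) := by
  have hR := hp.radius_pos
  have hδ := hp.delta_pos
  have hCin := hp.cin_pos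
  filter_upwards [ae_lintegral_rayDensity_sq_le hp hf hl hF] with t ht
  have hm : Measurable fun p => fermiDensity R F (t, p) :=
    (measurable_fermiDensity R F).comp (by fun_prop)
  have hpow : R ^ (d - 1) = R ^ (d - 2) * R := by
    rw [← pow_succ]
    congr 1
    have := hp.two_le
    omega
  have hle : ∫⁻ p, ENNReal.ofReal (fermiDensity R F (t, p) ^ 2)
      ∂(volume.prod (surfaceMeasure d R)) ≤ ENNReal.ofReal (Cin / (R * δ ^ 2)) := by
    rw [prod_surfaceMeasure_eq_map, lintegral_smul_measure,
      lintegral_map (by fun_prop) (by fun_prop)]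
    have h1 : ∀ z : Sp d × Metric.sphere (0 : Sp d) 1,
        ENNReal.ofReal (fermiDensity R F (t, z.1, R • (z.2 : Sp d)) ^ 2) =
          ENNReal.ofReal ((R ^ (d - 1))⁻¹ ^ 2) * ENNReal.ofReal (rayDensity F (t, z) ^ 2) := by
      intro z
      rw [← ENNReal.ofReal_mul (by positivity), ← mul_pow,
        ← fermiDensity_polarPoint hR F (t, z)]
      rfl
    simp_rw [h1]
    rw [lintegral_const_mul' _ _ ENNReal.ofReal_ne_top, smul_eq_mul, ← mul_assoc,
      ← ENNReal.ofReal_mul (by positivity)]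
    refine (mul_le_mul_right ht _).trans ?_
    rw [← ENNReal.ofReal_mul (by positivity)]
    refine ENNReal.ofReal_le_ofReal (le_of_eq ?_)
    rw [hpow]
    have : 0 < R ^ (d - 2) := by positivity
    field_simp
  have hnonneg : ∀ p, 0 ≤ fermiDensity R F (t, p) ^ 2 := fun p => sq_nonneg _
  refine ⟨?_, ?_⟩
  · rw [memLp_two_iff_integrable_sq hm.aestronglyMeasurable]
    refine ⟨(hm.pow_const 2).aestronglyMeasurable, ?_⟩
    rw [hasFiniteIntegral_iff_ofReal (ae_of_all _ hnonneg)]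
    exact hle.trans_lt ENNReal.ofReal_lt_top
  · rw [integral_eq_lintegral_of_nonneg_ae (ae_of_all _ hnonneg)
      (hm.pow_const 2).aestronglyMeasurable]
    exact ENNReal.toReal_le_of_le_ofReal (by positivity) hle

/-- Weak-star convergence extends to test functions of quadratic growth: away from the Fermi sphere
a test function has zero trace, so that the fluctuations do not see it in the limit. -/
lemma tendsto_functional_of_tendsto_fluctuationMeasure (hp : AdmissibleParameters d δ R τ Cin)
    (hf : UniformEntropyBound δ R τ τ Cin f) {ι : Type*} {l : Filter ι} {e : ι → {ε : ℝ // 0 < ε}}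
    (he : Tendsto e l vanishing) {F : Lp ℝ 2 (rayMeasure d)}
    (hF : Tendsto (fun i => fluctuationMeasure hp hf (e i)) l (𝓝 (limitMeasure hp.radius_pos F)))
    (Φ : testSpace d R) (hΦ : Continuous (Φ : ℝ≥0 × Sp d × Sp d → ℝ))
    (hK : CompactInTimeSpace (Φ : ℝ≥0 × Sp d × Sp d → ℝ)) :
    Tendsto (fun i => fluctuationFunctional hp hf (e i) Φ) l
      (𝓝 (inner ℝ F (weightedTrace d R Φ))) := by
  have hR := hp.radius_pos
  obtain ⟨K, hK, h0⟩ := hK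
  -- a continuous cutoff, equal to `1` near the Fermi sphere
  let χ : ℝ≥0 × Sp d × Sp d → ℝ := fun p => max 0 (min 1 (R + 2 - ‖p.2.2‖))
  have hχ : Continuous χ := by fun_prop
  let Kv : Set (ℝ≥0 × Sp d × Sp d) :=
    (fun z : (ℝ≥0 × Sp d) × Sp d => (z.1.1, z.1.2, z.2)) '' (K ×ˢ Metric.closedBall 0 (R + 2))
  have hKv : IsCompact Kv := (hK.prod (isCompact_closedBall _ _)).image (by fun_prop)
  have hsupp : HasCompactSupport fun p => (Φ : ℝ≥0 × Sp d × Sp d → ℝ) p * χ p := by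
    refine HasCompactSupport.intro hKv fun p hpK => ?_
    by_cases hv : p.2.2 ∈ Metric.closedBall (0 : Sp d) (R + 2)
    · rw [h0 p.1 p.2.1 p.2.2 fun h => hpK ⟨((p.1, p.2.1), p.2.2), ⟨h, hv⟩, rfl⟩, zero_mul]
    · have hv' : R + 2 < ‖p.2.2‖ := by simpa using hv
      have : χ p = 0 := max_eq_left ((min_le_right _ _).trans (by linarith))
      rw [this, mul_zero]
  let φ : C_c(ℝ≥0 × Sp d × Sp d, ℝ) := ⟨⟨_, hΦ.mul hχ⟩, hsupp⟩
  set Φ₁ := compactlySupportedTest d R φ with hΦ₁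
  have htrace : weightedTrace d R (Φ - Φ₁) = 0 := by
    rw [← norm_eq_zero, ← sq_eq_zero_iff, norm_weightedTrace_sq]
    refine integral_eq_zero_of_ae (ae_of_all _ fun q => ?_)
    have hone : χ (polarPoint q R) = 1 := by
      have : ‖(polarPoint q R).2.2‖ = R := by simp [polarPoint, norm_smul, abs_of_pos hR]
      simp only [χ, this]
      norm_num
    have hval : ((Φ - Φ₁ : testSpace d R) : ℝ≥0 × Sp d × Sp d → ℝ) (polarPoint q R) =
        (Φ : ℝ≥0 × Sp d × Sp d → ℝ) (polarPoint q R) -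
          (Φ : ℝ≥0 × Sp d × Sp d → ℝ) (polarPoint q R) * χ (polarPoint q R) := rfl
    simp only [hval, hone]
    simp
  have h1 : Tendsto (fun i => fluctuationFunctional hp hf (e i) Φ₁) l
      (𝓝 (inner ℝ F (weightedTrace d R Φ))) := by
    have h := LocRadonMeasure.tendsto_iff.1 hF φ
    rw [pairing_limitMeasure] at h
    simp_rw [pairing_fluctuationMeasure] at h
    rw [map_sub, sub_eq_zero] at htrace
    rwa [htrace]
  have h2 : Tendsto (fun i => fluctuationFunctional hp hf (e i) (Φ - Φ₁)) l (𝓝 0) := by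
    obtain ⟨C, hC⟩ := exists_eventually_abs_functional_le hp hf
    rw [Metric.tendsto_nhds]
    intro η hη
    filter_upwards [he.eventually (hC (Φ - Φ₁) (η / 2) (half_pos hη))] with i hi
    rw [htrace, norm_zero, mul_zero, zero_add] at hi
    rw [Real.dist_eq, sub_zero]
    linarith
  have h3 := h2.add h1
  simpa only [map_sub, sub_add_cancel, zero_add] using h3

/-- A limit point of the fluctuations as `ε → 0` is a measure with square integrable density on the
Fermi sphere. -/
lemma exists_ultrafilter_of_forall_mem_closure (hp : AdmissibleParameters d δ R τ Cin)
    (hf : UniformEntropyBound δ R τ τ Cin f) {μ : LocRadonMeasure (ℝ≥0 × Sp d × Sp d)}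
    (hμ : ∀ ε₀ : ℝ, 0 < ε₀ → μ ∈ closure (fluctuationMeasure hp hf '' {ε | (ε : ℝ) ≤ ε₀})) :
    ∃ (u : Ultrafilter {ε : ℝ // 0 < ε}) (F : Lp ℝ 2 (rayMeasure d)), ↑u ≤ vanishing ∧
      (∀ Ψ, Tendsto (fun ε => fluctuationFunctional hp hf ε Ψ) u
        (𝓝 (inner ℝ F (weightedTrace d R Ψ)))) ∧ μ = limitMeasure hp.radius_pos F := by
  have hcl : MapClusterPt μ vanishing (fluctuationMeasure hp hf) := by
    rw [mapClusterPt_iff_frequently]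
    intro s hs
    rw [Filter.Frequently, vanishing, Filter.eventually_comap]
    intro h
    obtain ⟨η, hη, hball⟩ := Metric.eventually_nhds_iff.1 h
    obtain ⟨_, hνs, ε, hε, rfl⟩ := mem_closure_iff_nhds.1 (hμ (η / 2) (half_pos hη)) s hs
    have hε' : (ε : ℝ) ≤ η / 2 := hε
    refine hball (y := (ε : ℝ)) ?_ ε rfl hνs
    rw [Real.dist_eq, sub_zero, abs_of_pos ε.2]
    linarith
  obtain ⟨u, hu, hlim⟩ := mapClusterPt_iff_ultrafilter.1 hcl
  obtain ⟨F, hF⟩ := exists_tendsto_functional hp hf u hu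
  refine ⟨u, F, hu, hF, LocRadonMeasure.eq_of_pairing_eq fun φ => ?_⟩
  exact tendsto_nhds_unique (LocRadonMeasure.tendsto_iff.1 hlim φ)
    (LocRadonMeasure.tendsto_iff.1
      (tendsto_fluctuationMeasure_of_functional hp hf (e := id) hF) φ)

end LimitPoints

end FermiGas

theorem mainTheorem4 (d : ℕ) (hd : 2 ≤ d) (δ R γ τ Cin : ℝ)
    (hδ : 0 < δ) (hR : 0 < R) (hCin : 0 < Cin)
    (hγ : 0 < γ) (hγτ : γ = τ) (hτ : τ ≤ 1)
    (f : ℝ → ℝ≥0 × FermiGas.Sp d × FermiGas.Sp d → ℝ)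
    (hf : FermiGas.UniformEntropyBound δ R γ τ Cin f) :
    -- uniform bound in `L^∞(dt; L¹_loc(dx; L¹((1+v²)dv)))`
    (∀ ε₀ : ℝ, 0 < ε₀ → ∀ K : Set (FermiGas.Sp d), IsCompact K →
      ∃ C : ℝ≥0, ∀ ε ∈ Ioc 0 ε₀, ∀ᵐ t ∂FermiGas.timeMeasure,
        ∫⁻ p in K ×ˢ univ,
          ENNReal.ofReal (|FermiGas.fluctuation δ R τ f ε (t, p)| * (1 + ‖p.2‖ ^ 2)) ≤ C) ∧
    -- the fluctuations are locally finite Radon measures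
    ∃ hg : ∀ ε, 0 < ε →
        LocallyIntegrable (FermiGas.fluctuation δ R τ f ε) (FermiGas.phaseMeasure d),
      -- weak-star relative compactness, topological and sequential
      (∀ ε₀ : ℝ, 0 < ε₀ → IsCompact (closure
        {ν | ∃ (ε : ℝ) (hε : 0 < ε), ε ≤ ε₀ ∧
          ν = FermiGas.LocRadonMeasure.ofDensity (FermiGas.phaseMeasure d)
            (FermiGas.fluctuation δ R τ f ε) (hg ε hε)})) ∧
      (∀ (ε : ℕ → ℝ) (hε : ∀ n, 0 < ε n), Tendsto ε atTop (𝓝 0) →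
        ∃ (θ : ℕ → ℕ) (μ : FermiGas.LocRadonMeasure (ℝ≥0 × FermiGas.Sp d × FermiGas.Sp d)),
          StrictMono θ ∧
          Tendsto (fun n => FermiGas.LocRadonMeasure.ofDensity (FermiGas.phaseMeasure d)
            (FermiGas.fluctuation δ R τ f (ε (θ n))) (hg _ (hε (θ n)))) atTop (𝓝 μ)) ∧
      -- weak relative compactness of radial averages in `L¹_loc(dt dx dσ)`
      (∀ φ : ℝ≥0 × FermiGas.Sp d × FermiGas.Sp d → ℝ, FermiGas.QuadraticGrowth φ →
        ∀ ε : ℕ → ℝ, (∀ n, 0 < ε n) → Tendsto ε atTop (𝓝 0) →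
        (∀ n, ∀ᵐ q ∂FermiGas.rayMeasure d, IntegrableOn
          (FermiGas.rayIntegrand (FermiGas.fluctuation δ R τ f (ε n)) φ q) (Ioi 0)) ∧
        ∃ (hm : ∀ n, AEStronglyMeasurable
              (FermiGas.rayAverage (FermiGas.fluctuation δ R τ f (ε n)) φ)
              (FermiGas.rayMeasure d))
          (hG : ∀ n, LocallyIntegrable
              (FermiGas.rayAverage (FermiGas.fluctuation δ R τ f (ε n)) φ)
              (FermiGas.rayMeasure d)),
          IsCompact (closure (range fun n => FermiGas.LocL1.mk
            (FermiGas.rayAverage (FermiGas.fluctuation δ R τ f (ε n)) φ) (hm n) (hG n)))) ∧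
      -- characterization of the limit points as `ε → 0`
      (∀ μ : FermiGas.LocRadonMeasure (ℝ≥0 × FermiGas.Sp d × FermiGas.Sp d),
        (∀ ε₀ : ℝ, 0 < ε₀ → μ ∈ closure
          {ν | ∃ (ε : ℝ) (hε : 0 < ε), ε ≤ ε₀ ∧
            ν = FermiGas.LocRadonMeasure.ofDensity (FermiGas.phaseMeasure d)
              (FermiGas.fluctuation δ R τ f ε) (hg ε hε)}) →
        ∃ g : ℝ≥0 × FermiGas.Sp d × FermiGas.Sp d → ℝ,
          AEStronglyMeasurable g (FermiGas.fermiMeasure d R) ∧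
          -- `g ∈ L^∞(dt; L²(dx dω))` with the sharp bound
          (∀ᵐ t ∂FermiGas.timeMeasure,
            MemLp (fun p => g (t, p)) 2 (volume.prod (FermiGas.surfaceMeasure d R)) ∧
            ∫ p, g (t, p) ^ 2 ∂(volume.prod (FermiGas.surfaceMeasure d R))
              ≤ Cin / (R * δ ^ 2)) ∧
          (∃ hloc : LocallyIntegrable (FermiGas.sphericalExtension R g)
              (FermiGas.fermiMeasure d R),
            μ = FermiGas.LocRadonMeasure.ofDensity (FermiGas.fermiMeasure d R)
              (FermiGas.sphericalExtension R g) hloc) ∧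
          -- `μ` is the limit of a sequence of fluctuations
          (∃ (ε : ℕ → ℝ) (hε : ∀ n, 0 < ε n), Tendsto ε atTop (𝓝 0) ∧
            Tendsto (fun n => FermiGas.LocRadonMeasure.ofDensity (FermiGas.phaseMeasure d)
              (FermiGas.fluctuation δ R τ f (ε n)) (hg _ (hε n))) atTop (𝓝 μ)) ∧
          -- and along every such sequence test functions of quadratic growth are admissible
          (∀ (ε : ℕ → ℝ) (hε : ∀ n, 0 < ε n), Tendsto ε atTop (𝓝 0) →
            Tendsto (fun n => FermiGas.LocRadonMeasure.ofDensity (FermiGas.phaseMeasure d)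
              (FermiGas.fluctuation δ R τ f (ε n)) (hg _ (hε n))) atTop (𝓝 μ) →
            ∀ φ : ℝ≥0 × FermiGas.Sp d × FermiGas.Sp d → ℝ,
              FermiGas.QuadraticGrowth φ → FermiGas.CompactInTimeSpace φ →
              (∀ n, Integrable (fun p => FermiGas.fluctuation δ R τ f (ε n) p * φ p)
                (FermiGas.phaseMeasure d)) ∧
              Integrable (fun p => g p * φ p) (FermiGas.fermiMeasure d R) ∧
              Tendsto (fun n => ∫ p, FermiGas.fluctuation δ R τ f (ε n) p * φ p
                ∂FermiGas.phaseMeasure d) atTop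
                (𝓝 (∫ p, g p * φ p ∂FermiGas.fermiMeasure d R)))) := by
  obtain rfl := hγτ
  have hp : FermiGas.AdmissibleParameters d δ R γ Cin := ⟨hd, hδ, hR, hCin, hγ, hτ⟩
  have hset : ∀ ε₀ : ℝ, {ν | ∃ (ε : ℝ) (hε : 0 < ε), ε ≤ ε₀ ∧
      ν = FermiGas.LocRadonMeasure.ofDensity (FermiGas.phaseMeasure d)
        (FermiGas.fluctuation δ R γ f ε) (FermiGas.locallyIntegrable_fluctuation hp hf hε)} =
      FermiGas.fluctuationMeasure hp hf '' {ε | (ε : ℝ) ≤ ε₀} := by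
    intro ε₀
    ext ν
    constructor
    · rintro ⟨ε, hε, hle, rfl⟩
      exact ⟨⟨ε, hε⟩, hle, rfl⟩
    · rintro ⟨ε, hle, rfl⟩
      exact ⟨ε, ε.2, hle, rfl⟩
  have hseq : ∀ (ε : ℕ → ℝ) (hε : ∀ n, 0 < ε n), Tendsto ε atTop (𝓝 0) →
      Tendsto (fun n => (⟨ε n, hε n⟩ : {ε : ℝ // 0 < ε})) atTop FermiGas.vanishing :=
    fun ε hε h => tendsto_comap_iff.2 h
  have hgrowth : ∀ φ : ℝ≥0 × FermiGas.Sp d × FermiGas.Sp d → ℝ, FermiGas.QuadraticGrowth φ →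
      ∃ C : ℝ, ∀ p, |φ p| ≤ C * (1 + ‖p.2.2‖ ^ 2) := fun φ hφ =>
    hφ.2.imp fun C hC p => (div_le_iff₀ (by positivity)).1 (hC p)
  refine ⟨fun ε₀ hε₀ K hK => FermiGas.exists_lintegral_fluctuation_le hp hf hε₀ hK,
    fun ε hε => FermiGas.locallyIntegrable_fluctuation hp hf hε, fun ε₀ hε₀ => ?_,
    fun ε hε h0 => ?_, fun φ hφ ε hε h0 => ?_, fun μ hμ => ?_⟩
  · rw [hset]
    exact FermiGas.isCompact_closure_fluctuationMeasure hp hf hε₀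
  · obtain ⟨θ, μ, hθ, hμ⟩ :=
      FermiGas.exists_subseq_tendsto_fluctuationMeasure hp hf (hseq ε hε h0)
    exact ⟨θ, μ, hθ, hμ⟩
  · obtain ⟨C, hC⟩ := hgrowth φ hφ
    exact ⟨fun n => FermiGas.ae_integrableOn_rayIntegrand hp hf (hε n) hφ.1 hC,
      fun n => FermiGas.aestronglyMeasurable_rayAverage hp hf (hε n) hφ.1,
      fun n => FermiGas.locallyIntegrable_of_forall_rayBox
        (FermiGas.integrableOn_rayAverage hp hf (hε n) hφ.1 hC),
      FermiGas.isCompact_closure_rayAverage hp hf hφ.1 hC (hseq ε hε h0) _ _⟩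
  · simp_rw [hset] at hμ
    obtain ⟨u, F, hu, hF, rfl⟩ := FermiGas.exists_ultrafilter_of_forall_mem_closure hp hf hμ
    have hext := FermiGas.sphericalExtension_fermiDensity hR F
    refine ⟨FermiGas.fermiDensity R F, (FermiGas.measurable_fermiDensity R F).aestronglyMeasurable,
      FermiGas.ae_memLp_fermiDensity hp hf hu hF, ?_, ?_, ?_⟩
    · rw [hext]
      exact ⟨FermiGas.locallyIntegrable_fermiDensity hR F, FermiGas.limitMeasure.eq_1 hR F⟩
    · have : Nonempty {ε : ℝ // 0 < ε} := ⟨⟨1, one_pos⟩⟩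
      obtain ⟨i, hi, hiF⟩ :=
        FermiGas.exists_seq_tendsto_functional hp hf (e := id) tendsto_id u hu hF
      exact ⟨fun n => i n, fun n => (i n).2, tendsto_comap_iff.1 hi,
        FermiGas.tendsto_fluctuationMeasure_of_functional hp hf hiF⟩
    · intro ε hε h0 hlim φ hφ hK
      obtain ⟨C, hC⟩ := hgrowth φ hφ
      obtain ⟨B, hB⟩ := FermiGas.exists_boundedByBox hC hK
      have hΦ : φ ∈ FermiGas.testSpace d R := FermiGas.mem_testSpace_of_continuous hφ.1 hB
      refine ⟨fun n => FermiGas.integrable_fluctuation_mul hp hf (hε n) hφ.1.measurable hB,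
        FermiGas.integrable_fermiDensity_mul hR F ⟨φ, hΦ⟩, ?_⟩
      have h := FermiGas.tendsto_functional_of_tendsto_fluctuationMeasure hp hf (hseq ε hε h0)
        hlim ⟨φ, hΦ⟩ hφ.1 hK
      rw [← FermiGas.integral_fermiDensity_mul hR] at h
      exact h
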